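/- **Setting.** Let $G=(V,E)$ be an underlying graph (vertices are named by natural numbers). A fully dynamic stream is a finite sequence of $M$ updates, fixed in advance; each update inserts an inactive vertex or deletes an active one, and initially no vertex is active. Let $V^t$ be the set of active vertices after the $t$-th update and $G^t=G[V^t]$. The algorithm can test in constant time whether two vertices are adjacent in the current graph (query access to its adjacency matrix). For a ranking $\pi:V\to[0,1]$, the lexicographically first MIS $\mathrm{LFMIS}(G^t,\pi)$ is the maximal independent set obtained by repeatedly selecting the alive vertex of smallest rank and killing it and all its alive neighbours, where initially all vertices of $V^t$ are alive. $\mathrm{LFMIS}_k(G^t,\pi)$ consists of its first $\min\{k,|\mathrm{LFMIS}(G^t,\pi)|\}$ vertices, ordered by $\pi$. A top-$k$ LFMIS with leaders of $G^t$ is the set $\mathrm{LFMIS}_k(G^t,\pi)$ together with a map $\ell:V^t\to V^t\cup\{\bot\}$ such that $\{v,\ell(v)\}$ is an edge of $G^t$ whenever $\ell(v)\neq\bot$, and such that, if $\mathrm{LFMIS}_k(G^t,\pi)=\mathrm{LFMIS}(G^t,\pi)$, then $\ell(v)\in\mathrm{LFMIS}_k(G^t,\pi)$ for all $v\in V^t\setminus\mathrm{LFMIS}_k(G^t,\pi)$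 and $\ell(v)=\bot$ for all $v\in\mathrm{LFMIS}_k(G^t,\pi)$. **Theorem.** There are a single randomized algorithm (a program for a unit-cost random access machine that can draw, copy and compare independent uniform random elements of $[0,1]$ and whose only operations on integers are copying, comparing, incrementing, decrementing and halving) and an absolute constant $C$ such that the following holds for every $k\ge 1$ (given to the algorithm), every graph $G$ and every such stream. There is a random ranking $\pi:V\to[0,1]$, a function of the random source of the algorithm, whose values are independent and uniform on $[0,1]$, such that almost surely the algorithm holds, at all time steps $t$, a top-$k$ LFMIS with leaders of $G^t$ with respect to $\pi$. Moreover, for every $n\ge 2$ such that at most $n$ vertices are active at any time, the expected total running time over the $M$ updates is at most $C\,M\,(k\log n+\log^2 n)$; that is, the expected amortized time per update is $O(k\log n+\log^2 n)$. The algorithm is given neither $n$ nor $M$. -/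

import Mathlib

open MeasureTheory
open scoped unitInterval ENNReal

/-! # Fully dynamic graphs with vertex updates

Vertices of the underlying graph are named by natural numbers. -/

/-- One update of a fully dynamic stream: a vertex is inserted or deleted. -/
inductive Update where
  | ins (v : ℕ)
  | del (v : ℕ)

/-- The set of active vertices after one more update. -/
def Update.apply (A : Finset ℕ) : Update → Finset ℕ
  | .ins v => insert v A
  | .del v => A.erase v

/-- The set of active vertices after a sequence of updates; initially no vertex is active. -/
def activeAfter (l : List Update) : Finset ℕ :=
  l.foldl Update.apply ∅

/-- An update is admissible if it inserts an inactive vertex or deletes an active one. -/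
def Update.Admissible (A : Finset ℕ) : Update → Prop
  | .ins v => v ∉ A
  | .del v => v ∈ A

/-- A stream is valid if each update is admissible at the time at which it arrives. -/
def ValidStream (l : List Update) : Prop :=
  ∀ t (ht : t < l.length), (l[t]).Admissible (activeAfter (l.take t))

/-- The subgraph of `G` induced by the active vertices (inactive vertices are isolated). -/
def activeGraph (G : SimpleGraph ℕ) (A : Finset ℕ) : SimpleGraph ℕ where
  Adj u v := G.Adj u v ∧ u ∈ A ∧ v ∈ A
  symm := ⟨fun _ _ h => ⟨h.1.symm, h.2.2, h.2.1⟩⟩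
  loopless := ⟨fun v h => G.loopless.irrefl v h.1⟩

/-! # Lexicographically first maximal independent sets -/

/-- A vertex of minimal rank in a nonempty set (unique if ranks are distinct). -/
noncomputable def minRank (π : ℕ → I) (A : Finset ℕ) (h : A.Nonempty) : ℕ :=
  (A.exists_min_image π h).choose

theorem minRank_mem (π : ℕ → I) (A : Finset ℕ) (h : A.Nonempty) : minRank π A h ∈ A :=
  (A.exists_min_image π h).choose_spec.1

open Classical in
/-- The greedy process on the set `A` of alive vertices: select the alive vertex of minimal rank,
kill it and its alive neighbours, and continue. The result lists the selected vertices in the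
order of their selection, that is, by increasing rank. -/
noncomputable def greedyMIS (G : SimpleGraph ℕ) (π : ℕ → I) (A : Finset ℕ) : List ℕ :=
  if h : A.Nonempty then
    minRank π A h ::
      greedyMIS G π (A.filter fun u => u ≠ minRank π A h ∧ ¬ G.Adj (minRank π A h) u)
  else []
termination_by A.card
decreasing_by
  exact Finset.card_lt_card
    (Finset.filter_ssubset.2 ⟨minRank π A h, minRank_mem π A h, fun hc => hc.1 rfl⟩)

/-- The LFMIS of the subgraph of `G` induced by `A`, with respect to the ranking `π`. -/
noncomputable def LFMIS (G : SimpleGraph ℕ) (π : ℕ → I) (A : Finset ℕ) : Finset ℕ :=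
  (greedyMIS G π A).toFinset

/-- The top-`k` LFMIS: the first `min k |LFMIS|` vertices of the LFMIS, ordered by rank. -/
noncomputable def topLFMIS (k : ℕ) (G : SimpleGraph ℕ) (π : ℕ → I) (A : Finset ℕ) : Finset ℕ :=
  ((greedyMIS G π A).take k).toFinset

/-- `(S, l)` is a top-`k` LFMIS with leaders of the subgraph of `G` induced by `A`
(`none` stands for `⊥`; only the leaders of vertices in `A` matter). -/
structure IsTopLFMISWithLeaders (k : ℕ) (G : SimpleGraph ℕ) (π : ℕ → I) (A : Finset ℕ)
    (S : Finset ℕ) (l : ℕ → Option ℕ) : Prop where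
  set_eq : S = topLFMIS k G π A
  leader_adj : ∀ v ∈ A, ∀ u, l v = some u → u ∈ A ∧ G.Adj v u
  leader_mem : topLFMIS k G π A = LFMIS G π A →
    ∀ v ∈ A, v ∉ topLFMIS k G π A → ∃ u ∈ topLFMIS k G π A, l v = some u
  leader_none : topLFMIS k G π A = LFMIS G π A → ∀ v ∈ topLFMIS k G π A, l v = none

/-! # The machine model

A randomized random access machine with unit cost instructions. It has finitely many number
variables, finitely many arrays of numbers and finitely many arrays of ranks (those that its program
mentions), oracle access to the adjacency matrix of the current graph, and a source of independent
uniform random elements of `[0,1]`, which it can draw, copy and compare, but not otherwise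
operate on. A number can only be copied, compared, incremented, decremented and halved. So after
`T` steps the numbers exceed those of the input and of the program by at most `T`; the unit cost of
an instruction is thus that of a machine with words of logarithmic length. -/

/-- The elementary instructions. Variables and arrays have numerals as names; array indices are
the values of variables. -/
inductive Instr where
  /-- `x := c` -/
  | const (x c : ℕ)
  /-- `x := y` -/
  | copy (x y : ℕ)
  /-- `x := x + 1` -/
  | inc (x : ℕ)
  /-- `x := x - 1`, and `0` stays `0` -/
  | dec (x : ℕ)
  /-- `x := ⌊x / 2⌋` -/
  | half (x : ℕ)
  /-- `x := a[i]` -/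
  | load (x a i : ℕ)
  /-- `a[i] := x` -/
  | store (a i x : ℕ)
  /-- `x := 1` if the vertices `u` and `v` are adjacent in the current graph, else `x := 0` -/
  | adj (x u v : ℕ)
  /-- draw a fresh uniform random element of `[0,1]` into the rank cell `a[i]` -/
  | draw (a i : ℕ)
  /-- `a[i] := b[j]` for rank cells -/
  | copyRank (a i b j : ℕ)
  /-- `x := 1` if `a[i] < b[j]` for rank cells, else `x := 0` -/
  | lessRank (x a i b j : ℕ)

/-- Tests on number variables: `x = y` and `x < y`. -/
inductive Test where
  | eq (x y : ℕ)
  | lt (x y : ℕ)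

/-- Programs. -/
inductive Prog where
  | skip
  | instr (c : Instr)
  | seq (p q : Prog)
  | ite (b : Test) (p q : Prog)
  | while (b : Test) (p : Prog)

/-- A state of the machine. -/
structure MState where
  /-- the number variables -/
  var : ℕ → ℕ
  /-- the arrays of numbers -/
  arr : ℕ → ℕ → ℕ
  /-- the arrays of ranks -/
  rank : ℕ → ℕ → I
  /-- how many random elements have been drawn so far -/
  drawn : ℕ

namespace MState

/-- Assign a number to a variable. -/
def setVar (s : MState) (x n : ℕ) : MState :=
  { s with var := Function.update s.var x n }

/-- Assign a number to an array cell. -/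
def setArr (s : MState) (a i n : ℕ) : MState :=
  { s with arr := Function.update s.arr a (Function.update (s.arr a) i n) }

/-- Assign a rank to a rank cell. -/
def setRank (s : MState) (a i : ℕ) (r : I) : MState :=
  { s with rank := Function.update s.rank a (Function.update (s.rank a) i r) }

end MState

open Classical in
/-- The effect of an instruction, for the current graph `H` and the random source `ω`. -/
noncomputable def Instr.step (H : SimpleGraph ℕ) (ω : ℕ → I) (s : MState) : Instr → MState
  | .const x c => s.setVar x c
  | .copy x y => s.setVar x (s.var y)
  | .inc x => s.setVar x (s.var x + 1)
  | .dec x => s.setVar x (s.var x - 1)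
  | .half x => s.setVar x (s.var x / 2)
  | .load x a i => s.setVar x (s.arr a (s.var i))
  | .store a i x => s.setArr a (s.var i) (s.var x)
  | .adj x u v => s.setVar x (if H.Adj (s.var u) (s.var v) then 1 else 0)
  | .draw a i => { s.setRank a (s.var i) (ω s.drawn) with drawn := s.drawn + 1 }
  | .copyRank a i b j => s.setRank a (s.var i) (s.rank b (s.var j))
  | .lessRank x a i b j =>
      s.setVar x (if s.rank a (s.var i) < s.rank b (s.var j) then 1 else 0)

/-- The truth of a test. -/
def Test.Holds (s : MState) : Test → Prop
  | .eq x y => s.var x = s.var y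
  | .lt x y => s.var x < s.var y

/-- `Exec H ω p s s' T`: the program `p`, started in the state `s`, halts in the state `s'` after
`T` steps, where every elementary instruction and every evaluation of a test is one step. -/
inductive Exec (H : SimpleGraph ℕ) (ω : ℕ → I) : Prog → MState → MState → ℕ → Prop where
  | skip (s : MState) : Exec H ω .skip s s 0
  | instr (c : Instr) (s : MState) : Exec H ω (.instr c) s (c.step H ω s) 1
  | seq {p q : Prog} {s s' s'' : MState} {T T' : ℕ} :
      Exec H ω p s s' T → Exec H ω q s' s'' T' → Exec H ω (.seq p q) s s'' (T + T')
  | ite_true {b : Test} {p q : Prog} {s s' : MState} {T : ℕ} :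
      b.Holds s → Exec H ω p s s' T → Exec H ω (.ite b p q) s s' (T + 1)
  | ite_false {b : Test} {p q : Prog} {s s' : MState} {T : ℕ} :
      ¬ b.Holds s → Exec H ω q s s' T → Exec H ω (.ite b p q) s s' (T + 1)
  | while_true {b : Test} {p : Prog} {s s' s'' : MState} {T T' : ℕ} :
      b.Holds s → Exec H ω p s s' T → Exec H ω (.while b p) s' s'' T' →
        Exec H ω (.while b p) s s'' (T + T' + 1)
  | while_false {b : Test} {p : Prog} {s : MState} :
      ¬ b.Holds s → Exec H ω (.while b p) s s 1

/-! # Dynamic algorithms on this machine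

Input and output conventions: variable `0` initially holds `k`; variables `1` and `2` receive the
type (`1` for an insertion, `0` for a deletion) and the vertex of each update. After each update,
variable `3` holds the size of the maintained set, whose elements are listed in the cells
`0, 1, 2, …` of array `0`, and cell `v` of array `1` holds `0` if the leader of `v` is `⊥`, and
`u + 1` if it is `u`. Everything is `0` at the beginning, except for variable `0`. -/

/-- The initial state. -/
def initState (k : ℕ) : MState where
  var x := if x = 0 then k else 0
  arr _ _ := 0
  rank _ _ := 0
  drawn := 0

/-- The state in which the processing of an update begins. -/
def MState.receive (s : MState) : Update → MState
  | .ins v => (s.setVar 1 1).setVar 2 v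
  | .del v => (s.setVar 1 0).setVar 2 v

/-- The list of vertices that the machine presents as its set. -/
def MState.outList (s : MState) : List ℕ :=
  (List.range (s.var 3)).map (s.arr 0)

/-- The leader mapping that the machine presents. -/
def MState.outLeader (s : MState) (v : ℕ) : Option ℕ :=
  if s.arr 1 v = 0 then none else some (s.arr 1 v - 1)

/-- `Runs P k G ω l s T`: the program `P`, run once for each update in `l` (with the memory kept
between updates), halts after each of them, ends in the state `s`, and takes `T` steps in total.
While an update is processed, the adjacency oracle answers for the graph after that update. -/
inductive Runs (P : Prog) (k : ℕ) (G : SimpleGraph ℕ) (ω : ℕ → I) :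
    List Update → MState → ℕ → Prop where
  | nil : Runs P k G ω [] (initState k) 0
  | snoc {l : List Update} {u : Update} {s s' : MState} {T T' : ℕ} :
      Runs P k G ω l s T →
      Exec (activeGraph G (activeAfter (l ++ [u]))) ω P (s.receive u) s' T' →
        Runs P k G ω (l ++ [u]) s' (T + T')

/-- The total running time on a sequence of updates; it is `∞` if the program does not halt. -/
noncomputable def totalTime (P : Prog) (k : ℕ) (G : SimpleGraph ℕ) (l : List Update)
    (ω : ℕ → I) : ℝ≥0∞ :=
  ⨅ (T : ℕ) (_ : ∃ s, Runs P k G ω l s T), (T : ℝ≥0∞)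

/-- After each update in `l`, the machine holds a top-`k` LFMIS with leaders of the current graph
with respect to the ranking `π`. -/
def Maintains (P : Prog) (k : ℕ) (G : SimpleGraph ℕ) (l : List Update) (ω : ℕ → I)
    (π : ℕ → I) : Prop :=
  ∀ t ≤ l.length, ∃ s T, Runs P k G ω (l.take t) s T ∧ s.outList.Nodup ∧
    IsTopLFMISWithLeaders k G π (activeAfter (l.take t)) s.outList.toFinset s.outLeader

/-- The law of a sequence of independent uniform random elements of `[0,1]`. -/
noncomputable def uniformSeq : Measure (ℕ → I) :=
  Measure.infinitePi fun _ : ℕ => (volume : Measure I)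

/-! # The greedy maximal independent set -/

/-! The algorithm. The machine keeps the first `k + 1` members of the LFMIS as a list `S` sorted by
rank, a binary heap `Q` of vertices still to be placed, and for every other active vertex a leader,
which is an earlier neighbour in `S` or `Q`. Between updates either `Q` is empty, or `S` is full and
precedes all of `Q`; then `S` is an initial segment of the greedy set (`eq_take_greedyMIS`,
`Rest.take_greedyMIS`). An update places vertices into `Q` and then pops them by increasing rank. A
popped vertex either becomes a follower of its first neighbour in `S`, if that neighbour precedes
it, or it enters `S`, turns its later neighbours in `S` into its followers, and pushes the last
element of an overfull list back into `Q`. A vertex that becomes a follower, and a deleted one,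
returns its own followers to `Q`. A round costs `O(k + log n)`, plus `O(log n)` per returned
follower.

Amortization. Call the first greedy vertex that equals or is adjacent to `w` the eliminator of `w`,
and let `D` be the number of vertices whose eliminator changes in the update. A follower that is
returned loses a leader that is not in the new greedy set, so its leader was already wrong or its
eliminator changes. A leader assigned during the update is the eliminator at its end. A vertex whose
entry pushes another one out is new in the greedy set. Hence, with the potential `|Q| + 2 *
|wrong|`, an update has amortized cost `O((k + log n) * (1 + D))` (`Hist.card_dumped_add_wrong_le`,
`Hist.card_fresh_le`, `AtRest.wp_finish`).

Expectation. It remains to see that `D` has expectation `O(log n)`. Run the greedy processes on `A`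
and on `A.erase v` along the same uniformly random order. Let `F` count the edges between the
vertices alive in exactly one process (the single ones) and those alive in both (the common ones).
Handling a single vertex separates the fates of its common neighbours only, so with `r + 1` vertices
to come the expected number of newly separated vertices is `F / (r + 1)`. On average the number of
single vertices shrinks by the factor `r / (r + 1)`, and the expected new `F` is at most `(r * F - ∑
b²) / (r + 1)`, where `b` runs over the numbers of common neighbours of the single vertices: a
single vertex with many common neighbours is likely to be killed by one of them. The quadratic term
permits a linear potential in the two quantities, `pot`, that starts at a harmonic number plus at
most `1` (`sum_changed_le`, `sum_changed_erase_le`).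

Randomness. A rank is drawn at the first insertion of a vertex and kept for ever. As the stream is
fixed in advance, the ranking is the random source reindexed by a fixed permutation, hence again
independent and uniform. -/

theorem minRank_le (π : ℕ → I) (A : Finset ℕ) (h : A.Nonempty) {v : ℕ} (hv : v ∈ A) :
    π (minRank π A h) ≤ π v :=
  (A.exists_min_image π h).choose_spec.2 v hv

open Classical in
/-- The vertices of `A` that survive the selection of `m`. -/
noncomputable def survivors (G : SimpleGraph ℕ) (m : ℕ) (A : Finset ℕ) : Finset ℕ :=
  A.filter fun u => u ≠ m ∧ ¬ G.Adj m u

theorem mem_survivors {G : SimpleGraph ℕ} {m u : ℕ} {A : Finset ℕ} :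
    u ∈ survivors G m A ↔ u ∈ A ∧ u ≠ m ∧ ¬ G.Adj m u := by
  simp [survivors]

theorem survivors_ssubset {G : SimpleGraph ℕ} {m : ℕ} {A : Finset ℕ} (h : m ∈ A) :
    survivors G m A ⊂ A := by
  classical
  exact Finset.filter_ssubset.2 ⟨m, h, fun hc => hc.1 rfl⟩

theorem greedyMIS_empty (G : SimpleGraph ℕ) (π : ℕ → I) : greedyMIS G π ∅ = [] := by
  rw [greedyMIS]; simp

theorem greedyMIS_cons (G : SimpleGraph ℕ) (π : ℕ → I) {A : Finset ℕ} (h : A.Nonempty) :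
    greedyMIS G π A = minRank π A h :: greedyMIS G π (survivors G (minRank π A h) A) := by
  rw [greedyMIS]; simp [h, survivors]

theorem mem_of_mem_greedyMIS {G : SimpleGraph ℕ} {π : ℕ → I} {A : Finset ℕ} {v : ℕ}
    (hv : v ∈ greedyMIS G π A) : v ∈ A := by
  induction A using Finset.strongInduction with
  | H A ih =>
    rcases A.eq_empty_or_nonempty with rfl | h
    · simp [greedyMIS_empty] at hv
    · rw [greedyMIS_cons G π h, List.mem_cons] at hv
      rcases hv with rfl | hv
      · exact minRank_mem π A h
      · exact (mem_survivors.1 (ih _ (survivors_ssubset (minRank_mem π A h)) hv)).1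

theorem greedyMIS_sorted (G : SimpleGraph ℕ) {π : ℕ → I} (hπ : π.Injective) (A : Finset ℕ) :
    (greedyMIS G π A).Pairwise (fun a b => π a < π b) := by
  induction A using Finset.strongInduction with
  | H A ih =>
    rcases A.eq_empty_or_nonempty with rfl | h
    · simp [greedyMIS_empty]
    · rw [greedyMIS_cons G π h, List.pairwise_cons]
      refine ⟨fun b hb => ?_, ih _ (survivors_ssubset (minRank_mem π A h))⟩
      have := mem_survivors.1 (mem_of_mem_greedyMIS hb)
      exact lt_of_le_of_ne (minRank_le π A h this.1) fun e => this.2.1 (hπ e).symm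

theorem greedyMIS_nodup (G : SimpleGraph ℕ) {π : ℕ → I} (hπ : π.Injective) (A : Finset ℕ) :
    (greedyMIS G π A).Nodup :=
  (greedyMIS_sorted G hπ A).imp fun h e => (e ▸ h).ne rfl

theorem greedyMIS_indep {G : SimpleGraph ℕ} {π : ℕ → I} {A : Finset ℕ} {a b : ℕ}
    (ha : a ∈ greedyMIS G π A) (hb : b ∈ greedyMIS G π A) : ¬ G.Adj a b := by
  induction A using Finset.strongInduction with
  | H A ih =>
    rcases A.eq_empty_or_nonempty with rfl | h
    · simp [greedyMIS_empty] at ha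
    · rw [greedyMIS_cons G π h, List.mem_cons] at ha hb
      rcases ha with rfl | ha <;> rcases hb with rfl | hb
      · exact G.loopless.irrefl _
      · exact (mem_survivors.1 (mem_of_mem_greedyMIS hb)).2.2
      · exact fun e => (mem_survivors.1 (mem_of_mem_greedyMIS ha)).2.2 e.symm
      · exact ih _ (survivors_ssubset (minRank_mem π A h)) ha hb

/-- A sorted independent list that dominates everything below its last element is an initial
segment of the greedy maximal independent set. -/
theorem eq_take_greedyMIS {G : SimpleGraph ℕ} {π : ℕ → I} {S : List ℕ}
    {A : Finset ℕ} (hS : S.Pairwise (fun a b => π a < π b)) (hA : ∀ v ∈ S, v ∈ A)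
    (hi : ∀ a ∈ S, ∀ b ∈ S, ¬ G.Adj a b)
    (hd : ∀ v ∈ A, v ∈ S ∨ (∃ s ∈ S, π s < π v ∧ G.Adj s v) ∨ ∀ s ∈ S, π s < π v) :
    (greedyMIS G π A).take S.length = S := by
  induction S generalizing A with
  | nil => simp
  | cons s S ih =>
    have hne : A.Nonempty := ⟨s, hA s (by simp)⟩
    -- The minimal vertex of `A` has nothing below it that could dominate it, and it does not follow
    -- the whole list, since `s` itself lies in `A`.
    have hms : minRank π A hne = s := by
      have h1 := minRank_le π A hne (hA s (by simp))
      rcases hd _ (minRank_mem π A hne) with h | ⟨x, hx, hlt, -⟩ | h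
      · rcases List.mem_cons.1 h with h | h
        · exact h
        · exact absurd ((List.pairwise_cons.1 hS).1 _ h) (not_lt.2 h1)
      · exact absurd hlt (not_lt.2 (minRank_le π A hne (hA x hx)))
      · exact absurd (h s (by simp)) (not_lt.2 h1)
    rw [greedyMIS_cons G π hne, hms, List.length_cons, List.take_succ_cons]
    congr 1
    have hlt := (List.pairwise_cons.1 hS).1
    refine ih (List.pairwise_cons.1 hS).2 (fun v hv => mem_survivors.2 ⟨hA v (by simp [hv]), ?_, ?_⟩)
      (fun a ha b hb => hi a (by simp [ha]) b (by simp [hb])) fun v hv => ?_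
    · rintro rfl
      exact (hlt _ hv).ne rfl
    · exact hi s (by simp) v (by simp [hv])
    · obtain ⟨hvA, hvs, hadj⟩ := mem_survivors.1 hv
      rcases hd v hvA with h | ⟨x, hx, hlt, hx'⟩ | h
      · exact .inl ((List.mem_cons.1 h).resolve_left hvs)
      · rcases List.mem_cons.1 hx with rfl | hx
        · exact absurd hx' hadj
        · exact .inr (.inl ⟨x, hx, hlt, hx'⟩)
      · exact .inr (.inr fun x hx => h x (by simp [hx]))

/-! # Eliminators -/

open Classical in
/-- The eliminator of an active vertex `w`: the member of the greedy maximal independent set of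
least rank that equals `w` or is adjacent to `w`. -/
noncomputable def elim (G : SimpleGraph ℕ) (π : ℕ → I) (A : Finset ℕ) (w : ℕ) : Option ℕ :=
  if w ∈ A then (greedyMIS G π A).find? fun u => u = w ∨ G.Adj u w else none

theorem elim_some {G : SimpleGraph ℕ} {π : ℕ → I} {A : Finset ℕ} {w u : ℕ}
    (h : elim G π A w = some u) : u ∈ greedyMIS G π A ∧ (u = w ∨ G.Adj u w) := by
  unfold elim at h
  split_ifs at h
  exact ⟨List.mem_of_find?_eq_some h, by simpa using List.find?_some h⟩

theorem find?_eq_some_of_sorted {π : ℕ → I} {L : List ℕ} (hL : L.Pairwise (fun a b => π a < π b))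
    {p : ℕ → Bool} {u : ℕ} (hu : u ∈ L) (hp : p u) (hmin : ∀ x ∈ L, p x → π u ≤ π x) :
    L.find? p = some u := by
  induction L with
  | nil => simp at hu
  | cons a L ih =>
    rw [List.pairwise_cons] at hL
    rw [List.find?_cons]
    by_cases ha : p a
    · simp only [ha]
      rcases List.mem_cons.1 hu with rfl | hu
      · rfl
      · exact absurd (hL.1 u hu) (not_lt.2 (hmin a (by simp) ha))
    · simp only [ha]
      rcases List.mem_cons.1 hu with rfl | hu
      · exact absurd hp ha
      · exact ih hL.2 hu fun x hx => hmin x (by simp [hx])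

theorem elim_eq_of_min {G : SimpleGraph ℕ} {π : ℕ → I} (hπ : π.Injective) {A : Finset ℕ} {w u : ℕ}
    (hw : w ∈ A) (hu : u ∈ greedyMIS G π A) (hadj : u = w ∨ G.Adj u w)
    (hmin : ∀ x ∈ greedyMIS G π A, (x = w ∨ G.Adj x w) → π u ≤ π x) :
    elim G π A w = some u := by
  unfold elim
  rw [if_pos hw]
  exact find?_eq_some_of_sorted (greedyMIS_sorted G hπ A) hu (by simpa using hadj)
    fun x hx hp => hmin x hx (by simpa using hp)

theorem elim_self {G : SimpleGraph ℕ} {π : ℕ → I} (hπ : π.Injective) {A : Finset ℕ} {w : ℕ}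
    (hw : w ∈ greedyMIS G π A) : elim G π A w = some w :=
  elim_eq_of_min hπ (mem_of_mem_greedyMIS hw) hw (.inl rfl) fun x hx h => by
    rcases h with rfl | h
    · exact le_rfl
    · exact absurd h (greedyMIS_indep hx hw)

/-! # The greedy process along a list of vertices -/

open Classical in
/-- The greedy process that handles the vertices in the order of the list, with `X` alive. -/
noncomputable def misAlong (G : SimpleGraph ℕ) : List ℕ → Finset ℕ → List ℕ
  | [], _ => []
  | u :: o, X => if u ∈ X then u :: misAlong G o (survivors G u X) else misAlong G o X

/-- The list may contain vertices outside `X`, which are skipped. This lets processes with different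
alive sets run in lockstep along one list, as the comparison of two of them requires. -/
theorem greedyMIS_eq_misAlong (G : SimpleGraph ℕ) {π : ℕ → I} {o : List ℕ} {X : Finset ℕ}
    (ho : o.Pairwise (fun a b => π a < π b)) (hX : ∀ x ∈ X, x ∈ o) :
    greedyMIS G π X = misAlong G o X := by
  induction o generalizing X with
  | nil =>
    have : X = ∅ := Finset.eq_empty_of_forall_notMem fun x hx => by simpa using hX x hx
    simp [this, greedyMIS_empty, misAlong]
  | cons u o ih =>
    rw [List.pairwise_cons] at ho
    by_cases hu : u ∈ X
    · have hne : X.Nonempty := ⟨u, hu⟩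
      have hm : minRank π X hne = u := by
        rcases List.mem_cons.1 (hX _ (minRank_mem π X hne)) with h | h
        · exact h
        · exact absurd (ho.1 _ h) (not_lt.2 (minRank_le π X hne hu))
      rw [greedyMIS_cons G π hne, hm, misAlong, if_pos hu, ih ho.2]
      intro x hx
      obtain ⟨h1, h2, -⟩ := mem_survivors.1 hx
      exact (List.mem_cons.1 (hX x h1)).resolve_left h2
    · rw [misAlong, if_neg hu, ih ho.2]
      intro x hx
      exact (List.mem_cons.1 (hX x hx)).resolve_left (by rintro rfl; exact hu hx)

open Classical in
/-- The eliminator of `w` in the greedy process along a list. -/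
noncomputable def elimAlong (G : SimpleGraph ℕ) (o : List ℕ) (X : Finset ℕ) (w : ℕ) : Option ℕ :=
  if w ∈ X then (misAlong G o X).find? fun u => u = w ∨ G.Adj u w else none

theorem elim_eq_elimAlong (G : SimpleGraph ℕ) {π : ℕ → I} {o : List ℕ} {X : Finset ℕ}
    (ho : o.Pairwise (fun a b => π a < π b)) (hX : ∀ x ∈ X, x ∈ o) (w : ℕ) :
    elim G π X w = elimAlong G o X w := by
  rw [elim, elimAlong, greedyMIS_eq_misAlong G ho hX]

/-- The alive set after the vertex `u` has been handled. -/
noncomputable def aliveNext (G : SimpleGraph ℕ) (u : ℕ) (X : Finset ℕ) : Finset ℕ :=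
  if u ∈ X then survivors G u X else X

theorem mem_aliveNext {G : SimpleGraph ℕ} {u x : ℕ} {X : Finset ℕ} :
    x ∈ aliveNext G u X ↔ x ∈ X ∧ (u ∈ X → x ≠ u ∧ ¬ G.Adj u x) := by
  unfold aliveNext
  split_ifs with h <;> simp [h, mem_survivors]

open Classical in
theorem elimAlong_cons_of_mem {G : SimpleGraph ℕ} {u w : ℕ} {o : List ℕ} {X : Finset ℕ}
    (hw : w ∈ aliveNext G u X) : elimAlong G (u :: o) X w = elimAlong G o (aliveNext G u X) w := by
  have hw' := mem_aliveNext.1 hw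
  unfold elimAlong
  rw [if_pos hw'.1, if_pos hw, misAlong]
  by_cases hu : u ∈ X
  · have := hw'.2 hu
    rw [if_pos hu, List.find?_cons, aliveNext, if_pos hu]
    have h0 : decide (u = w ∨ G.Adj u w) = false := by simp [this.1.symm, this.2]
    simp only [h0]
  · rw [if_neg hu, aliveNext, if_neg hu]

open Classical in
theorem elimAlong_cons_of_killed {G : SimpleGraph ℕ} {u w : ℕ} {o : List ℕ} {X : Finset ℕ}
    (hw : w ∈ X) (hu : u ∈ X) (h : u = w ∨ G.Adj u w) : elimAlong G (u :: o) X w = some u := by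
  unfold elimAlong
  rw [if_pos hw, misAlong, if_pos hu, List.find?_cons]
  have h0 : decide (u = w ∨ G.Adj u w) = true := by simpa using h
  simp only [h0]

open Classical in
/-- The number of vertices alive in both `X` and `Y` whose eliminators differ. -/
noncomputable def changed (G : SimpleGraph ℕ) (o : List ℕ) (X Y : Finset ℕ) : ℕ :=
  ((X ∩ Y).filter fun w => elimAlong G o X w ≠ elimAlong G o Y w).card

open Classical in
/-- The number of vertices alive in both `X` and `Y` that survive the handling of `u` in only one
of the two processes. -/
noncomputable def gain (G : SimpleGraph ℕ) (u : ℕ) (X Y : Finset ℕ) : ℕ :=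
  if u ∈ symmDiff X Y then ((X ∩ Y).filter fun w => G.Adj u w).card else 0

theorem changed_nil (G : SimpleGraph ℕ) (X Y : Finset ℕ) : changed G [] X Y = 0 := by
  rw [changed, Finset.card_eq_zero, Finset.filter_eq_empty_iff]
  intro w hw
  rw [Finset.mem_inter] at hw
  simp [elimAlong, misAlong]

/-- If `u` is alive in both processes, the common vertices that it kills have the same eliminator
`u`; if in neither, nothing happens. Only a `u` alive in exactly one process separates common
vertices, and these are among its neighbours. -/
theorem changed_cons_le (G : SimpleGraph ℕ) (u : ℕ) (o : List ℕ) (X Y : Finset ℕ) :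
    changed G (u :: o) X Y ≤ gain G u X Y + changed G o (aliveNext G u X) (aliveNext G u Y) := by
  classical
  have hsub : ∀ w ∈ (X ∩ Y).filter (fun w => elimAlong G (u :: o) X w ≠ elimAlong G (u :: o) Y w),
      w ∈ aliveNext G u X ∩ aliveNext G u Y ∨ (u ∈ symmDiff X Y ∧ G.Adj u w) := by
    intro w hw
    rw [Finset.mem_filter, Finset.mem_inter] at hw
    obtain ⟨⟨hX, hY⟩, hne⟩ := hw
    by_cases h : u = w ∨ G.Adj u w
    · by_cases huX : u ∈ X <;> by_cases huY : u ∈ Y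
      · rw [elimAlong_cons_of_killed hX huX h, elimAlong_cons_of_killed hY huY h] at hne
        exact absurd rfl hne
      · refine .inr ⟨by simp [Finset.mem_symmDiff, huX, huY], h.resolve_left ?_⟩
        rintro rfl; exact huY hY
      · refine .inr ⟨by simp [Finset.mem_symmDiff, huX, huY], h.resolve_left ?_⟩
        rintro rfl; exact huX hX
      · left; simp [mem_aliveNext, hX, hY, huX, huY]
    · push Not at h
      left; simp [mem_aliveNext, hX, hY, h.1.symm, h.2]
  unfold changed
  by_cases hu : u ∈ symmDiff X Y
  · rw [gain, if_pos hu]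
    refine (Finset.card_le_card ?_).trans (Finset.card_union_le _ _)
    intro w hw
    have hw' := hw
    rw [Finset.mem_filter] at hw'
    rw [Finset.mem_union]
    rcases hsub w hw with h | h
    · right
      rw [Finset.mem_filter]
      refine ⟨h, ?_⟩
      rw [Finset.mem_inter] at h
      rw [← elimAlong_cons_of_mem h.1, ← elimAlong_cons_of_mem h.2]
      exact hw'.2
    · left
      exact Finset.mem_filter.2 ⟨hw'.1, h.2⟩
  · rw [gain, if_neg hu, zero_add]
    refine Finset.card_le_card fun w hw => ?_
    have hw' := hw
    rw [Finset.mem_filter] at hw' ⊢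
    have h := (hsub w hw).resolve_right fun h => hu h.1
    refine ⟨h, ?_⟩
    rw [Finset.mem_inter] at h
    rw [← elimAlong_cons_of_mem h.1, ← elimAlong_cons_of_mem h.2]
    exact hw'.2

/-! # Two greedy processes on the same random order -/

section TwoProcesses

open Classical in
/-- The edges between the vertices alive in one process only and those alive in both. -/
noncomputable def cutEdges (G : SimpleGraph ℕ) (X Y : Finset ℕ) : Finset (ℕ × ℕ) :=
  (symmDiff X Y ×ˢ (X ∩ Y)).filter fun e => G.Adj e.1 e.2

open Classical in
/-- The number of neighbours of `x` that are alive in both processes. -/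
noncomputable def commonDeg (G : SimpleGraph ℕ) (X Y : Finset ℕ) (x : ℕ) : ℕ :=
  ((X ∩ Y).filter fun w => G.Adj x w).card

variable (G : SimpleGraph ℕ) (X Y R : Finset ℕ)

theorem mem_cutEdges {G : SimpleGraph ℕ} {X Y : Finset ℕ} {e : ℕ × ℕ} :
    e ∈ cutEdges G X Y ↔ (e.1 ∈ symmDiff X Y ∧ e.2 ∈ X ∩ Y) ∧ G.Adj e.1 e.2 := by
  simp [cutEdges]

theorem sum_commonDeg : ∑ x ∈ symmDiff X Y, commonDeg G X Y x = (cutEdges G X Y).card := by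
  classical
  simp only [commonDeg, cutEdges, Finset.card_filter, Finset.sum_product]

theorem sum_gain (h : symmDiff X Y ⊆ R) :
    ∑ u ∈ R, gain G u X Y = (cutEdges G X Y).card := by
  classical
  rw [← sum_commonDeg]
  simp only [gain, commonDeg]
  rw [← Finset.sum_filter, Finset.filter_mem_eq_inter, Finset.inter_eq_right.2 h]

theorem symmDiff_next_of_common {u : ℕ} (hu : u ∈ X ∩ Y) :
    ∀ x ∈ symmDiff (aliveNext G u X) (aliveNext G u Y), x ∈ symmDiff X Y ∧ ¬ G.Adj u x := by
  intro x hx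
  rw [Finset.mem_inter] at hu
  simp only [Finset.mem_symmDiff, mem_aliveNext] at hx ⊢
  tauto

theorem common_next_of_common {u : ℕ} (hu : u ∈ X ∩ Y) :
    ∀ x ∈ aliveNext G u X ∩ aliveNext G u Y, x ∈ X ∩ Y ∧ x ≠ u ∧ ¬ G.Adj u x := by
  intro x hx
  rw [Finset.mem_inter] at hu
  simp only [Finset.mem_inter, mem_aliveNext] at hx ⊢
  tauto

theorem symmDiff_next_of_single {u : ℕ} (hu : u ∈ symmDiff X Y) :
    ∀ x ∈ symmDiff (aliveNext G u X) (aliveNext G u Y),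
      (x ∈ symmDiff X Y ∧ x ≠ u) ∨ (x ∈ X ∩ Y ∧ G.Adj u x) := by
  intro x hx
  simp only [Finset.mem_symmDiff, mem_aliveNext, Finset.mem_inter] at hx hu ⊢
  by_cases hxu : x = u
  · subst hxu; tauto
  · tauto

theorem common_next_of_single {u : ℕ} (hu : u ∈ symmDiff X Y) :
    ∀ x ∈ aliveNext G u X ∩ aliveNext G u Y, x ∈ X ∩ Y ∧ ¬ G.Adj u x := by
  intro x hx
  simp only [Finset.mem_symmDiff, mem_aliveNext, Finset.mem_inter] at hx hu ⊢
  tauto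

theorem aliveNext_of_notMem {u : ℕ} {X : Finset ℕ} (hu : u ∉ X) : aliveNext G u X = X :=
  if_neg hu

/-- Bookkeeping for the average over the next vertex `u`. From the current value `c`, a common `u`
loses at least `p u`, a single `u` loses `q u` and gains at most `g u`, and a `u` dead in both
processes changes nothing. -/
theorem sum_split {X Y R : Finset ℕ} (hX : X ⊆ R) (hY : Y ⊆ R) (f g : ℕ → ℕ) (c : ℕ)
    (p q : ℕ → ℕ)
    (h1 : ∀ u ∈ X ∩ Y, f u + p u ≤ c) (h2 : ∀ u ∈ symmDiff X Y, f u + q u ≤ c + g u)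
    (h3 : ∀ u ∈ R, u ∉ X → u ∉ Y → f u ≤ c) :
    ∑ u ∈ R, f u + ∑ u ∈ X ∩ Y, p u + ∑ u ∈ symmDiff X Y, q u
      ≤ R.card * c + ∑ u ∈ symmDiff X Y, g u := by
  classical
  have hB : ∀ h : ℕ → ℕ, ∑ u ∈ X ∩ Y, h u = ∑ u ∈ R, if u ∈ X ∩ Y then h u else 0 := by
    intro h
    rw [← Finset.sum_filter, Finset.filter_mem_eq_inter,
      Finset.inter_eq_right.2 (Finset.inter_subset_left.trans hX)]
  have hD : ∀ h : ℕ → ℕ, ∑ u ∈ symmDiff X Y, h u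
      = ∑ u ∈ R, if u ∈ symmDiff X Y then h u else 0 := by
    intro h
    rw [← Finset.sum_filter, Finset.filter_mem_eq_inter, Finset.inter_eq_right.2]
    intro x hx
    rcases Finset.mem_symmDiff.1 hx with h | h
    · exact hX h.1
    · exact hY h.1
  rw [hB, hD, hD, ← Finset.sum_add_distrib, ← Finset.sum_add_distrib, ← smul_eq_mul,
    ← Finset.sum_const, ← Finset.sum_add_distrib]
  refine Finset.sum_le_sum fun u hu => ?_
  by_cases hx : u ∈ X <;> by_cases hy : u ∈ Y
  · have := h1 u (by simp [hx, hy])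
    simpa [hx, hy, Finset.mem_symmDiff] using this
  · have := h2 u (by simp [hx, hy, Finset.mem_symmDiff])
    simpa [hx, hy, Finset.mem_symmDiff] using this
  · have := h2 u (by simp [hx, hy, Finset.mem_symmDiff])
    simpa [hx, hy, Finset.mem_symmDiff] using this
  · simpa [hx, hy, Finset.mem_symmDiff] using h3 u hu hx hy

variable {X Y R} in
/-- On average over the next vertex, the difference of the alive sets does not grow. -/
theorem sum_card_symmDiff_next (hX : X ⊆ R) (hY : Y ⊆ R) :
    ∑ u ∈ R, (symmDiff (aliveNext G u X) (aliveNext G u Y)).card + (symmDiff X Y).card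
      ≤ R.card * (symmDiff X Y).card := by
  classical
  have key := sum_split hX hY
    (fun u => (symmDiff (aliveNext G u X) (aliveNext G u Y)).card)
    (fun u => commonDeg G X Y u) (symmDiff X Y).card
    (fun u => ((symmDiff X Y).filter fun x => G.Adj u x).card) (fun _ => 1) ?_ ?_ ?_
  -- Double counting of the edges between single and common vertices: a common `u` kills its single
  -- neighbours, a single `u` makes its common neighbours single. These effects cancel, and what
  -- remains is that a single `u` itself disappears.
  · have hdc : ∑ u ∈ X ∩ Y, ((symmDiff X Y).filter fun x => G.Adj u x).card
        = ∑ u ∈ symmDiff X Y, commonDeg G X Y u := by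
      simp only [commonDeg, Finset.card_filter]
      rw [Finset.sum_comm]
      simp only [G.adj_comm]
    simp only [Finset.sum_const, smul_eq_mul, mul_one] at key
    omega
  · intro u hu
    rw [← Finset.card_union_of_disjoint]
    · refine Finset.card_le_card fun x hx => ?_
      rcases Finset.mem_union.1 hx with h | h
      · exact (symmDiff_next_of_common G X Y hu x h).1
      · exact (Finset.mem_filter.1 h).1
    · rw [Finset.disjoint_left]
      intro x hx hx'
      exact (symmDiff_next_of_common G X Y hu x hx).2 (Finset.mem_filter.1 hx').2
  · intro u hu
    have : (symmDiff (aliveNext G u X) (aliveNext G u Y)).card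
        ≤ ((symmDiff X Y).erase u).card + commonDeg G X Y u := by
      refine (Finset.card_le_card fun x hx => ?_).trans (Finset.card_union_le _ _)
      rw [Finset.mem_union, Finset.mem_erase, Finset.mem_filter]
      have := symmDiff_next_of_single G X Y hu x hx
      tauto
    have h2 := Finset.card_erase_add_one hu
    show _ + 1 ≤ _
    omega
  · intro u _ h1 h2
    rw [aliveNext_of_notMem G h1, aliveNext_of_notMem G h2]

variable {X Y R} in
/-- On average over the next vertex, the number of cut edges drops. -/
theorem sum_card_cutEdges_next (hX : X ⊆ R) (hY : Y ⊆ R) :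
    ∑ u ∈ R, (cutEdges G (aliveNext G u X) (aliveNext G u Y)).card + (cutEdges G X Y).card
      + ∑ x ∈ symmDiff X Y, commonDeg G X Y x ^ 2 ≤ R.card * (cutEdges G X Y).card := by
  classical
  -- `T u` bounds the new cut edges that appear when a single `u` kills `e.1` in only one process
  -- while `e.2` stays common.
  set T : ℕ → ℕ := fun u => (((X ∩ Y) ×ˢ (X ∩ Y)).filter fun e =>
    G.Adj u e.1 ∧ G.Adj e.1 e.2 ∧ ¬ G.Adj u e.2).card with hT
  have key := sum_split hX hY
    (fun u => (cutEdges G (aliveNext G u X) (aliveNext G u Y)).card)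
    T (cutEdges G X Y).card
    (fun u => ((cutEdges G X Y).filter fun e => G.Adj e.1 u).card +
      ((cutEdges G X Y).filter fun e => G.Adj e.2 u ∧ ¬ G.Adj e.1 u).card)
    (fun u => commonDeg G X Y u) ?_ ?_ ?_
  · rw [Finset.sum_add_distrib, sum_commonDeg] at key
    -- A common neighbour `u` of a single `x` kills `x` together with all its cut edges: there are
    -- `commonDeg x` such `u`, each destroying `commonDeg x` edges.
    have h1 : ∑ u ∈ X ∩ Y, ((cutEdges G X Y).filter fun e => G.Adj e.1 u).card
        = ∑ x ∈ symmDiff X Y, commonDeg G X Y x ^ 2 := by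
      simp only [cutEdges, Finset.filter_filter, Finset.card_filter, Finset.sum_product, commonDeg,
        sq, Finset.sum_mul_sum]
      rw [Finset.sum_comm]
      refine Finset.sum_congr rfl fun x _ => ?_
      refine Finset.sum_congr rfl fun u _ => ?_
      refine Finset.sum_congr rfl fun w _ => ?_
      by_cases ha : G.Adj x w <;> by_cases hb : G.Adj x u <;> simp [ha, hb]
    -- Both sides count the paths `x, w, u` with `x` single, `w` and `u` common, and `x` not
    -- adjacent to `u`. Read with `u` as the next vertex, the edge from `x` to `w` is lost; read
    -- with `x` as the next vertex, the edge from `w` to `u` is gained. So gains and losses cancel.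
    have h2 : ∑ u ∈ X ∩ Y, ((cutEdges G X Y).filter fun e => G.Adj e.2 u ∧ ¬ G.Adj e.1 u).card
        = ∑ u ∈ symmDiff X Y, T u := by
      simp only [cutEdges, Finset.filter_filter, Finset.card_filter, Finset.sum_product, hT]
      rw [Finset.sum_comm]
      refine Finset.sum_congr rfl fun x _ => ?_
      rw [Finset.sum_comm]
    omega
  · intro u hu
    rw [← Finset.card_union_of_disjoint, ← Finset.card_union_of_disjoint]
    · refine Finset.card_le_card fun e he => ?_
      rcases Finset.mem_union.1 he with h | h
      · obtain ⟨⟨h1, h2⟩, h3⟩ := mem_cutEdges.1 h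
        exact mem_cutEdges.2 ⟨⟨(symmDiff_next_of_common G X Y hu _ h1).1,
          (common_next_of_common G X Y hu _ h2).1⟩, h3⟩
      · rcases Finset.mem_union.1 h with h | h
        · exact (Finset.mem_filter.1 h).1
        · exact (Finset.mem_filter.1 h).1
    · rw [Finset.disjoint_left]
      intro e he he'
      obtain ⟨⟨h1, h2⟩, -⟩ := mem_cutEdges.1 he
      have h1 := (symmDiff_next_of_common G X Y hu _ h1).2
      have h2 := (common_next_of_common G X Y hu _ h2).2.2
      rcases Finset.mem_union.1 he' with h | h
      · exact h1 (Finset.mem_filter.1 h).2.symm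
      · exact h2 (Finset.mem_filter.1 h).2.1.symm
    · rw [Finset.disjoint_left]
      intro e he he'
      exact (Finset.mem_filter.1 he').2.2 (Finset.mem_filter.1 he).2
  · intro u hu
    have h1 : (cutEdges G (aliveNext G u X) (aliveNext G u Y)).card
        ≤ ((cutEdges G X Y).filter fun e => e.1 ≠ u).card + T u := by
      refine (Finset.card_le_card fun e he => ?_).trans (Finset.card_union_le _ _)
      obtain ⟨⟨h1, h2⟩, h3⟩ := mem_cutEdges.1 he
      have h2 := common_next_of_single G X Y hu _ h2
      rw [Finset.mem_union]
      rcases symmDiff_next_of_single G X Y hu _ h1 with h | h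
      · exact .inl (Finset.mem_filter.2 ⟨mem_cutEdges.2 ⟨⟨h.1, h2.1⟩, h3⟩, h.2⟩)
      · exact .inr (Finset.mem_filter.2 ⟨Finset.mem_product.2 ⟨h.1, h2.1⟩, h.2, h3, h2.2⟩)
    have h2 : commonDeg G X Y u = ((cutEdges G X Y).filter fun e => e.1 = u).card := by
      rw [commonDeg, ← Finset.card_map ⟨fun w => (u, w), fun a b h => (Prod.mk.inj h).2⟩]
      congr 1
      ext ⟨a, b⟩
      simp only [Finset.mem_map, Finset.mem_filter, mem_cutEdges]
      constructor
      · rintro ⟨w, ⟨h1, h2⟩, h⟩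
        cases h
        exact ⟨⟨⟨hu, h1⟩, h2⟩, rfl⟩
      · rintro ⟨⟨⟨h1, h2⟩, h3⟩, rfl⟩
        exact ⟨b, ⟨h2, h3⟩, rfl⟩
    have h3 := Finset.card_filter_add_card_filter_not (s := cutEdges G X Y) (fun e => e.1 = u)
    simp only [ne_eq] at h1
    omega
  · intro u _ h1 h2
    rw [aliveNext_of_notMem G h1, aliveNext_of_notMem G h2]

end TwoProcesses

/-! # Averages over all orders -/

/-- The lists that enumerate `R` without repetition. -/
def orders (R : Finset ℕ) : Finset (List ℕ) := R.val.lists.toFinset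

theorem mem_orders {R : Finset ℕ} {o : List ℕ} : o ∈ orders R ↔ (o : Multiset ℕ) = R.val := by
  rw [orders, Multiset.mem_toFinset, Multiset.mem_lists_iff]
  exact eq_comm

theorem mem_of_mem_orders {R : Finset ℕ} {o : List ℕ} (h : o ∈ orders R) (v : ℕ) :
    v ∈ o ↔ v ∈ R := by
  rw [← Finset.mem_val, ← mem_orders.1 h, Multiset.mem_coe]

theorem nodup_of_mem_orders {R : Finset ℕ} {o : List ℕ} (h : o ∈ orders R) : o.Nodup := by
  rw [← Multiset.coe_nodup, mem_orders.1 h]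
  exact R.nodup

theorem cons_mem_orders {R : Finset ℕ} {u : ℕ} {o : List ℕ} :
    u :: o ∈ orders R ↔ u ∈ R ∧ o ∈ orders (R.erase u) := by
  rw [mem_orders, mem_orders, Finset.erase_val, ← Multiset.cons_coe]
  constructor
  · intro h
    rw [← h]
    refine ⟨?_, by simp⟩
    rw [← Finset.mem_val, ← h]; simp
  · rintro ⟨h1, h2⟩
    rw [h2, Multiset.cons_erase h1]

theorem sum_orders {M : Type*} [AddCommMonoid M] {R : Finset ℕ} (hR : R.Nonempty)
    (F : List ℕ → M) :
    ∑ o ∈ orders R, F o = ∑ u ∈ R, ∑ o ∈ orders (R.erase u), F (u :: o) := by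
  rw [Finset.sum_sigma']
  symm
  refine Finset.sum_bij (fun x _ => x.1 :: x.2) ?_ ?_ ?_ ?_
  · rintro ⟨u, o⟩ h
    rw [Finset.mem_sigma] at h
    exact cons_mem_orders.2 h
  · rintro ⟨u, o⟩ _ ⟨u', o'⟩ _ h
    simp only [List.cons.injEq] at h
    obtain ⟨rfl, rfl⟩ := h
    rfl
  · rintro (_ | ⟨u, o⟩) h
    · obtain ⟨v, hv⟩ := hR
      exact absurd ((mem_of_mem_orders h v).2 hv) (by simp)
    · exact ⟨⟨u, o⟩, Finset.mem_sigma.2 (cons_mem_orders.1 h), rfl⟩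
  · intros; rfl

theorem orders_empty : orders ∅ = {[]} := by
  ext o
  rw [mem_orders, Finset.mem_singleton]
  simp

theorem card_orders (R : Finset ℕ) : (orders R).card = R.card.factorial := by
  induction hr : R.card generalizing R with
  | zero => rw [Finset.card_eq_zero] at hr; simp [hr, orders_empty]
  | succ r ih =>
    have hne : R.Nonempty := Finset.card_pos.1 (by omega)
    rw [Finset.card_eq_sum_ones, sum_orders hne]
    have : ∀ u ∈ R, ∑ o ∈ orders (R.erase u), 1 = r.factorial := fun u hu => by
      rw [← Finset.card_eq_sum_ones]
      exact ih _ (by rw [Finset.card_erase_of_mem hu, hr]; rfl)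
    rw [Finset.sum_congr rfl this, Finset.sum_const, hr, smul_eq_mul, Nat.factorial_succ]

/-- The weight sequence of the potential function. -/
noncomputable def potWeight (N r : ℕ) : ℝ := ∑ i ∈ Finset.range r, (N : ℝ) / ((N : ℝ) - i)

/-- The potential function of two processes with `r` of `N` vertices yet to come. -/
noncomputable def pot (G : SimpleGraph ℕ) (N r : ℕ) (X Y : Finset ℕ) : ℝ :=
  potWeight N r / r * (symmDiff X Y).card +
    ((N : ℝ) - r + 1) / N * (cutEdges G X Y).card

theorem potWeight_nonneg {N r : ℕ} (h : r ≤ N) : 0 ≤ potWeight N r := by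
  refine Finset.sum_nonneg fun i hi => div_nonneg (Nat.cast_nonneg _) ?_
  rw [sub_nonneg, Nat.cast_le]
  exact ((Finset.mem_range.1 hi).le).trans h

/-- The contribution to the induction step for `pot` of one single vertex with `b` common
neighbours. The increment `N / (N - r)` of `potWeight` is what completes the square in `b`. -/
theorem pot_coeff {N r : ℝ} (hr : 0 ≤ r) (h : r + 1 ≤ N) (b : ℝ) (hb : 0 ≤ b) :
    b + (N - r + 1) / N * (r * b - b ^ 2) ≤ N / (N - r) + (r + 1) * ((N - (r + 1) + 1) / N * b) := by
  have hN : 0 < N := by linarith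
  have hNr : 0 < N - r := by linarith
  have h1 : N / (N - r) + (r + 1) * ((N - (r + 1) + 1) / N * b) -
      (b + (N - r + 1) / N * (r * b - b ^ 2))
      = (N ^ 2 / (N - r) - 2 * r * b + (N - r + 1) * b ^ 2) / N := by
    field_simp
    ring
  have h2 : 0 ≤ N ^ 2 / (N - r) - 2 * r * b + (N - r + 1) * b ^ 2 := by
    -- Compared with the expression in `h2`, this square lacks exactly `2 * (N - r) * b + b ^ 2`,
    -- which is nonnegative.
    have h3 : N ^ 2 / (N - r) - 2 * N * b + (N - r) * b ^ 2 = (N - (N - r) * b) ^ 2 / (N - r) := by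
      field_simp
      ring
    have h4 : 0 ≤ (N - (N - r) * b) ^ 2 / (N - r) := by positivity
    nlinarith [sq_nonneg b, mul_nonneg hNr.le hb]
  have := div_nonneg h2 hN.le
  linarith

/-- The potential bounds the average number of vertices whose eliminators differ. -/
theorem sum_changed_le (G : SimpleGraph ℕ) {N : ℕ} {R X Y : Finset ℕ} (hN : R.card ≤ N)
    (hX : X ⊆ R) (hY : Y ⊆ R) :
    ∑ o ∈ orders R, (changed G o X Y : ℝ) ≤ R.card.factorial * pot G N R.card X Y := by
  induction hr : R.card generalizing R X Y with
  | zero =>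
    rw [Finset.card_eq_zero] at hr
    subst hr
    rw [Finset.subset_empty] at hX hY
    subst hX hY
    simp [orders_empty, changed_nil, pot, cutEdges]
  | succ r ih =>
    have hne : R.Nonempty := Finset.card_pos.1 (by omega)
    have hrN : r + 1 ≤ N := hr ▸ hN
    have hN0 : (0 : ℝ) < N := by exact_mod_cast (by omega : 0 < N)
    have hrN' : (r : ℝ) + 1 ≤ N := by exact_mod_cast hrN
    have hsub : ∀ u, ∀ Z ⊆ R, aliveNext G u Z ⊆ R.erase u := by
      intro u Z hZ x hx
      rw [mem_aliveNext] at hx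
      rw [Finset.mem_erase]
      refine ⟨?_, hZ hx.1⟩
      rintro rfl
      exact (hx.2 hx.1).1 rfl
    have hD : symmDiff X Y ⊆ R := by
      intro x hx
      rcases Finset.mem_symmDiff.1 hx with h | h
      · exact hX h.1
      · exact hY h.1
    rw [sum_orders hne]
    have step : ∀ u ∈ R, ∑ o ∈ orders (R.erase u), (changed G (u :: o) X Y : ℝ) ≤
        r.factorial * (gain G u X Y + pot G N r (aliveNext G u X) (aliveNext G u Y)) := by
      intro u hu
      have hc : (R.erase u).card = r := by rw [Finset.card_erase_of_mem hu, hr]; rfl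
      calc ∑ o ∈ orders (R.erase u), (changed G (u :: o) X Y : ℝ)
          ≤ ∑ o ∈ orders (R.erase u), ((gain G u X Y : ℝ) +
              changed G o (aliveNext G u X) (aliveNext G u Y)) :=
            Finset.sum_le_sum fun o _ => by exact_mod_cast changed_cons_le G u o X Y
        _ ≤ _ := by
            rw [Finset.sum_add_distrib, Finset.sum_const, card_orders, hc, nsmul_eq_mul, mul_add]
            have := ih (by omega) (hsub u X hX) (hsub u Y hY) hc
            linarith
    refine (Finset.sum_le_sum step).trans ?_
    rw [← Finset.mul_sum, Nat.factorial_succ, Nat.cast_mul, mul_comm ((r + 1 : ℕ) : ℝ), mul_assoc]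
    refine mul_le_mul_of_nonneg_left ?_ (Nat.cast_nonneg _)
    have hg : ∑ u ∈ R, (gain G u X Y : ℝ) = (cutEdges G X Y).card := by
      exact_mod_cast sum_gain G X Y R hD
    have hd : (∑ u ∈ R, ((symmDiff (aliveNext G u X) (aliveNext G u Y)).card : ℝ))
        ≤ r * (symmDiff X Y).card := by
      have := sum_card_symmDiff_next G hX hY
      rw [hr, add_mul, one_mul, Nat.add_le_add_iff_right] at this
      exact_mod_cast this
    have hf : (∑ u ∈ R, ((cutEdges G (aliveNext G u X) (aliveNext G u Y)).card : ℝ))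
        + ∑ x ∈ symmDiff X Y, (commonDeg G X Y x : ℝ) ^ 2 ≤ r * (cutEdges G X Y).card := by
      have := sum_card_cutEdges_next G hX hY
      rw [hr] at this
      have h2 : (∑ u ∈ R, (cutEdges G (aliveNext G u X) (aliveNext G u Y)).card)
        + ∑ x ∈ symmDiff X Y, commonDeg G X Y x ^ 2 ≤ r * (cutEdges G X Y).card := by linarith
      exact_mod_cast h2
    have hfr : ((cutEdges G X Y).card : ℝ) = ∑ x ∈ symmDiff X Y, (commonDeg G X Y x : ℝ) := by
      exact_mod_cast (sum_commonDeg G X Y).symm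
    have hw : potWeight N (r + 1) = potWeight N r + N / ((N : ℝ) - r) := by
      rw [potWeight, Finset.sum_range_succ, ← potWeight]
    have hβ : 0 ≤ ((N : ℝ) - r + 1) / N := div_nonneg (by linarith) hN0.le
    have hα : potWeight N r / r * ∑ u ∈ R,
        ((symmDiff (aliveNext G u X) (aliveNext G u Y)).card : ℝ)
        ≤ potWeight N r * (symmDiff X Y).card := by
      rcases Nat.eq_zero_or_pos r with h0 | h0
      · subst h0
        simp [potWeight]
      · have : (0 : ℝ) < r := by exact_mod_cast h0
        calc _ ≤ potWeight N r / r * (r * (symmDiff X Y).card) :=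
              mul_le_mul_of_nonneg_left hd (div_nonneg (potWeight_nonneg (by omega)) this.le)
          _ = _ := by field_simp
    -- Summed over the single vertices, the terms `b` give the number of cut edges, and the constant
    -- terms give the increase of `potWeight` times the number of single vertices.
    have hsum := Finset.sum_le_sum fun x (_ : x ∈ symmDiff X Y) =>
      pot_coeff (Nat.cast_nonneg r) hrN' (commonDeg G X Y x : ℝ) (Nat.cast_nonneg _)
    simp only [Finset.sum_add_distrib, ← Finset.mul_sum, Finset.sum_sub_distrib, Finset.sum_const,
      nsmul_eq_mul] at hsum
    rw [← hfr] at hsum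
    have hpot : ((r + 1 : ℕ) : ℝ) * pot G N (r + 1) X Y
        = potWeight N (r + 1) * (symmDiff X Y).card +
          (r + 1) * (((N : ℝ) - (r + 1) + 1) / N * (cutEdges G X Y).card) := by
      rw [pot]
      push_cast
      have : (r : ℝ) + 1 ≠ 0 := by positivity
      field_simp
    rw [hpot, hw, Finset.sum_add_distrib, hg]
    simp only [pot, Finset.sum_add_distrib, ← Finset.mul_sum]
    have h5 := mul_le_mul_of_nonneg_left (le_sub_iff_add_le.2 hf) hβ
    nlinarith [h5, hα, hsum]

/-- The number of vertices whose eliminator is affected by a vertex `v`, on average over all orders,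
is at most logarithmic. -/
theorem sum_changed_erase_le (G : SimpleGraph ℕ) {A : Finset ℕ} {v : ℕ} (hv : v ∈ A) :
    ∑ o ∈ orders A, (changed G o A (A.erase v) : ℝ)
      ≤ A.card.factorial * (2 + Real.log A.card) := by
  classical
  have hpos : 0 < A.card := Finset.card_pos.2 ⟨v, hv⟩
  have hN0 : (0 : ℝ) < A.card := by exact_mod_cast hpos
  refine (sum_changed_le G le_rfl subset_rfl (Finset.erase_subset v A)).trans
    (mul_le_mul_of_nonneg_left ?_ (Nat.cast_nonneg _))
  have hD : symmDiff A (A.erase v) = {v} := by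
    ext x
    simp only [Finset.mem_symmDiff, Finset.mem_erase, Finset.mem_singleton]
    constructor
    · tauto
    · rintro rfl; simp [hv]
  have hF : (cutEdges G A (A.erase v)).card ≤ A.card := by
    rw [← sum_commonDeg, hD, Finset.sum_singleton, commonDeg]
    exact Finset.card_le_card ((Finset.filter_subset _ _).trans Finset.inter_subset_left)
  have hF' : ((cutEdges G A (A.erase v)).card : ℝ) ≤ A.card := by exact_mod_cast hF
  -- With all `N` vertices to come the weights `N / (N - i)` are `N` times the harmonic terms in
  -- reverse order, so the single vertex `v` contributes the harmonic number. The cut edges have the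
  -- coefficient `1 / N` and contribute at most `1`.
  have hH : potWeight A.card A.card = A.card * (harmonic A.card : ℝ) := by
    rw [potWeight, harmonic, Rat.cast_sum, Finset.mul_sum,
      ← Finset.sum_range_reflect]
    refine Finset.sum_congr rfl fun i hi => ?_
    have := Finset.mem_range.1 hi
    rw [Nat.sub_sub, Nat.cast_sub (by omega)]
    push_cast
    rw [div_eq_mul_inv]
    congr 2
    ring
  have hlog := harmonic_le_one_add_log A.card
  rw [pot, hD, Finset.card_singleton, hH, sub_self, zero_add, Nat.cast_one, mul_one,
    mul_div_cancel_left₀ _ hN0.ne']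
  have : 1 / (A.card : ℝ) * (cutEdges G A (A.erase v)).card ≤ 1 := by
    rw [one_div, inv_mul_le_iff₀ hN0, mul_one]
    exact hF'
  linarith

/-! # Independent uniform ranks -/

instance : IsProbabilityMeasure uniformSeq := by
  unfold uniformSeq; infer_instance

/-- All factors of the product measure are equal. This symmetry is used twice: all orders of a
finite set are equally likely, and the ranks may be drawn in the order of arrival. -/
theorem measurePreserving_reindex (e : Equiv.Perm ℕ) :
    MeasurePreserving (fun ω : ℕ → I => fun v => ω (e v)) uniformSeq uniformSeq := by
  refine ⟨by fun_prop, ?_⟩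
  have h := Measure.infinitePi_map_piCongrLeft (fun _ : ℕ => (volume : Measure I)) e.symm
  have h2 : (MeasurableEquiv.piCongrLeft (fun _ : ℕ => I) e.symm : (ℕ → I) → (ℕ → I))
      = fun ω v => ω (e v) := by
    ext ω v
    have := MeasurableEquiv.piCongrLeft_apply_apply (β := fun _ => I) e.symm ω (e v)
    rw [Equiv.symm_apply_apply] at this
    rw [this]
  rw [h2] at h
  exact h

/-- Two coordinates are independent with an atomless law, so their joint law gives measure zero to
the diagonal; there are countably many pairs. -/
theorem ae_injective : ∀ᵐ ω ∂uniformSeq, Function.Injective ω := by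
  have key : ∀ a b : ℕ, a ≠ b → ∀ᵐ ω ∂uniformSeq, ω a ≠ ω b := by
    intro a b hab
    have hind : ProbabilityTheory.IndepFun (fun ω : ℕ → I => ω a) (fun ω => ω b) uniformSeq := by
      have := ProbabilityTheory.iIndepFun_infinitePi (P := fun _ : ℕ => (volume : Measure I))
        (X := fun _ x => x) (fun _ => measurable_id)
      exact this.indepFun hab
    rw [ProbabilityTheory.indepFun_iff_map_prod_eq_prod_map_map
      (measurable_pi_apply a).aemeasurable (measurable_pi_apply b).aemeasurable] at hind
    have hm : ∀ i : ℕ, Measure.map (fun ω : ℕ → I => ω i) uniformSeq = volume := fun i =>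
      Measure.infinitePi_map_eval (fun _ : ℕ => (volume : Measure I)) i
    rw [hm, hm] at hind
    have hdiag : ((volume : Measure I).prod (volume : Measure I)) {p : I × I | p.1 = p.2} = 0 := by
      rw [Measure.measure_prod_null (measurableSet_eq_fun measurable_fst measurable_snd)]
      refine Filter.Eventually.of_forall fun x => ?_
      have : Prod.mk x ⁻¹' {p : I × I | p.1 = p.2} = {x} := by
        ext y; simp [eq_comm]
      change volume (Prod.mk x ⁻¹' {p : I × I | p.1 = p.2}) = 0
      rw [this]
      simp
    rw [← hind, Measure.map_apply (by fun_prop)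
      (measurableSet_eq_fun measurable_fst measurable_snd)] at hdiag
    rw [ae_iff]
    convert hdiag using 2
    ext ω; simp
  have : ∀ᵐ ω ∂uniformSeq, ∀ a b : ℕ, a ≠ b → ω a ≠ ω b := by
    rw [ae_all_iff]; intro a
    rw [ae_all_iff]; intro b
    by_cases h : a = b
    · simp [h]
    · filter_upwards [key a b h] with ω hω _ using hω
  filter_upwards [this] with ω hω a b hab
  by_contra hne
  exact hω a b hne hab

/-- The permutations of `ℕ` act transitively on the injective tuples of each finite length. -/
theorem exists_perm_map_eq {o o' : List ℕ} (ho : o.Nodup) (ho' : o'.Nodup)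
    (h : o.length = o'.length) : ∃ e : Equiv.Perm ℕ, o.map e = o' := by
  have := Equiv.Perm.isMultiplyPretransitive ℕ o.length
  let x : Fin o.length ↪ ℕ := ⟨o.get, List.nodup_iff_injective_get.1 ho⟩
  let y : Fin o.length ↪ ℕ := ⟨fun i => o'.get (i.cast h), fun i j hij => by
    simpa using List.nodup_iff_injective_get.1 ho' hij⟩
  obtain ⟨e, he⟩ := MulAction.exists_smul_eq (Equiv.Perm ℕ) x y
  refine ⟨e, List.ext_get (by simpa using h) fun i h1 h2 => ?_⟩
  have h3 := DFunLike.congr_fun he ⟨i, by simpa using h1⟩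
  simpa [x, y] using h3

/-- The event that the ranks increase along the list `o`. -/
def increasingAlong (o : List ℕ) : Set (ℕ → I) := {π | o.Pairwise fun a b => π a < π b}

theorem measurableSet_increasingAlong (o : List ℕ) : MeasurableSet (increasingAlong o) := by
  induction o with
  | nil => simp [increasingAlong]
  | cons a o ih =>
    have : increasingAlong (a :: o) = (⋂ b ∈ {b | b ∈ o}, {π | π a < π b}) ∩ increasingAlong o := by
      ext π; simp [increasingAlong]
    rw [this]
    refine MeasurableSet.inter (MeasurableSet.biInter (Set.to_countable _) fun b _ => ?_) ih
    exact measurableSet_lt (measurable_pi_apply a) (measurable_pi_apply b)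

/-- The events for the `R.card.factorial` enumerations of `R` are disjoint and, by reindexing,
equally likely. Only the upper bound on their common probability is needed. -/
theorem measure_increasingAlong_le {R : Finset ℕ} {o : List ℕ} (ho : o ∈ orders R) :
    uniformSeq (increasingAlong o) ≤ (R.card.factorial : ℝ≥0∞)⁻¹ := by
  have heq : ∀ o' ∈ orders R, uniformSeq (increasingAlong o') = uniformSeq (increasingAlong o) := by
    intro o' ho'
    have hlen : o.length = o'.length := by
      rw [← Multiset.coe_card, ← Multiset.coe_card, mem_orders.1 ho, mem_orders.1 ho']
    obtain ⟨e, rfl⟩ := exists_perm_map_eq (nodup_of_mem_orders ho) (nodup_of_mem_orders ho') hlen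
    rw [← (measurePreserving_reindex e).measure_preimage
      (measurableSet_increasingAlong o).nullMeasurableSet]
    congr 1
    ext π
    simp [increasingAlong, List.pairwise_map]
  have hdisj : Set.PairwiseDisjoint (orders R : Set (List ℕ)) increasingAlong := by
    intro o₁ h₁ o₂ h₂ hne
    rw [Function.onFun, Set.disjoint_left]
    intro π hπ₁ hπ₂
    refine hne (List.Perm.eq_of_pairwise ?_ hπ₁ hπ₂ ?_)
    · intro a b _ _ h h'
      exact absurd h (not_lt.2 h'.le)
    · rw [← Multiset.coe_eq_coe, mem_orders.1 h₁, mem_orders.1 h₂]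
  have hsum : ∑ o' ∈ orders R, uniformSeq (increasingAlong o') ≤ 1 := by
    rw [← measure_biUnion_finset hdisj fun o _ => measurableSet_increasingAlong o]
    exact prob_le_one
  rw [Finset.sum_congr rfl heq, Finset.sum_const, card_orders, nsmul_eq_mul] at hsum
  rw [ENNReal.le_inv_iff_mul_le, mul_comm]
  exact hsum

theorem exists_increasing_order {π : ℕ → I} (hπ : π.Injective) (R : Finset ℕ) :
    ∃ o ∈ orders R, π ∈ increasingAlong o := by
  induction hr : R.card generalizing R with
  | zero =>
    rw [Finset.card_eq_zero] at hr
    exact ⟨[], by simp [hr, orders_empty], by simp [increasingAlong]⟩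
  | succ r ih =>
    have hne : R.Nonempty := Finset.card_pos.1 (by omega)
    obtain ⟨u, hu, hmin⟩ := R.exists_min_image π hne
    obtain ⟨o, ho, hinc⟩ := ih (R.erase u) (by rw [Finset.card_erase_of_mem hu, hr]; rfl)
    refine ⟨u :: o, cons_mem_orders.2 ⟨hu, ho⟩, List.pairwise_cons.2 ⟨fun b hb => ?_, hinc⟩⟩
    have := Finset.mem_erase.1 ((mem_of_mem_orders ho b).1 hb)
    exact lt_of_le_of_ne (hmin b this.2) fun e => this.1 (hπ e).symm

/-- The vertices whose eliminators in `A` and `A'` differ. -/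
noncomputable def elimDiff (G : SimpleGraph ℕ) (π : ℕ → I) (A A' : Finset ℕ) : Finset ℕ :=
  (A ∪ A').filter fun w => elim G π A w ≠ elim G π A' w

theorem elimDiff_comm (G : SimpleGraph ℕ) (π : ℕ → I) (A A' : Finset ℕ) :
    elimDiff G π A A' = elimDiff G π A' A := by
  simp only [elimDiff, Finset.union_comm A A', ne_comm]

theorem mem_elimDiff {G : SimpleGraph ℕ} {π : ℕ → I} {A A' : Finset ℕ} {w : ℕ} :
    w ∈ elimDiff G π A A' ↔ elim G π A w ≠ elim G π A' w := by
  simp only [elimDiff, Finset.mem_filter, Finset.mem_union, and_iff_right_iff_imp]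
  intro h
  by_contra hc
  push Not at hc
  exact h (by simp [elim, hc.1, hc.2])

/-- The summand `1` accounts for `v` itself, which is not alive in the second process. -/
theorem card_elimDiff_erase_le (G : SimpleGraph ℕ) {π : ℕ → I} {A : Finset ℕ} (v : ℕ)
    {o : List ℕ} (ho : o ∈ orders A) (hinc : π ∈ increasingAlong o) :
    (elimDiff G π A (A.erase v)).card ≤ 1 + changed G o A (A.erase v) := by
  classical
  rw [changed, ← Finset.card_singleton v]
  refine (Finset.card_le_card fun w hw => ?_).trans (Finset.card_union_le _ _)
  have hw' := mem_elimDiff.1 hw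
  rw [elim_eq_elimAlong G hinc (fun x hx => (mem_of_mem_orders ho x).2 hx),
    elim_eq_elimAlong G hinc (fun x hx => (mem_of_mem_orders ho x).2 (Finset.mem_of_mem_erase hx))]
    at hw'
  have hwA : w ∈ A := by
    rcases Finset.mem_union.1 (Finset.mem_filter.1 hw).1 with h | h
    · exact h
    · exact Finset.mem_of_mem_erase h
  by_cases h : w = v
  · simp [h]
  · simp [h, hwA, hw']

/-- The expected number of vertices whose eliminators are affected by the vertex `v`. -/
theorem lintegral_elimDiff_erase_le (G : SimpleGraph ℕ) {A : Finset ℕ} {v : ℕ} (hv : v ∈ A) :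
    ∃ f : (ℕ → I) → ℝ≥0∞, Measurable f ∧
      (∀ π, Function.Injective π → ((elimDiff G π A (A.erase v)).card : ℝ≥0∞) ≤ f π) ∧
      ∫⁻ π, f π ∂uniformSeq ≤ ENNReal.ofReal (3 + Real.log A.card) := by
  have hm : ∀ o ∈ orders A, Measurable ((increasingAlong o).indicator
      (fun _ : ℕ → I => (changed G o A (A.erase v) : ℝ≥0∞))) := fun o _ =>
    Measurable.indicator measurable_const (measurableSet_increasingAlong o)
  -- The eliminators depend on `π` only through the order that it induces on `A`, so the bound is a
  -- finite combination of indicators of the events `increasingAlong o`. Passing to this majorant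
  -- avoids any question of measurability of `elimDiff`.
  refine ⟨fun π => 1 + ∑ o ∈ orders A,
    (increasingAlong o).indicator (fun _ : ℕ → I => (changed G o A (A.erase v) : ℝ≥0∞)) π, ?_, ?_, ?_⟩
  · exact Measurable.add measurable_const (Finset.measurable_fun_sum _ hm)
  · intro π hπ
    obtain ⟨o, ho, hinc⟩ := exists_increasing_order hπ A
    calc ((elimDiff G π A (A.erase v)).card : ℝ≥0∞)
        ≤ ((1 + changed G o A (A.erase v) : ℕ) : ℝ≥0∞) := by
          exact_mod_cast card_elimDiff_erase_le G v ho hinc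
      _ = 1 + (increasingAlong o).indicator
            (fun _ : ℕ → I => (changed G o A (A.erase v) : ℝ≥0∞)) π := by
          rw [Set.indicator_of_mem hinc]; push_cast; rfl
      _ ≤ _ := by
          refine add_le_add le_rfl ?_
          exact Finset.single_le_sum (f := fun o => (increasingAlong o).indicator
            (fun _ : ℕ → I => (changed G o A (A.erase v) : ℝ≥0∞)) π) (fun _ _ => zero_le) ho
  · have hpos : (0 : ℝ) < A.card.factorial := by exact_mod_cast A.card.factorial_pos
    have hlog : 0 ≤ Real.log A.card := Real.log_natCast_nonneg _
    rw [lintegral_add_left measurable_const, lintegral_const, measure_univ, mul_one,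
      lintegral_finsetSum _ hm]
    have h1 : ∀ o ∈ orders A, ∫⁻ π, (increasingAlong o).indicator
        (fun _ : ℕ → I => (changed G o A (A.erase v) : ℝ≥0∞)) π ∂uniformSeq
        ≤ ENNReal.ofReal (changed G o A (A.erase v) * (A.card.factorial : ℝ)⁻¹) := by
      intro o ho
      rw [lintegral_indicator_const (measurableSet_increasingAlong o),
        ENNReal.ofReal_mul (Nat.cast_nonneg _), ENNReal.ofReal_natCast,
        ENNReal.ofReal_inv_of_pos hpos, ENNReal.ofReal_natCast]
      gcongr
      exact measure_increasingAlong_le ho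
    calc _ ≤ 1 + ∑ o ∈ orders A,
          ENNReal.ofReal (changed G o A (A.erase v) * (A.card.factorial : ℝ)⁻¹) := by
            gcongr with o ho; exact h1 o ho
      _ = ENNReal.ofReal (1 + ∑ o ∈ orders A,
            changed G o A (A.erase v) * (A.card.factorial : ℝ)⁻¹) := by
            rw [ENNReal.ofReal_add zero_le_one (Finset.sum_nonneg fun _ _ => by positivity),
              ENNReal.ofReal_one, ENNReal.ofReal_sum_of_nonneg fun _ _ => by positivity]
      _ ≤ _ := by
            refine ENNReal.ofReal_le_ofReal ?_
            rw [← Finset.sum_mul]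
            have := sum_changed_erase_le G hv
            have : (∑ o ∈ orders A, (changed G o A (A.erase v) : ℝ)) * (A.card.factorial : ℝ)⁻¹
                ≤ 2 + Real.log A.card := by
              rw [mul_inv_le_iff₀ hpos, mul_comm]; exact this
            linarith

/-! # Reasoning about programs -/

/-- The program `p`, started in the state `s` at time `t`, halts in a state and at a time that
satisfy `Φ`. -/
def WP (H : SimpleGraph ℕ) (ω : ℕ → I) (p : Prog) (s : MState) (t : ℕ)
    (Φ : MState → ℕ → Prop) : Prop :=
  ∃ s' T, Exec H ω p s s' T ∧ Φ s' (t + T)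

/-- A sequence of instructions. -/
def Prog.block : List Instr → Prog
  | [] => .skip
  | c :: cs => .seq (.instr c) (Prog.block cs)

infixr:60 " ;; " => Prog.seq

section WPRules

variable {H : SimpleGraph ℕ} {ω : ℕ → I} {p q : Prog} {s : MState} {t : ℕ}
  {Φ Ψ : MState → ℕ → Prop} {b : Test}

theorem WP.mono (h : WP H ω p s t Φ) (hi : ∀ s' t', Φ s' t' → Ψ s' t') : WP H ω p s t Ψ := by
  obtain ⟨s', T, h1, h2⟩ := h
  exact ⟨s', T, h1, hi _ _ h2⟩

theorem WP.skip (h : Φ s t) : WP H ω .skip s t Φ := ⟨s, 0, .skip s, h⟩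

theorem WP.seq (h : WP H ω p s t fun s' t' => WP H ω q s' t' Φ) : WP H ω (p ;; q) s t Φ := by
  obtain ⟨s', T, h1, s'', T', h2, h3⟩ := h
  exact ⟨s'', T + T', .seq h1 h2, by rwa [← add_assoc]⟩

theorem WP.instr {c : Instr} (h : Φ (c.step H ω s) (t + 1)) : WP H ω (.instr c) s t Φ :=
  ⟨_, 1, .instr c s, h⟩

theorem WP.block {cs : List Instr} (h : Φ (cs.foldl (Instr.step H ω) s) (t + cs.length)) :
    WP H ω (Prog.block cs) s t Φ := by
  induction cs generalizing s t with
  | nil => exact WP.skip h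
  | cons c cs ih =>
    refine WP.seq (WP.instr (ih ?_))
    rw [List.foldl_cons, List.length_cons] at h
    rwa [add_assoc, add_comm 1]

theorem WP.ite (h1 : b.Holds s → WP H ω p s (t + 1) Φ)
    (h2 : ¬ b.Holds s → WP H ω q s (t + 1) Φ) : WP H ω (.ite b p q) s t Φ := by
  by_cases h : b.Holds s
  · obtain ⟨s', T, h3, h4⟩ := h1 h
    exact ⟨s', T + 1, .ite_true h h3, by rwa [add_comm T, ← add_assoc]⟩
  · obtain ⟨s', T, h3, h4⟩ := h2 h
    exact ⟨s', T + 1, .ite_false h h3, by rwa [add_comm T, ← add_assoc]⟩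

/-- A loop with an invariant indexed by a number that decreases in each round. -/
theorem WP.while (J : ℕ → MState → ℕ → Prop) {n : ℕ} (h0 : J n s t)
    (h1 : ∀ n s t, J n s t → b.Holds s → WP H ω p s (t + 1) fun s' t' => ∃ n' < n, J n' s' t')
    (h2 : ∀ n s t, J n s t → ¬ b.Holds s → Φ s (t + 1)) : WP H ω (.while b p) s t Φ := by
  induction n using Nat.strong_induction_on generalizing s t with
  | _ n ih =>
    by_cases h : b.Holds s
    · obtain ⟨s', T, h3, n', hn', h4⟩ := h1 n s t h0 h
      obtain ⟨s'', T', h5, h6⟩ := ih n' hn' h4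
      refine ⟨s'', T + T' + 1, .while_true h h3 h5, ?_⟩
      have : t + (T + T' + 1) = t + 1 + T + T' := by ring
      rwa [this]
    · exact ⟨s, 1, .while_false h, h2 n s t h0 h⟩

end WPRules

namespace MState

variable (s : MState) (x y n a b i : ℕ) (r : I)

@[simp] theorem var_setVar : (s.setVar x n).var y = if y = x then n else s.var y := by
  simp [setVar, Function.update_apply]
@[simp] theorem arr_setVar : (s.setVar x n).arr = s.arr := rfl
@[simp] theorem rank_setVar : (s.setVar x n).rank = s.rank := rfl
@[simp] theorem drawn_setVar : (s.setVar x n).drawn = s.drawn := rfl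
@[simp] theorem var_setArr : (s.setArr a i n).var = s.var := rfl
@[simp] theorem arr_setArr :
    (s.setArr a i n).arr b = if b = a then Function.update (s.arr a) i n else s.arr b := by
  simp [setArr, Function.update_apply]
@[simp] theorem rank_setArr : (s.setArr a i n).rank = s.rank := rfl
@[simp] theorem drawn_setArr : (s.setArr a i n).drawn = s.drawn := rfl

end MState

attribute [simp] Instr.step Test.Holds

/-! # A binary heap -/

/-- `h` and `p` are mutually inverse bijections between the positions `1, …, m` and `Q`. -/
structure HeapMap (h p : ℕ → ℕ) (m : ℕ) (Q : Finset ℕ) : Prop where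
  mem : ∀ i, 1 ≤ i → i ≤ m → h i ∈ Q
  pos_heap : ∀ i, 1 ≤ i → i ≤ m → p (h i) = i
  one_le : ∀ v ∈ Q, 1 ≤ p v
  le : ∀ v ∈ Q, p v ≤ m
  heap_pos : ∀ v ∈ Q, h (p v) = v
  pos_zero : ∀ v, v ∉ Q → p v = 0

/-- Exchange the values of `h` at `i` and `j`. -/
def exch (h : ℕ → ℕ) (i j : ℕ) : ℕ → ℕ :=
  Function.update (Function.update h i (h j)) j (h i)

theorem exch_apply (h : ℕ → ℕ) (i j k : ℕ) :
    exch h i j k = if k = j then h i else if k = i then h j else h k := by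
  simp [exch, Function.update_apply]

section Heap

variable {h p d : ℕ → ℕ} {m i j : ℕ} {Q : Finset ℕ} {r : ℕ → I}

theorem HeapMap.exch (hm : HeapMap h p m Q) (hi : 1 ≤ i) (hi' : i ≤ m) (hj : 1 ≤ j) (hj' : j ≤ m) :
    HeapMap (exch h i j) (Function.update (Function.update p (h j) i) (h i) j) m Q := by
  have hne : ∀ a b, 1 ≤ a → a ≤ m → 1 ≤ b → b ≤ m → h a = h b → a = b := fun a b h1 h2 h3 h4 e => by
    rw [← hm.pos_heap a h1 h2, e, hm.pos_heap b h3 h4]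
  have hp := hm.pos_heap
  have hq := hm.heap_pos
  have h1 := hm.one_le
  have h2 := hm.le
  have h3 := hm.mem
  have h4 := hm.pos_zero
  constructor <;> intro a ha <;> simp only [exch_apply, Function.update_apply] <;> grind

theorem HeapMap.card (hm : HeapMap h p m Q) : Q.card = m := by
  have : Q = (Finset.Icc 1 m).image h := by
    ext v
    simp only [Finset.mem_image, Finset.mem_Icc]
    constructor
    · exact fun hv => ⟨p v, ⟨hm.one_le v hv, hm.le v hv⟩, hm.heap_pos v hv⟩
    · rintro ⟨i, ⟨h1, h2⟩, rfl⟩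
      exact hm.mem i h1 h2
  rw [this, Finset.card_image_of_injOn, Nat.card_Icc, Nat.add_sub_cancel]
  intro a ha b hb e
  simp only [Finset.coe_Icc, Set.mem_Icc] at ha hb
  rw [← hm.pos_heap a ha.1 ha.2, ← hm.pos_heap b hb.1 hb.2, e]

theorem HeapMap.push (hm : HeapMap h p m Q) {x : ℕ} (hx : x ∉ Q) :
    HeapMap (Function.update h (m + 1) x) (Function.update p x (m + 1)) (m + 1) (insert x Q) := by
  have hp := hm.pos_heap
  have hq := hm.heap_pos
  have h1 := hm.one_le
  have h2 := hm.le
  have h3 := hm.mem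
  have h4 := hm.pos_zero
  constructor <;> intro a ha <;> simp only [Function.update_apply] <;> grind

theorem HeapMap.pop (hm : HeapMap h p (m + 1) Q) :
    HeapMap h (Function.update p (h (m + 1)) 0) m (Q.erase (h (m + 1))) := by
  have hp := hm.pos_heap
  have hq := hm.heap_pos
  have h1 := hm.one_le
  have h2 := hm.le
  have h3 := hm.mem
  have h4 := hm.pos_zero
  constructor <;> intro a ha <;> simp only [Function.update_apply, Finset.mem_erase] at * <;> grind

/-- The heap order. -/
def HeapOrd (r : ℕ → I) (h : ℕ → ℕ) (m : ℕ) : Prop :=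
  ∀ j, 2 ≤ j → j ≤ m → r (h (j / 2)) ≤ r (h j)

/-- The heap order, except at the position `i`. -/
def HeapExcept (r : ℕ → I) (h : ℕ → ℕ) (m i : ℕ) : Prop :=
  (∀ j, 2 ≤ j → j ≤ m → j ≠ i → j / 2 ≠ i → r (h (j / 2)) ≤ r (h j)) ∧
  ∀ j, 2 ≤ j → j ≤ m → j / 2 = i → 2 ≤ i → r (h (i / 2)) ≤ r (h j)

/-- The element at the position `i` is not above its parent's place too late. -/
def UpperOrd (r : ℕ → I) (h : ℕ → ℕ) (i : ℕ) : Prop := 2 ≤ i → r (h (i / 2)) ≤ r (h i)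

/-- The element at the position `i` is at most its children. -/
def LowerOrd (r : ℕ → I) (h : ℕ → ℕ) (m i : ℕ) : Prop :=
  ∀ j, 2 ≤ j → j ≤ m → j / 2 = i → r (h i) ≤ r (h j)

theorem HeapOrd.except (ho : HeapOrd r h m) : HeapExcept r h m i :=
  ⟨fun j h1 h2 _ _ => ho j h1 h2, fun j h1 h2 h3 h4 => by
    subst h3
    exact (ho (j / 2) h4 (by omega)).trans (ho j h1 h2)⟩

theorem HeapExcept.ord (he : HeapExcept r h m i) (hu : UpperOrd r h i) (hl : LowerOrd r h m i) :
    HeapOrd r h m := by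
  intro j h1 h2
  by_cases h3 : j = i
  · subst h3; exact hu h1
  · by_cases h4 : j / 2 = i
    · have := hl j h1 h2 h4
      rwa [h4]
    · exact he.1 j h1 h2 h3 h4

/-- The second clause of `HeapExcept` says that the parent of the exceptional position may stand
above its children. So the exchange needs no comparison of ranks, and it also serves to raise an
arbitrary element. -/
theorem HeapExcept.up (he : HeapExcept r h m i) (hi : 2 ≤ i) (hi' : i ≤ m) :
    HeapExcept r (_root_.exch h i (i / 2)) m (i / 2) := by
  constructor
  · intro j h1 h2 h3 h4
    have hji : j ≠ i := by rintro rfl; exact h4 rfl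
    rw [exch_apply, exch_apply, if_neg h4, if_neg h3, if_neg hji]
    by_cases h5 : j / 2 = i
    · rw [if_pos h5]; exact he.2 j h1 h2 h5 hi
    · rw [if_neg h5]; exact he.1 j h1 h2 hji h5
  · intro j h1 h2 h3 h4
    have e1 := he.1 (i / 2) h4 (by omega) (by omega) (by omega)
    rw [exch_apply, exch_apply, if_neg (by omega), if_neg (by omega), if_neg (by omega)]
    by_cases h5 : j = i
    · rw [if_pos h5]; exact e1
    · rw [if_neg h5]
      have e2 := he.1 j h1 h2 h5 (by omega)
      rw [h3] at e2
      exact e1.trans e2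

theorem LowerOrd.up (he : HeapExcept r h m i) (hi : 2 ≤ i) (hlt : r (h i) < r (h (i / 2))) :
    LowerOrd r (_root_.exch h i (i / 2)) m (i / 2) := by
  intro j h1 h2 h3
  rw [exch_apply, exch_apply, if_pos rfl, if_neg (by omega)]
  by_cases h5 : j = i
  · rw [if_pos h5]; exact hlt.le
  · rw [if_neg h5]
    have e2 := he.1 j h1 h2 h5 (by omega)
    rw [h3] at e2
    exact hlt.le.trans e2

/-- The child `c` that moves up must be the smaller one, so that it may stand above its sibling. -/
theorem HeapExcept.down {c : ℕ} (he : HeapExcept r h m i) (hu : UpperOrd r h i) (hi : 1 ≤ i)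
    (hc : c / 2 = i) (hcm : c ≤ m) (hmin : ∀ j, 2 ≤ j → j ≤ m → j / 2 = i → r (h c) ≤ r (h j)) :
    HeapExcept r (_root_.exch h i c) m c := by
  constructor
  · intro j h1 h2 h3 h4
    rw [exch_apply, exch_apply, if_neg h4, if_neg h3]
    by_cases h5 : j = i
    · subst h5
      rw [if_neg (by omega), if_pos rfl]
      exact he.2 c (by omega) hcm hc h1
    · rw [if_neg h5]
      by_cases h6 : j / 2 = i
      · rw [if_pos h6]; exact hmin j h1 h2 h6
      · rw [if_neg h6]; exact he.1 j h1 h2 h5 h6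
  · intro j h1 h2 h3 h4
    rw [exch_apply, exch_apply, if_neg (by omega), if_pos hc, if_neg (by omega), if_neg (by omega)]
    have := he.1 j h1 h2 (by omega) (by omega)
    rwa [h3] at this

theorem UpperOrd.down {c : ℕ} (hc : c / 2 = i) (hlt : r (h c) < r (h i)) :
    UpperOrd r (_root_.exch h i c) c := by
  intro h1
  rw [exch_apply, exch_apply, if_neg (by omega), if_pos hc, if_pos rfl]
  exact hlt.le

theorem HeapOrd.le_root (ho : HeapOrd r h m) : ∀ j, 1 ≤ j → j ≤ m → r (h 1) ≤ r (h j) := by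
  intro j
  induction j using Nat.strong_induction_on with
  | _ j ih =>
    intro h1 h2
    by_cases hj : j = 1
    · rw [hj]
    · exact (ih (j / 2) (by omega) (by omega) (by omega)).trans (ho j (by omega) h2)

/-- The table of doubled positions. -/
structure DoubleTable (d : ℕ → ℕ) (m : ℕ) : Prop where
  zero_or : ∀ i, 1 ≤ i → d i = 0 ∨ d i = 2 * i
  eq : ∀ i, 1 ≤ i → 2 * i ≤ m → d i = 2 * i

end Heap

/-- The heap of the machine has the content `Q`: array `4` holds the heap, array `5` the positions,
array `8` the doubled positions, and variable `8` the size. -/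
structure IsHeap (s : MState) (Q : Finset ℕ) : Prop where
  map : HeapMap (s.arr 4) (s.arr 5) (s.var 8) Q
  tab : DoubleTable (s.arr 8) (s.var 8)
  ord : HeapOrd (s.rank 0) (s.arr 4) (s.var 8)

/-- What the heap operations leave unchanged. -/
structure HeapFrame (s s' : MState) : Prop where
  var : ∀ x, x < 30 → x ≠ 8 → s'.var x = s.var x
  arr : ∀ a, a ≠ 4 → a ≠ 5 → a ≠ 8 → s'.arr a = s.arr a
  rank : s'.rank = s.rank
  drawn : s'.drawn = s.drawn

theorem HeapFrame.refl (s : MState) : HeapFrame s s :=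
  ⟨fun _ _ _ => rfl, fun _ _ _ _ => rfl, rfl, rfl⟩

/-- Exchange the heap elements at the positions in the variables `31` and `32`. -/
def exchProg : Prog := Prog.block [.load 33 4 31, .load 34 4 32, .store 4 31 34, .store 4 32 33,
  .store 5 34 31, .store 5 33 32]

/-- Insert the element in variable `30`. -/
def pushProg : Prog :=
  Prog.block [.inc 8, .copy 31 8, .store 4 31 30, .store 5 30 31, .copy 32 8, .half 32,
    .load 33 8 32] ;;
  .ite (.eq 33 4) (.instr (.store 8 32 8)) .skip ;;
  .while (.lt 4 32) (
    Prog.block [.load 33 4 31, .load 34 4 32, .lessRank 35 0 33 0 34] ;;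
    .ite (.eq 35 5) (exchProg ;; Prog.block [.copy 31 32, .half 32]) (.instr (.const 32 0)))

/-- Move the element in variable `30` to the root. -/
def raiseProg : Prog :=
  Prog.block [.load 31 5 30, .copy 32 31, .half 32] ;;
  .while (.lt 4 32) (exchProg ;; Prog.block [.copy 31 32, .half 32])

/-- The loop that moves the root down to its place. -/
def siftDownProg : Prog :=
  .while (.eq 36 5) (
    Prog.block [.load 32 8 31, .const 36 0] ;;
    .ite (.eq 32 4) .skip (.ite (.lt 8 32) .skip (
      Prog.block [.copy 35 32, .inc 35] ;;
      .ite (.lt 8 35) .skip (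
        Prog.block [.load 33 4 32, .load 34 4 35, .lessRank 33 0 34 0 33] ;;
        .ite (.eq 33 5) (.instr (.copy 32 35)) .skip) ;;
      Prog.block [.load 33 4 31, .load 34 4 32, .lessRank 36 0 34 0 33] ;;
      .ite (.eq 36 5) (exchProg ;; .instr (.copy 31 32)) .skip)))

/-- Remove the root. -/
def removeRootProg : Prog :=
  Prog.block [.const 31 1, .copy 32 8] ;; exchProg ;;
  Prog.block [.load 33 4 8, .store 5 33 4, .dec 8, .const 31 1, .const 36 1] ;;
  siftDownProg

/-! ### Correctness and running time of the heap programs -/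

section HeapPrograms

variable {H : SimpleGraph ℕ} {ω : ℕ → I} {s : MState} {t : ℕ} {Φ : MState → ℕ → Prop}
  {Q : Finset ℕ}

theorem wp_exch
    (h : ∀ s', HeapFrame s s' → (∀ x, x ≠ 33 → x ≠ 34 → s'.var x = s.var x) →
      s'.arr 4 = exch (s.arr 4) (s.var 31) (s.var 32) →
      s'.arr 5 = Function.update (Function.update (s.arr 5) (s.arr 4 (s.var 32)) (s.var 31))
        (s.arr 4 (s.var 31)) (s.var 32) →
      s'.arr 8 = s.arr 8 → Φ s' (t + 6)) :
    WP H ω exchProg s t Φ := by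
  refine WP.block (h _ ⟨?_, ?_, ?_, ?_⟩ ?_ ?_ ?_ ?_)
  · intro x h1 h2
    simp only [List.foldl, Instr.step, MState.var_setVar, MState.var_setArr]
    rw [if_neg (by omega), if_neg (by omega)]
  · intro a h1 h2 h3
    simp [h1, h2]
  · rfl
  · rfl
  · intro x h1 h2
    simp [h1, h2]
  · simp [exch]
  · simp
  · simp

end HeapPrograms

section HeapPrograms

variable {H : SimpleGraph ℕ} {ω : ℕ → I} {s : MState} {t : ℕ} {Φ : MState → ℕ → Prop}
  {Q : Finset ℕ}

theorem wp_push {N : ℕ} (h0 : s.var 4 = 0) (h1 : s.var 5 = 1) (hQ : IsHeap s Q)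
    (hx : s.var 30 ∉ Q) (hN : s.var 8 + 1 < 2 ^ N)
    (h : ∀ s' t', HeapFrame s s' → IsHeap s' (insert (s.var 30) Q) → t' ≤ t + 13 * N + 10 →
      Φ s' t') :
    WP H ω pushProg s t Φ := by
  have loop : ∀ s1 t1, HeapFrame s s1 → s1.var 8 = s.var 8 + 1 → s1.var 31 = s.var 8 + 1 →
      s1.var 32 = (s.var 8 + 1) / 2 →
      HeapMap (s1.arr 4) (s1.arr 5) (s.var 8 + 1) (insert (s.var 30) Q) →
      DoubleTable (s1.arr 8) (s.var 8 + 1) →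
      HeapExcept (s.rank 0) (s1.arr 4) (s.var 8 + 1) (s.var 8 + 1) → t1 ≤ t + 9 →
      WP H ω (.while (.lt 4 32) (
        Prog.block [.load 33 4 31, .load 34 4 32, .lessRank 35 0 33 0 34] ;;
        .ite (.eq 35 5) (exchProg ;; Prog.block [.copy 31 32, .half 32])
          (.instr (.const 32 0)))) s1 t1 Φ := by
    intro s1 t1 hf1 h8 h31 h32 hm1 ht1 he1 hle
    -- Variable `32` holds the parent position, which is halved in each round, or `0` once the
    -- element has found its place. Hence there are at most `N` rounds, of at most 13 steps each.
    refine WP.while (n := N) (fun n s' t' => HeapFrame s s' ∧ s'.var 8 = s.var 8 + 1 ∧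
      HeapMap (s'.arr 4) (s'.arr 5) (s.var 8 + 1) (insert (s.var 30) Q) ∧
      DoubleTable (s'.arr 8) (s.var 8 + 1) ∧ 1 ≤ s'.var 31 ∧ s'.var 31 ≤ s.var 8 + 1 ∧
      HeapExcept (s.rank 0) (s'.arr 4) (s.var 8 + 1) (s'.var 31) ∧
      LowerOrd (s.rank 0) (s'.arr 4) (s.var 8 + 1) (s'.var 31) ∧
      (s'.var 32 = s'.var 31 / 2 ∨
        s'.var 32 = 0 ∧ UpperOrd (s.rank 0) (s'.arr 4) (s'.var 31)) ∧
      s'.var 32 < 2 ^ n ∧ t' + 13 * n ≤ t + 9 + 13 * N) ?_ ?_ ?_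
    · refine ⟨hf1, h8, hm1, ht1, by omega, by omega, by rwa [h31], ?_, .inl (by omega), by omega,
        by omega⟩
      intro j h2 h3 h4
      omega
    · rintro n s2 t2 ⟨hf, h8, hm, ht, hi1, hi2, he, hl, hj, hn, hT⟩ hb
      have e4 : s2.var 4 = 0 := (hf.var 4 (by omega) (by omega)).trans h0
      have e5 : s2.var 5 = 1 := (hf.var 5 (by omega) (by omega)).trans h1
      have hb : 0 < s2.var 32 := by simpa [e4] using hb
      have hj : s2.var 32 = s2.var 31 / 2 := by
        rcases hj with hj | hj
        · exact hj
        · omega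
      obtain ⟨n, rfl⟩ : ∃ k, n = k + 1 := ⟨n - 1, by
        rcases n with _ | n
        · simp at hn; omega
        · rfl⟩
      rw [pow_succ] at hn
      refine WP.seq (WP.block ?_)
      refine WP.ite (fun hc => ?_) (fun hc => ?_)
      · have hc : s2.rank 0 (s2.arr 4 (s2.var 31)) < s2.rank 0 (s2.arr 4 (s2.var 32)) := by
          by_contra hcon
          simp [e5, hcon] at hc
        refine WP.seq (wp_exch fun s3 hf3 hv3 h43 h53 h83 => WP.block ⟨n, by omega, ?_⟩)
        have hfr : HeapFrame s2 s3 := ⟨fun x h1 h2 => by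
          rw [hf3.var x h1 h2]; simp [show x ≠ 33 by omega, show x ≠ 34 by omega,
            show x ≠ 35 by omega], fun a h1 h2 h3 => by rw [hf3.arr a h1 h2 h3]; simp,
            hf3.rank, hf3.drawn⟩
        have v8 : s3.var 8 = s2.var 8 := by rw [hv3 8 (by omega) (by omega)]; simp
        have v31 : s3.var 31 = s2.var 31 := by rw [hv3 31 (by omega) (by omega)]; simp
        have v32 : s3.var 32 = s2.var 32 := by rw [hv3 32 (by omega) (by omega)]; simp
        simp at h43 h53 h83
        rw [hj] at h43 h53
        rw [hf.rank] at hc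
        rw [hj] at hc
        refine ⟨⟨fun x h1 h2 => ?_, fun a h1 h2 h3 => ?_, ?_, ?_⟩, ?_⟩
        · simp [show x ≠ 31 by omega, show x ≠ 32 by omega]
          rw [hfr.var x h1 h2, hf.var x h1 h2]
        · simp; rw [hfr.arr a h1 h2 h3, hf.arr a h1 h2 h3]
        · simp; rw [hfr.rank, hf.rank]
        · simp; rw [hfr.drawn, hf.drawn]
        · simp only [List.foldl, Instr.step, MState.var_setVar, MState.arr_setVar, h43, h53, h83,
            v8, v31, v32, hj]
          simp
          refine ⟨h8, hm.exch (by omega) (by omega) (by omega) (by omega), ht, by omega, by omega,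
            he.up (by omega) (by omega), LowerOrd.up he (by omega) hc, by omega, by omega⟩
      · have hc : ¬ s2.rank 0 (s2.arr 4 (s2.var 31)) < s2.rank 0 (s2.arr 4 (s2.var 32)) := by
          intro hcon
          simp [e5, hcon] at hc
        rw [hf.rank, hj] at hc
        refine WP.instr ⟨n, by omega, ⟨fun x h1 h2 => ?_, fun a h1 h2 h3 => ?_, ?_, ?_⟩, ?_⟩
        · simp [show x ≠ 33 by omega, show x ≠ 34 by omega, show x ≠ 35 by omega,
            show x ≠ 32 by omega]
          rw [hf.var x h1 h2]
        · simp; rw [hf.arr a h1 h2 h3]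
        · simp; rw [hf.rank]
        · simp; rw [hf.drawn]
        · simp
          exact ⟨h8, hm, ht, hi1, hi2, he, hl, .inr fun _ => not_lt.1 hc, by omega⟩
    · rintro n s2 t2 ⟨hf, h8, hm, ht, hi1, hi2, he, hl, hj, hn, hT⟩ hb
      have e4 : s2.var 4 = 0 := (hf.var 4 (by omega) (by omega)).trans h0
      have hb : s2.var 32 = 0 := by simpa [e4] using hb
      refine h _ _ hf ⟨by rwa [h8], by rwa [h8], ?_⟩ (by omega)
      rw [h8, hf.rank]
      refine he.ord ?_ hl
      rcases hj with hj | hj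
      · intro h2; omega
      · exact hj.2
  have hord : HeapExcept (s.rank 0) (Function.update (s.arr 4) (s.var 8 + 1) (s.var 30))
      (s.var 8 + 1) (s.var 8 + 1) := by
    have := hQ.ord
    constructor
    · intro j h1 h2 h3 h4
      rw [Function.update_of_ne h3, Function.update_of_ne h4]
      exact this j h1 (by omega)
    · intro j h1 h2 h3 h4; omega
  -- Doubling is not an instruction, so the child positions needed for sifting down are recorded
  -- while the heap grows. An empty entry at the parent means that the new position is even, hence
  -- equal to twice the parent. Position `0` may receive a meaningless entry, as the table is only
  -- constrained from `1` on.
  have hz := hQ.tab.zero_or ((s.var 8 + 1) / 2)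
  have he := hQ.tab.eq ((s.var 8 + 1) / 2)
  refine WP.seq (WP.block (WP.seq (WP.ite (fun hc => WP.instr ?_) (fun hc => WP.skip ?_))))
  · have hc : s.arr 8 ((s.var 8 + 1) / 2) = 0 := by simpa [h0] using hc
    refine loop _ _ ⟨fun x h1 h2 => ?_, fun a h1 h2 h3 => ?_, rfl, rfl⟩ ?_ ?_ ?_ ?_ ?_ ?_ ?_
    · simp [show x ≠ 31 by omega, show x ≠ 32 by omega, show x ≠ 33 by omega, h2]
    · simp [h1, h2, h3]
    · simp
    · simp
    · simp
    · simpa using hQ.map.push hx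
    · simp
      constructor
      · intro i hi
        rw [Function.update_apply]
        split_ifs with h2
        · right; omega
        · exact hQ.tab.zero_or i hi
      · intro i hi hi2
        rw [Function.update_apply]
        split_ifs with h2
        · omega
        · exact hQ.tab.eq i hi (by omega)
    · simpa using hord
    · simp
  · have hc : s.arr 8 ((s.var 8 + 1) / 2) ≠ 0 := by simpa [h0] using hc
    refine loop _ _ ⟨fun x h1 h2 => ?_, fun a h1 h2 h3 => ?_, rfl, rfl⟩ ?_ ?_ ?_ ?_ ?_ ?_ ?_
    · simp [show x ≠ 31 by omega, show x ≠ 32 by omega, show x ≠ 33 by omega, h2]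
    · simp [h1, h2]
    · simp
    · simp
    · simp
    · simpa using hQ.map.push hx
    · simp
      refine ⟨hQ.tab.zero_or, fun i hi hi2 => ?_⟩
      by_cases h2 : 2 * i ≤ s.var 8
      · exact hQ.tab.eq i hi h2
      · have : i = (s.var 8 + 1) / 2 := by omega
        rw [this]; omega
    · simpa using hord
    · simp

end HeapPrograms

section HeapPrograms

variable {H : SimpleGraph ℕ} {ω : ℕ → I} {s : MState} {t : ℕ} {Φ : MState → ℕ → Prop}
  {Q : Finset ℕ}

/-- The heap of the machine, where the root may be out of order. -/
structure IsHeapButRoot (s : MState) (Q : Finset ℕ) : Prop where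
  map : HeapMap (s.arr 4) (s.arr 5) (s.var 8) Q
  tab : DoubleTable (s.arr 8) (s.var 8)
  ord : HeapExcept (s.rank 0) (s.arr 4) (s.var 8) 1

/-- Serves the deletion of an arbitrary element: it is lifted to the root regardless of its rank and
removed there, so that only the root is ever out of order. Each of the at most `N` rounds takes 9
steps. -/
theorem wp_raise {N : ℕ} (h0 : s.var 4 = 0) (hQ : IsHeap s Q)
    (hx : s.var 30 ∈ Q) (hN : s.var 8 < 2 ^ N)
    (h : ∀ s' t', HeapFrame s s' → s'.var 8 = s.var 8 → IsHeapButRoot s' Q →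
      s'.arr 4 1 = s.var 30 → t' ≤ t + 9 * N + 4 → Φ s' t') :
    WP H ω raiseProg s t Φ := by
  have hp1 := hQ.map.one_le _ hx
  have hp2 := hQ.map.le _ hx
  have hp3 := hQ.map.heap_pos _ hx
  refine WP.seq (WP.block (WP.while (n := N) (fun n s' t' => HeapFrame s s' ∧
      s'.var 8 = s.var 8 ∧ HeapMap (s'.arr 4) (s'.arr 5) (s.var 8) Q ∧
      DoubleTable (s'.arr 8) (s.var 8) ∧ 1 ≤ s'.var 31 ∧ s'.var 31 ≤ s.var 8 ∧
      s'.arr 4 (s'.var 31) = s.var 30 ∧ HeapExcept (s.rank 0) (s'.arr 4) (s.var 8) (s'.var 31) ∧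
      s'.var 32 = s'.var 31 / 2 ∧
      s'.var 32 < 2 ^ n ∧ t' + 9 * n ≤ t + 3 + 9 * N) ?_ ?_ ?_))
  · refine ⟨⟨fun x h1 h2 => ?_, fun a h1 h2 h3 => ?_, rfl, rfl⟩, ?_⟩
    · simp [show x ≠ 31 by omega, show x ≠ 32 by omega]
    · simp
    · simp
      exact ⟨hQ.map, hQ.tab, by omega, hp2, hp3, hQ.ord.except, by omega⟩
  · rintro n s2 t2 ⟨hf, h8, hm, ht, hi1, hi2, hix, he, hj, hn, hT⟩ hb
    have e4 : s2.var 4 = 0 := (hf.var 4 (by omega) (by omega)).trans h0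
    have hb : 0 < s2.var 32 := by simpa [e4] using hb
    obtain ⟨n, rfl⟩ : ∃ k, n = k + 1 := ⟨n - 1, by
      rcases n with _ | n
      · simp at hn; omega
      · rfl⟩
    rw [pow_succ] at hn
    refine WP.seq (wp_exch fun s3 hf3 hv3 h43 h53 h83 => WP.block ⟨n, by omega, ?_⟩)
    have v8 : s3.var 8 = s2.var 8 := hv3 8 (by omega) (by omega)
    have v31 : s3.var 31 = s2.var 31 := hv3 31 (by omega) (by omega)
    have v32 : s3.var 32 = s2.var 32 := hv3 32 (by omega) (by omega)
    rw [hj] at h43 h53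
    refine ⟨⟨fun x h1 h2 => ?_, fun a h1 h2 h3 => ?_, ?_, ?_⟩, ?_⟩
    · simp [show x ≠ 31 by omega, show x ≠ 32 by omega]
      rw [hf3.var x h1 h2, hf.var x h1 h2]
    · simp; rw [hf3.arr a h1 h2 h3, hf.arr a h1 h2 h3]
    · simp; rw [hf3.rank, hf.rank]
    · simp; rw [hf3.drawn, hf.drawn]
    · simp only [List.foldl, Instr.step, MState.var_setVar, MState.arr_setVar, h43, h53, h83,
        v8, v31, v32, hj]
      simp
      refine ⟨h8, hm.exch (by omega) (by omega) (by omega) (by omega), ht, by omega, by omega,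
        ?_, he.up (by omega) (by omega), by omega, by omega⟩
      rw [exch_apply, if_pos rfl, hix]
  · rintro n s2 t2 ⟨hf, h8, hm, ht, hi1, hi2, hix, he, hj, hn, hT⟩ hb
    have e4 : s2.var 4 = 0 := (hf.var 4 (by omega) (by omega)).trans h0
    have hb : s2.var 32 = 0 := by simpa [e4] using hb
    have hi : s2.var 31 = 1 := by omega
    rw [hi] at hix he
    exact h _ _ hf h8 ⟨by rwa [h8], by rwa [h8], by rwa [h8, hf.rank]⟩ hix (by omega)

theorem wp_siftDown {N : ℕ} (h0 : s.var 4 = 0) (h1 : s.var 5 = 1) (hQ : IsHeapButRoot s Q)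
    (h31 : s.var 31 = 1) (h36 : s.var 36 = 1) (hN : s.var 8 < 2 ^ N)
    (h : ∀ s' t', HeapFrame s s' → s'.var 8 = s.var 8 → IsHeap s' Q → t' ≤ t + 24 * N + 25 →
      Φ s' t') :
    WP H ω siftDownProg s t Φ := by
  -- The position at least doubles whenever the element moves down, so its product with `2 ^ n'`
  -- stays above the size of the heap. The one additional round is that in which the flag in
  -- variable `36` is cleared. A round takes at most 24 steps.
  refine WP.while (n := N + 1) (fun n s' t' => HeapFrame s s' ∧
      s'.var 8 = s.var 8 ∧ HeapMap (s'.arr 4) (s'.arr 5) (s.var 8) Q ∧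
      DoubleTable (s'.arr 8) (s.var 8) ∧ 1 ≤ s'.var 31 ∧
      HeapExcept (s.rank 0) (s'.arr 4) (s.var 8) (s'.var 31) ∧
      UpperOrd (s.rank 0) (s'.arr 4) (s'.var 31) ∧
      (s'.var 36 = 1 ∧ (∃ n', n = n' + 1 ∧ s.var 8 < s'.var 31 * 2 ^ n') ∨
        s'.var 36 = 0 ∧ LowerOrd (s.rank 0) (s'.arr 4) (s.var 8) (s'.var 31)) ∧
      t' + 24 * n ≤ t + 24 * N + 24) ?_ ?_ ?_
  · exact ⟨.refl s, rfl, hQ.map, hQ.tab, by omega, by rw [h31]; exact hQ.ord,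
      by intro h2; omega, .inl ⟨h36, N, rfl, by rwa [h31, one_mul]⟩, by omega⟩
  · rintro n s2 t2 ⟨hf, h8, hm, ht, hi1, he, hu, hcase, hT⟩ hb
    have e4 : s2.var 4 = 0 := (hf.var 4 (by omega) (by omega)).trans h0
    have e5 : s2.var 5 = 1 := (hf.var 5 (by omega) (by omega)).trans h1
    have hb : s2.var 36 = 1 := by simpa [e5] using hb
    obtain ⟨n, rfl, hn⟩ : ∃ n', n = n' + 1 ∧ s.var 8 < s2.var 31 * 2 ^ n' := by
      rcases hcase with h | h
      · exact h.2
      · omega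
    -- the final state of a round in which the loop ends
    have done : LowerOrd (s.rank 0) (s2.arr 4) (s.var 8) (s2.var 31) →
        ∀ s3 t3, (∀ x, x ≠ 32 → x ≠ 33 → x ≠ 34 → x ≠ 35 → x ≠ 36 → s3.var x = s2.var x) →
        s3.var 36 = 0 → s3.arr = s2.arr → s3.rank = s2.rank → s3.drawn = s2.drawn →
        t3 ≤ t2 + 24 → ∃ n' < n + 1, HeapFrame s s3 ∧
      s3.var 8 = s.var 8 ∧ HeapMap (s3.arr 4) (s3.arr 5) (s.var 8) Q ∧
      DoubleTable (s3.arr 8) (s.var 8) ∧ 1 ≤ s3.var 31 ∧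
      HeapExcept (s.rank 0) (s3.arr 4) (s.var 8) (s3.var 31) ∧
      UpperOrd (s.rank 0) (s3.arr 4) (s3.var 31) ∧
      (s3.var 36 = 1 ∧ (∃ m, n' = m + 1 ∧ s.var 8 < s3.var 31 * 2 ^ m) ∨
        s3.var 36 = 0 ∧ LowerOrd (s.rank 0) (s3.arr 4) (s.var 8) (s3.var 31)) ∧
      t3 + 24 * n' ≤ t + 24 * N + 24 := by
      intro hl s3 t3 hv h36 ha hr hd ht3
      have e31 := hv 31 (by omega) (by omega) (by omega) (by omega) (by omega)
      refine ⟨n, by omega, ⟨fun x h1 h2 => ?_, fun a h1 h2 h3 => ?_, ?_, ?_⟩, ?_⟩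
      · rw [hv x (by omega) (by omega) (by omega) (by omega) (by omega), hf.var x h1 h2]
      · rw [ha, hf.arr a h1 h2 h3]
      · rw [hr, hf.rank]
      · rw [hd, hf.drawn]
      · rw [hv 8 (by omega) (by omega) (by omega) (by omega) (by omega), ha, e31]
        exact ⟨h8, hm, ht, hi1, he, hu, .inr ⟨h36, hl⟩, by omega⟩
    have hz := ht.zero_or (s2.var 31) hi1
    have hd := ht.eq (s2.var 31) hi1
    refine WP.seq (WP.block (WP.ite (fun hc => WP.skip ?_) (fun hc => WP.ite
      (fun hc' => WP.skip ?_) (fun hc' => ?_))))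
    · have hc : s2.arr 8 (s2.var 31) = 0 := by simpa [e4] using hc
      refine done (fun j h1 h2 h3 => by omega) _ _ ?_ ?_ ?_ ?_ ?_ ?_ <;> simp +contextual
    · have hc' : s2.var 8 < s2.arr 8 (s2.var 31) := by simpa using hc'
      refine done (fun j h1 h2 h3 => by omega) _ _ ?_ ?_ ?_ ?_ ?_ ?_ <;> simp +contextual
    · have hc : s2.arr 8 (s2.var 31) ≠ 0 := by simpa [e4] using hc
      have hc' : ¬ s2.var 8 < s2.arr 8 (s2.var 31) := by simpa using hc'
      have hd : s2.arr 8 (s2.var 31) = 2 * s2.var 31 := by omega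
      have hle : 2 * s2.var 31 ≤ s.var 8 := by omega
      -- Selects the child of least rank; the second child, at the position in variable `35`, may be
      -- beyond the end of the heap.
      have choose : ∀ s3 t3, s3 = (List.foldl (Instr.step H ω)
          (List.foldl (Instr.step H ω) s2 [.load 32 8 31, .const 36 0])
          [.copy 35 32, .inc 35]) → WP H ω (.ite (.lt 8 35) .skip (
        Prog.block [.load 33 4 32, .load 34 4 35, .lessRank 33 0 34 0 33] ;;
        .ite (.eq 33 5) (.instr (.copy 32 35)) .skip)) s3 t3 (fun s4 t4 =>
          (∀ x, x ≠ 32 → x ≠ 33 → x ≠ 34 → x ≠ 35 → x ≠ 36 → s4.var x = s2.var x) ∧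
          s4.arr = s2.arr ∧ s4.rank = s2.rank ∧ s4.drawn = s2.drawn ∧
          t4 ≤ t3 + 6 ∧ s4.var 32 / 2 = s2.var 31 ∧ s4.var 32 ≤ s.var 8 ∧
          ∀ j, 2 ≤ j → j ≤ s.var 8 → j / 2 = s2.var 31 →
            s.rank 0 (s2.arr 4 (s4.var 32)) ≤ s.rank 0 (s2.arr 4 j)) := by
        rintro s3 t3 rfl
        refine WP.ite (fun hc2 => WP.skip ?_) (fun hc2 => WP.seq (WP.block (WP.ite
          (fun hc3 => WP.instr ?_) (fun hc3 => WP.skip ?_))))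
        · have hc2 : s2.var 8 < 2 * s2.var 31 + 1 := by simpa [hd] using hc2
          refine ⟨by simp +contextual, by simp, by simp, by simp, by simp, ?_⟩
          simp [hd, hle]
          intro j h1 h2 h3
          have : j = 2 * s2.var 31 := by omega
          rw [this]
        · have hc2 : ¬ s2.var 8 < 2 * s2.var 31 + 1 := by simpa [hd] using hc2
          have hc3 : s2.rank 0 (s2.arr 4 (2 * s2.var 31 + 1)) < s2.rank 0 (s2.arr 4 (2 * s2.var 31)) := by
            by_contra hcon
            simp [e5, hd, hcon] at hc3
          rw [hf.rank] at hc3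
          refine ⟨by simp +contextual, by simp, by simp, by simp, by simp, ?_⟩
          simp [hd]
          refine ⟨by omega, by omega, fun j h1 h2 h3 => ?_⟩
          have : j = 2 * s2.var 31 ∨ j = 2 * s2.var 31 + 1 := by omega
          rcases this with rfl | rfl
          · exact hc3.le
          · exact le_rfl
        · have hc2 : ¬ s2.var 8 < 2 * s2.var 31 + 1 := by simpa [hd] using hc2
          have hc3 : ¬ s2.rank 0 (s2.arr 4 (2 * s2.var 31 + 1)) < s2.rank 0 (s2.arr 4 (2 * s2.var 31)) := by
            intro hcon
            simp [e5, hd, hcon] at hc3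
          rw [hf.rank] at hc3
          refine ⟨by simp +contextual, by simp, by simp, by simp, by simp, ?_⟩
          simp [hd, hle]
          intro j h1 h2 h3
          have : j = 2 * s2.var 31 ∨ j = 2 * s2.var 31 + 1 := by omega
          rcases this with rfl | rfl
          · exact le_rfl
          · exact not_lt.1 hc3
      refine WP.seq (WP.block (WP.seq ((choose _ _ rfl).mono ?_)))
      rintro s4 t4 ⟨hv, ha, hr, hdr, ht4, hci, hcm, hmin⟩
      simp only [List.length_cons, List.length_nil] at ht4
      have v31 := hv 31 (by omega) (by omega) (by omega) (by omega) (by omega)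
      have v5 := (hv 5 (by omega) (by omega) (by omega) (by omega) (by omega)).trans e5
      refine WP.seq (WP.block (WP.ite (fun hc2 => WP.seq ?_) (fun hc2 => WP.skip ?_)))
      · have hc2 : s2.rank 0 (s2.arr 4 (s4.var 32)) < s2.rank 0 (s2.arr 4 (s2.var 31)) := by
          by_contra hcon
          simp [v5, ha, hr, v31, hcon] at hc2
        refine wp_exch fun s5 hf5 hv5 h45 h55 h85 => WP.instr ⟨n, by omega, ?_⟩
        have w31 : s5.var 31 = s2.var 31 := by rw [hv5 31 (by omega) (by omega)]; simp [v31]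
        have w32 : s5.var 32 = s4.var 32 := by rw [hv5 32 (by omega) (by omega)]; simp
        have w8 : s5.var 8 = s.var 8 := by
          rw [hv5 8 (by omega) (by omega)]
          simp [hv, h8]
        have w36 : s5.var 36 = 1 := by
          rw [hv5 36 (by omega) (by omega)]
          simp [ha, hr, v31, hc2]
        simp [ha, v31] at h45 h55 h85
        rw [hf.rank] at hc2
        refine ⟨⟨fun x h1 h2 => ?_, fun a h1 h2 h3 => ?_, ?_, ?_⟩, ?_⟩
        · simp [show x ≠ 31 by omega]
          rw [hf5.var x h1 h2]
          simp [show x ≠ 33 by omega, show x ≠ 34 by omega, show x ≠ 36 by omega]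
          rw [hv x (by omega) (by omega) (by omega) (by omega) (by omega), hf.var x h1 h2]
        · simp; rw [hf5.arr a h1 h2 h3]; simp [ha]; rw [hf.arr a h1 h2 h3]
        · simp; rw [hf5.rank]; simp [hr]; rw [hf.rank]
        · simp; rw [hf5.drawn]; simp [hdr]; rw [hf.drawn]
        · simp only [Instr.step, MState.var_setVar, MState.arr_setVar, h45, h55, h85,
            w8, w31, w32, w36]
          simp only [if_true, show (8 : ℕ) ≠ 31 by omega, show (36 : ℕ) ≠ 31 by omega, if_false]
          refine ⟨trivial, hm.exch (by omega) (by omega) (by omega) (by omega), ht, by omega,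
            he.down hu hi1 hci hcm hmin, UpperOrd.down hci hc2, .inl ⟨trivial, ?_⟩, ?_⟩
          · rcases n with _ | n
            · rw [pow_zero, mul_one] at hn; omega
            · refine ⟨n, rfl, hn.trans_le ?_⟩
              rw [pow_succ, mul_comm (2 ^ n) 2, ← mul_assoc]
              exact Nat.mul_le_mul_right _ (by omega)
          · simp only [List.length_cons, List.length_nil]
            omega
      · have hc2 : ¬ s2.rank 0 (s2.arr 4 (s4.var 32)) < s2.rank 0 (s2.arr 4 (s2.var 31)) := by
          intro hcon
          simp [v5, ha, hr, v31, hcon] at hc2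
        refine done ?_ _ _ ?_ ?_ ?_ ?_ ?_ ?_
        · intro j h1 h2 h3
          rw [hf.rank] at hc2
          exact (not_lt.1 hc2).trans (hmin j h1 h2 h3)
        · intro x h1 h2 h3 h4 h5
          simp [h2, h3, h5, hv x h1 h2 h3 h4 h5]
        · simp [ha, hr, v31, hc2]
        · simp [ha]
        · simp [hr]
        · simp [hdr]
        · simp only [List.length_cons, List.length_nil]
          omega
  · rintro n s2 t2 ⟨hf, h8, hm, ht, hi1, he, hu, hcase, hT⟩ hb
    have e5 : s2.var 5 = 1 := (hf.var 5 (by omega) (by omega)).trans h1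
    have hb : s2.var 36 ≠ 1 := by simpa [e5] using hb
    have hl := (hcase.resolve_left fun h => hb h.1).2
    refine h _ _ hf h8 ⟨by rwa [h8], by rwa [h8], ?_⟩ (by omega)
    rw [h8, hf.rank]
    exact he.ord hu hl

/-- The root is exchanged with the last element and cut off, after which the new root is sifted
down. The old root need not be minimal, since an element raised for deletion is removed in the same
way. -/
theorem wp_removeRoot {N : ℕ} (h0 : s.var 4 = 0) (h1 : s.var 5 = 1) (hQ : IsHeapButRoot s Q)
    (hpos : 0 < s.var 8) (hN : s.var 8 < 2 ^ N)
    (h : ∀ s' t', HeapFrame s s' → IsHeap s' (Q.erase (s.arr 4 1)) →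
      t' ≤ t + 24 * N + 38 → Φ s' t') :
    WP H ω removeRootProg s t Φ := by
  obtain ⟨m, hm⟩ : ∃ m, s.var 8 = m + 1 := ⟨s.var 8 - 1, by omega⟩
  refine WP.seq (WP.block (WP.seq (wp_exch fun s1 hf1 hv1 h41 h51 h81 =>
    WP.seq (WP.block ?_))))
  have e4 : s1.var 4 = 0 := by rw [hv1 4 (by omega) (by omega)]; simp [h0]
  have e5 : s1.var 5 = 1 := by rw [hv1 5 (by omega) (by omega)]; simp [h1]
  have e8 : s1.var 8 = m + 1 := by rw [hv1 8 (by omega) (by omega)]; simp [hm]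
  simp at h41 h51 h81
  have hmap := hQ.map
  rw [hm] at hmap h41 h51
  have hmap := (hmap.exch le_rfl (by omega) (j := m + 1) (by omega) le_rfl).pop
  rw [← h41, ← h51] at hmap
  have hroot : s1.arr 4 (m + 1) = s.arr 4 1 := by rw [h41, exch_apply, if_pos rfl]
  refine wp_siftDown (N := N) (Q := Q.erase (s.arr 4 1)) ?_ ?_ ?_ ?_ ?_ ?_ ?_
  · simp [e4]
  · simp [e5]
  · refine ⟨?_, ?_, ?_⟩
    · simp only [hroot] at hmap
      simp [e8, e4, hroot]
      exact hmap
    · simp [e8, h81]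
      exact ⟨hQ.tab.zero_or, fun i hi hi' => hQ.tab.eq i hi (by omega)⟩
    · simp [e8, hf1.rank]
      constructor
      · intro j h2 h3 h4 h5
        rw [h41, exch_apply, exch_apply, if_neg (by omega), if_neg h5, if_neg (by omega), if_neg h4]
        exact hQ.ord.1 j h2 (by omega) h4 h5
      · intro j h2 h3 h4 h5; omega
  · simp
  · simp
  · simp [e8]; omega
  · intro s' t' hf h8 hheap ht
    refine h s' t' ⟨fun x h1 h2 => ?_, fun a h1 h2 h3 => ?_, ?_, ?_⟩ hheap ?_
    · rw [hf.var x h1 h2]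
      simp [show x ≠ 31 by omega, show x ≠ 33 by omega, show x ≠ 36 by omega, h2]
      rw [hf1.var x h1 h2]
      simp [show x ≠ 31 by omega, show x ≠ 32 by omega]
    · rw [hf.arr a h1 h2 h3]; simp [h2]; rw [hf1.arr a h1 h2 h3]; simp
    · rw [hf.rank]; simp; rw [hf1.rank]; simp
    · rw [hf.drawn]; simp; rw [hf1.drawn]; simp
    · simp only [List.length_cons, List.length_nil] at ht
      omega

end HeapPrograms

/-! # Clusters as circular lists -/

/-- The leader `u` and the vertices in `F` form a doubly linked circular list. -/
def RingList (nx pv : ℕ → ℕ) (u : ℕ) (F : List ℕ) : Prop :=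
  List.IsChain (fun a b => nx a = b ∧ pv b = a) (u :: (F ++ [u]))

theorem RingList.congr {nx pv nx' pv' : ℕ → ℕ} {u : ℕ} {F : List ℕ} (h : RingList nx pv u F)
    (hn : ∀ v ∈ u :: F, nx' v = nx v) (hp : ∀ v ∈ u :: F, pv' v = pv v) : RingList nx' pv' u F := by
  refine List.IsChain.imp_of_mem_imp (fun a b ha hb hab => ?_) h
  have hmem : ∀ c ∈ u :: (F ++ [u]), c ∈ u :: F := by
    intro c hc
    simp only [List.mem_cons, List.mem_append, List.not_mem_nil, or_false] at hc ⊢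
    tauto
  rw [hn a (hmem a ha), hp b (hmem b hb)]
  exact hab

/-- The clusters of the vertices in `A`: the cell `ℓ w` holds `0` if `w` has no leader, and `u + 1`
if its leader is `u`. -/
def Clusters (nx pv ℓ : ℕ → ℕ) (A : Finset ℕ) : Prop :=
  ∀ u ∈ A, ℓ u = 0 → ∃ F : List ℕ, F.Nodup ∧ (∀ w, w ∈ F ↔ ℓ w = u + 1) ∧ RingList nx pv u F

/-- Leaders have no leaders. -/
def FlatLeaders (ℓ : ℕ → ℕ) : Prop := ∀ w u, ℓ w = u + 1 → ℓ u = 0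

theorem Clusters.mono {nx pv ℓ : ℕ → ℕ} {A B : Finset ℕ} (h : Clusters nx pv ℓ A) (hB : B ⊆ A) :
    Clusters nx pv ℓ B := fun u hu => h u (hB hu)

theorem Clusters.singleton {nx pv ℓ : ℕ → ℕ} {A : Finset ℕ} {v : ℕ} (h : Clusters nx pv ℓ A)
    (hv : ∀ w, ℓ w ≠ v + 1) (hℓ : ℓ v = 0) :
    Clusters (Function.update nx v v) (Function.update pv v v) ℓ (insert v A) := by
  intro u hu hu0
  by_cases huv : u = v
  · subst huv
    exact ⟨[], List.nodup_nil, fun w => by simp [hv w], by simp [RingList]⟩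
  · obtain ⟨F, h1, h2, h3⟩ := h u (Finset.mem_of_mem_insert_of_ne hu huv) hu0
    have hne : ∀ w ∈ u :: F, w ≠ v := by
      rintro w hw rfl
      rcases List.mem_cons.1 hw with h | h
      · exact huv h.symm
      · rw [h2, hℓ] at h; omega
    exact ⟨F, h1, h2, h3.congr (fun w hw => by rw [Function.update_of_ne (hne w hw)])
      (fun w hw => by rw [Function.update_of_ne (hne w hw)])⟩

/-- Remove all followers of `x` from their cluster. -/
def dumpLeader (ℓ : ℕ → ℕ) (x : ℕ) : ℕ → ℕ := fun w => if ℓ w = x + 1 then 0 else ℓ w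

/-- The link array after all followers of `x` have left the cluster. -/
def dumpLink (ℓ : ℕ → ℕ) (x : ℕ) (nx : ℕ → ℕ) : ℕ → ℕ :=
  fun w => if w = x ∨ ℓ w = x + 1 then w else nx w

theorem Clusters.dump {nx pv ℓ : ℕ → ℕ} {A : Finset ℕ} {x : ℕ} (h : Clusters nx pv ℓ A)
    (hf : FlatLeaders ℓ) (hx : ℓ x = 0) :
    Clusters (dumpLink ℓ x nx) (dumpLink ℓ x pv) (dumpLeader ℓ x) A := by
  intro u hu hu0
  unfold dumpLeader at hu0
  by_cases hux : u = x ∨ ℓ u = x + 1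
  · refine ⟨[], List.nodup_nil, fun w => ?_, by simp [RingList, dumpLink, hux]⟩
    simp only [List.not_mem_nil, false_iff, dumpLeader]
    split_ifs with h1
    · exact not_false
    · rcases hux with rfl | hux
      · exact h1
      · intro hc
        have := hf w u hc
        omega
  · have hux' := hux
    push Not at hux
    rw [if_neg hux.2] at hu0
    obtain ⟨F, h1, h2, h3⟩ := h u hu hu0
    have hne : ∀ w ∈ u :: F, ¬ (w = x ∨ ℓ w = x + 1) := by
      intro w hw
      rcases List.mem_cons.1 hw with h | h
      · exact h ▸ hux'
      · have h4 := (h2 w).1 h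
        rintro (rfl | h5)
        · omega
        · exact hux.1 (by omega)
    refine ⟨F, h1, fun w => ?_, h3.congr (fun w hw => by rw [dumpLink, if_neg (hne w hw)])
      (fun w hw => by rw [dumpLink, if_neg (hne w hw)])⟩
    rw [h2, dumpLeader]
    split_ifs with h5
    · constructor
      · intro h6; exact absurd (by omega) hux.1
      · intro h6; exact h6.elim
    · rfl

theorem Clusters.link {nx pv ℓ : ℕ → ℕ} {A : Finset ℕ} {x u : ℕ} (h : Clusters nx pv ℓ A)
    (hx : ℓ x = 0) (hux : u ≠ x) (hu : ℓ u = 0) (huA : u ∈ A) :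
    Clusters (Function.update (Function.update nx x (nx u)) u x)
      (Function.update (Function.update pv (nx u) x) x u) (Function.update ℓ x (u + 1)) A := by
  intro z hz hz0
  have hzx : z ≠ x := by
    rintro rfl; simp at hz0
  rw [Function.update_of_ne hzx] at hz0
  by_cases hzu : z = u
  · subst hzu
    obtain ⟨F, h1, h2, h3⟩ := h z hz hz0
    have hxF : x ∉ F := by rw [h2]; omega
    have hzF : z ∉ F := by rw [h2]; omega
    refine ⟨x :: F, List.nodup_cons.2 ⟨hxF, h1⟩, fun w => ?_, ?_⟩
    · rw [List.mem_cons, h2, Function.update_apply]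
      split_ifs with hw <;> simp [hw]
    · rcases F with _ | ⟨f, F⟩
      · simp only [RingList, List.nil_append, List.isChain_cons_cons, List.IsChain.singleton,
          and_true] at h3
        simp [RingList, h3.1, Function.update_apply, hzx, hzx.symm]
      · rw [RingList, List.cons_append, List.isChain_cons_cons] at h3
        obtain ⟨⟨h4, h5⟩, h6⟩ := h3
        rw [RingList, List.cons_append, List.cons_append, List.isChain_cons_cons,
          List.isChain_cons_cons]
        simp only [List.mem_cons, not_or] at hxF hzF
        rw [List.nodup_cons] at h1
        refine ⟨by simp, ⟨by simp [h4, hux.symm], by simp [h4, Ne.symm hxF.1]⟩, ?_⟩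
        refine List.IsChain.imp_of_mem_tail_imp (fun a b ha hb hab => ?_) h6
        simp only [List.tail_cons, List.mem_append, List.mem_cons, List.not_mem_nil,
          or_false] at ha hb
        have hbf : b ≠ f := by
          rintro rfl
          rcases hb with h | h
          · exact h1.1 h
          · exact hzF.1 h.symm
        have hbx : b ≠ x := by
          rintro rfl
          rcases hb with h | h
          · exact hxF.2 h
          · exact hzx h.symm
        have hax : a ≠ x := by
          rintro rfl
          rcases ha with h | h | h
          · exact hxF.1 h
          · exact hxF.2 h
          · exact hzx h.symm
        have haz : a ≠ z := by
          rintro rfl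
          exact hbf (hab.1.symm.trans h4)
        rw [h4, Function.update_of_ne haz, Function.update_of_ne hax, Function.update_of_ne hbx,
          Function.update_of_ne hbf]
        exact hab
  · obtain ⟨F, h1, h2, h3⟩ := h z hz hz0
    obtain ⟨F', -, h2', h3'⟩ := h u huA hu
    have hnu : nx u = u ∨ ℓ (nx u) = u + 1 := by
      rcases F' with _ | ⟨f, F'⟩
      · simp [RingList] at h3'
        exact .inl h3'.1
      · rw [RingList, List.cons_append, List.isChain_cons_cons] at h3'
        rw [h3'.1.1]
        exact .inr ((h2' f).1 (by simp))
    have hmem : ∀ w ∈ z :: F, w ≠ x ∧ w ≠ u ∧ w ≠ nx u := by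
      intro w hw
      rcases List.mem_cons.1 hw with h | h
      · subst h
        refine ⟨hzx, hzu, ?_⟩
        rintro rfl
        rcases hnu with h | h
        · exact hzu h
        · omega
      · have h4 := (h2 w).1 h
        refine ⟨?_, ?_, ?_⟩
        · rintro rfl; omega
        · rintro rfl; omega
        · rintro rfl
          rcases hnu with h | h
          · rw [h] at h4; omega
          · exact hzu (by omega)
    refine ⟨F, h1, fun w => ?_, h3.congr (fun w hw => ?_) (fun w hw => ?_)⟩
    · rw [h2, Function.update_apply]
      split_ifs with hw
      · rw [hw]; constructor <;> intro h5 <;> omega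
      · rfl
    · rw [Function.update_of_ne (hmem w hw).2.1, Function.update_of_ne (hmem w hw).1]
    · rw [Function.update_of_ne (hmem w hw).1, Function.update_of_ne (hmem w hw).2.2]

theorem Clusters.unlink {nx pv ℓ : ℕ → ℕ} {A : Finset ℕ} {w l : ℕ} (h : Clusters nx pv ℓ A)
    (hf : FlatLeaders ℓ) (hw : ℓ w = l + 1) (hlA : l ∈ A) :
    Clusters (Function.update nx (pv w) (nx w)) (Function.update pv (nx w) (pv w))
      (Function.update ℓ w 0) (A.erase w) := by
  have hl := hf w l hw
  obtain ⟨F, h1, h2, h3⟩ := h l hlA hl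
  have hlF : l ∉ F := by rw [h2]; omega
  obtain ⟨F₁, F₂, rfl⟩ := List.append_of_mem ((h2 w).2 hw)
  obtain ⟨P, a, hP⟩ : ∃ P a, l :: F₁ = P ++ [a] :=
    ⟨_, _, (List.dropLast_append_getLast (List.cons_ne_nil l F₁)).symm⟩
  obtain ⟨b, T, hT⟩ : ∃ b T, F₂ ++ [l] = b :: T := by
    rcases F₂ with _ | ⟨b, F₂⟩
    · exact ⟨l, [], rfl⟩
    · exact ⟨b, F₂ ++ [l], rfl⟩
  have hsplit : l :: ((F₁ ++ w :: F₂) ++ [l]) = P ++ a :: w :: (b :: T) := by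
    rw [← hT, List.append_assoc, ← List.cons_append, hP]; simp
  rw [RingList, hsplit, List.isChain_append_cons_cons, List.isChain_cons_cons] at h3
  obtain ⟨h4, ⟨h5, h6⟩, ⟨h7, h8⟩, h9⟩ := h3
  rw [h6, h7]
  have hnd := List.nodup_append.1 h1
  have hnd2 := List.nodup_cons.1 hnd.2.1
  have hma : ∀ v, v ∈ P ++ [a] ↔ v = l ∨ v ∈ F₁ := by intro v; rw [← hP]; simp
  have hmb : ∀ v, v ∈ b :: T ↔ v = l ∨ v ∈ F₂ := by intro v; rw [← hT]; simp [or_comm]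
  have ha := (hma a).1 (by simp)
  have hb := (hmb b).1 (by simp)
  have hbT : b ∉ T := by
    have : (F₂ ++ [l]).Nodup := by
      rw [List.nodup_append]
      refine ⟨hnd2.2, List.nodup_singleton l, ?_⟩
      rintro x hx y hy rfl
      rw [List.mem_singleton] at hy
      subst hy
      exact hlF (by simp [hx])
    rw [hT, List.nodup_cons] at this
    exact this.1
  have hwF₁ : w ∉ F₁ := fun h => hnd.2.2 w h w (by simp) rfl
  have hwl : w ≠ l := by rintro rfl; omega
  have hbF₁ : b ∉ F₁ := by
    intro h
    rcases hb with h' | h'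
    · exact hlF (by simp [← h', h])
    · exact hnd.2.2 b h b (by simp [h']) rfl
  intro u hu hu0
  rw [Finset.mem_erase] at hu
  rw [Function.update_of_ne hu.1] at hu0
  by_cases hul : u = l
  · subst hul
    refine ⟨F₁ ++ F₂, ?_, fun v => ?_, ?_⟩
    · rw [List.nodup_append]
      exact ⟨hnd.1, hnd2.2, fun x hx y hy => hnd.2.2 x hx y (by simp [hy])⟩
    · rw [Function.update_apply]
      split_ifs with hv
      · subst hv
        simp [hwF₁, hnd2.1]
      · rw [← h2]; simp [hv]
    · have hs : u :: ((F₁ ++ F₂) ++ [u]) = P ++ a :: (b :: T) := by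
        rw [← hT, List.append_assoc, ← List.cons_append, hP]; simp
      rw [RingList, hs, List.isChain_append_cons_cons]
      refine ⟨List.IsChain.imp_of_mem_tail_imp (fun x y hx hy hxy => ?_) h4, by simp,
        List.IsChain.imp_of_mem_tail_imp (fun x y hx hy hxy => ?_) h9⟩
      · rw [← hP, List.tail_cons] at hy
        have hya : y ≠ b := by rintro rfl; exact hbF₁ hy
        have hxa : x ≠ a := by
          rintro rfl
          exact hwF₁ ((h5.symm.trans hxy.1) ▸ hy)
        rw [Function.update_of_ne hxa, Function.update_of_ne hya]
        exact hxy
      · rw [List.tail_cons] at hy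
        have hya : y ≠ b := by rintro rfl; exact hbT hy
        have hxa : x ≠ a := by
          rintro rfl
          have : w ∈ b :: T := (h5.symm.trans hxy.1) ▸ List.mem_cons_of_mem b hy
          rcases (hmb w).1 this with h | h
          · exact hwl h
          · exact hnd2.1 h
        rw [Function.update_of_ne hxa, Function.update_of_ne hya]
        exact hxy
  · obtain ⟨F, g1, g2, g3⟩ := h u hu.2 hu0
    have hcl : ∀ c, (c = l ∨ c ∈ F₁ ++ w :: F₂) → ∀ v ∈ u :: F, v ≠ c := by
      rintro c hc v hv rfl
      rcases List.mem_cons.1 hv with hv | hv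
      · rcases hc with h | h
        · exact hul (hv.symm.trans h)
        · rw [h2] at h; rw [hv] at h; omega
      · rw [g2] at hv
        rcases hc with h | h
        · rw [h] at hv; omega
        · rw [h2] at h; exact hul (by omega)
    have hca := hcl a (ha.imp_right fun h => by simp [h])
    have hcb := hcl b (hb.imp_right fun h => by simp [h])
    refine ⟨F, g1, fun v => ?_, g3.congr (fun v hv => by rw [Function.update_of_ne (hca v hv)])
      (fun v hv => by rw [Function.update_of_ne (hcb v hv)])⟩
    rw [g2, Function.update_apply]
    split_ifs with hv
    · rw [hv]; exact ⟨fun h5 => hul (by omega), False.elim⟩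
    · rfl

/-- Remove all followers of the vertex in variable `20` from its cluster and put them into the
heap. -/
def dumpProg : Prog :=
  Prog.block [.load 21 2 20, .const 22 1] ;;
  .ite (.eq 21 20) (.instr (.const 22 0)) .skip ;;
  .while (.eq 22 5) (
    Prog.block [.load 26 2 21, .store 2 21 21, .store 3 21 21, .store 1 21 4, .copy 30 21] ;;
    pushProg ;; .instr (.copy 21 26) ;;
    .ite (.eq 21 20) (.instr (.const 22 0)) .skip) ;;
  Prog.block [.store 2 20 20, .store 3 20 20]

/-- Put the vertex in variable `23` into the cluster of the vertex in variable `24`. -/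
def linkProg : Prog :=
  Prog.block [.load 25 2 24, .store 2 23 25, .store 3 25 23, .store 2 24 23, .store 3 23 24,
    .copy 25 24, .inc 25, .store 1 23 25]

/-- What the operations on clusters leave unchanged. -/
structure ClusterFrame (s s' : MState) : Prop where
  var : ∀ x, x < 20 → x ≠ 8 → s'.var x = s.var x
  arr : ∀ a, a ≠ 1 → a ≠ 2 → a ≠ 3 → a ≠ 4 → a ≠ 5 → a ≠ 8 → s'.arr a = s.arr a
  rank : s'.rank = s.rank
  drawn : s'.drawn = s.drawn

theorem ClusterFrame.trans {s s' s'' : MState} (h : ClusterFrame s s') (h' : ClusterFrame s' s'') :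
    ClusterFrame s s'' :=
  ⟨fun x h1 h2 => (h'.var x h1 h2).trans (h.var x h1 h2),
    fun a h1 h2 h3 h4 h5 h6 => (h'.arr a h1 h2 h3 h4 h5 h6).trans (h.arr a h1 h2 h3 h4 h5 h6),
    h'.rank.trans h.rank, h'.drawn.trans h.drawn⟩

theorem HeapFrame.cluster {s s' : MState} (h : HeapFrame s s') : ClusterFrame s s' :=
  ⟨fun x h1 h2 => h.var x (by omega) h2, fun a _ _ _ h1 h2 h3 => h.arr a h1 h2 h3, h.rank, h.drawn⟩

theorem IsHeap.congr {s s' : MState} {Q : Finset ℕ} (h : IsHeap s Q) (h4 : s'.arr 4 = s.arr 4)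
    (h5 : s'.arr 5 = s.arr 5) (h8 : s'.arr 8 = s.arr 8) (hv : s'.var 8 = s.var 8)
    (hr : s'.rank 0 = s.rank 0) : IsHeap s' Q := by
  constructor
  · rw [h4, h5, hv]; exact h.map
  · rw [h8, hv]; exact h.tab
  · rw [h4, hv, hr]; exact h.ord

theorem IsHeap.size {s : MState} {Q : Finset ℕ} (h : IsHeap s Q) : s.var 8 = Q.card :=
  h.map.card.symm

theorem RingList.next {nx pv : ℕ → ℕ} {u w : ℕ} {F T : List ℕ}
    (h : RingList nx pv u (F ++ w :: T)) :
    (T = [] ∧ nx w = u) ∨ ∃ y T', T = y :: T' ∧ nx w = y := by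
  rcases T with _ | ⟨y, T⟩
  · left
    have : u :: (F ++ [w] ++ [u]) = (u :: F) ++ w :: u :: [] := by simp
    rw [RingList, this, List.isChain_append_cons_cons] at h
    exact ⟨rfl, h.2.1.1⟩
  · right
    have : u :: (F ++ w :: y :: T ++ [u]) = (u :: F) ++ w :: y :: (T ++ [u]) := by simp
    rw [RingList, this, List.isChain_append_cons_cons] at h
    exact ⟨y, T, rfl, h.2.1.1⟩

theorem RingList.first {nx pv : ℕ → ℕ} {u : ℕ} {F : List ℕ} (h : RingList nx pv u F) :
    (F = [] ∧ nx u = u) ∨ ∃ y F', F = y :: F' ∧ nx u = y := by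
  rcases F with _ | ⟨y, F⟩
  · simp only [RingList, List.nil_append, List.isChain_cons_cons] at h
    exact .inl ⟨rfl, h.1.1⟩
  · rw [RingList, List.cons_append, List.isChain_cons_cons] at h
    exact .inr ⟨y, F, rfl, h.1.1⟩

section ClusterPrograms

variable {H : SimpleGraph ℕ} {ω : ℕ → I} {s : MState} {t : ℕ} {Φ : MState → ℕ → Prop}
  {Q : Finset ℕ}

theorem wp_dump {N : ℕ} {A Fs : Finset ℕ} (h0 : s.var 4 = 0) (h1 : s.var 5 = 1) (hQ : IsHeap s Q)
    (hcl : Clusters (s.arr 2) (s.arr 3) (s.arr 1) A) (hxA : s.var 20 ∈ A)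
    (hx0 : s.arr 1 (s.var 20) = 0) (hFs : ∀ w, w ∈ Fs ↔ s.arr 1 w = s.var 20 + 1)
    (hdisj : ∀ w ∈ Fs, w ∉ Q) (hN : Q.card + Fs.card < 2 ^ N)
    (h : ∀ s' t', ClusterFrame s s' → s'.arr 1 = dumpLeader (s.arr 1) (s.var 20) →
      s'.arr 2 = dumpLink (s.arr 1) (s.var 20) (s.arr 2) →
      s'.arr 3 = dumpLink (s.arr 1) (s.var 20) (s.arr 3) → IsHeap s' (Q ∪ Fs) →
      t' ≤ t + Fs.card * (13 * N + 19) + 8 → Φ s' t') :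
    WP H ω dumpProg s t Φ := by
  obtain ⟨F, hnd, hF, hring⟩ := hcl _ hxA hx0
  have hFF : Fs = F.toFinset := by ext w; rw [hFs, List.mem_toFinset, hF]
  have hcard : Fs.card = F.length := by rw [hFF, List.toFinset_card_of_nodup hnd]
  have hxF : s.var 20 ∉ F := by rw [hF]; omega
  obtain ⟨c, hc⟩ : ∃ c, c = 13 * N + 19 := ⟨_, rfl⟩
  rw [← hc] at h
  let J : ℕ → MState → ℕ → Prop := fun n s' t' => ∃ F₁ F₂, F = F₁ ++ F₂ ∧ n = F₂.length ∧
    ClusterFrame s s' ∧ s'.var 20 = s.var 20 ∧ (F₂ = [] → s'.var 22 = 0) ∧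
    (∀ w T, F₂ = w :: T → s'.var 22 = 1 ∧ s'.var 21 = w) ∧
    s'.arr 1 = (fun v => if v ∈ F₁ then 0 else s.arr 1 v) ∧
    s'.arr 2 = (fun v => if v ∈ F₁ then v else s.arr 2 v) ∧
    s'.arr 3 = (fun v => if v ∈ F₁ then v else s.arr 3 v) ∧
    IsHeap s' (Q ∪ F₁.toFinset) ∧ t' + n * c ≤ t + 4 + F.length * c
  have loop : ∀ s1 t1 n, J n s1 t1 → WP H ω (.while (.eq 22 5) (
      Prog.block [.load 26 2 21, .store 2 21 21, .store 3 21 21, .store 1 21 4, .copy 30 21] ;;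
      pushProg ;; .instr (.copy 21 26) ;;
      .ite (.eq 21 20) (.instr (.const 22 0)) .skip) ;;
      Prog.block [.store 2 20 20, .store 3 20 20]) s1 t1 Φ := by
    intro s1 t1 n hJ
    refine WP.seq (WP.while J hJ ?_ ?_)
    · rintro n s2 t2 ⟨F₁, F₂, hF12, rfl, hf, h20, h22, hw, ha1, ha2, ha3, hheap, hT⟩ hb
      have e4 : s2.var 4 = 0 := (hf.var 4 (by omega) (by omega)).trans h0
      have e5 : s2.var 5 = 1 := (hf.var 5 (by omega) (by omega)).trans h1
      have hb : s2.var 22 = 1 := by simpa [e5] using hb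
      rcases F₂ with _ | ⟨w, T⟩
      · have := h22 rfl
        omega
      have h21 := (hw w T rfl).2
      rw [hF12, List.nodup_append, List.nodup_cons] at hnd
      have hwF₁ : w ∉ F₁ := fun hh => hnd.2.2 w hh w (by simp) rfl
      have hwF : w ∈ F := by rw [hF12]; simp
      have hwQ : w ∉ Q ∪ F₁.toFinset := by
        rw [Finset.mem_union, List.mem_toFinset, not_or]
        exact ⟨hdisj w (by rw [hFF]; simpa using hwF), hwF₁⟩
      have hnext := (hF12 ▸ hring).next
      have hsize : s2.var 8 + 1 < 2 ^ N := by
        rw [hheap.size]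
        have h2 := Finset.card_union_le Q F₁.toFinset
        have h3 := F₁.toFinset_card_le
        have h4 : F.length = F₁.length + (T.length + 1) := by rw [hF12]; simp
        omega
      refine WP.seq (WP.block (WP.seq (wp_push (N := N) (Q := Q ∪ F₁.toFinset) (by simp [e4])
        (by simp [e5]) (hheap.congr (by simp) (by simp) (by simp) (by simp) (by simp))
        (by simpa [h21] using hwQ) (by simpa using hsize) ?_)))
      intro s3 t3 hf3 hheap3 ht3
      simp only [List.length_cons, List.length_nil] at ht3
      have v20 : s3.var 20 = s.var 20 := by rw [hf3.var 20 (by omega) (by omega)]; simp [h20]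
      have v26 : s3.var 26 = s.arr 2 w := by
        rw [hf3.var 26 (by omega) (by omega)]
        simp [h21, ha2, hwF₁]
      have v22 : s3.var 22 = 1 := by rw [hf3.var 22 (by omega) (by omega)]; simp [hb]
      have a1 : s3.arr 1 = fun v => if v ∈ F₁ ++ [w] then 0 else s.arr 1 v := by
        rw [hf3.arr 1 (by omega) (by omega) (by omega)]
        ext v
        simp only [List.foldl, Instr.step, MState.arr_setVar, MState.arr_setArr, h21, ha1]
        simp [Function.update_apply, h21, e4]
        by_cases hvw : v = w <;> simp [hvw]
      have a2 : s3.arr 2 = fun v => if v ∈ F₁ ++ [w] then v else s.arr 2 v := by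
        rw [hf3.arr 2 (by omega) (by omega) (by omega)]
        ext v
        simp only [List.foldl, Instr.step, MState.arr_setVar, MState.arr_setArr, h21, ha2]
        simp [Function.update_apply, h21]
        by_cases hvw : v = w <;> simp [hvw]
      have a3 : s3.arr 3 = fun v => if v ∈ F₁ ++ [w] then v else s.arr 3 v := by
        rw [hf3.arr 3 (by omega) (by omega) (by omega)]
        ext v
        simp only [List.foldl, Instr.step, MState.arr_setVar, MState.arr_setArr, h21, ha3]
        simp [Function.update_apply, h21]
        by_cases hvw : v = w <;> simp [hvw]
      have hfr : ClusterFrame s s3 := by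
        refine hf.trans (ClusterFrame.trans ⟨fun x h1 h2 => ?_, fun a h1 h2 h3 h4 h5 h6 => ?_,
          ?_, ?_⟩ hf3.cluster)
        · simp [show x ≠ 26 by omega, show x ≠ 30 by omega]
        · simp [h1, h2, h3]
        · rfl
        · rfl
      have hheap3 : IsHeap s3 (Q ∪ (F₁ ++ [w]).toFinset) := by
        convert hheap3 using 1
        ext v
        simp [h21]
      rw [List.length_cons, Nat.succ_mul] at hT
      have fin : ∀ s4 t4, s4.var 20 = s3.var 20 → s4.var 21 = s.arr 2 w →
          (s4.var 21 = s.var 20 → s4.var 22 = 0) → (s4.var 21 ≠ s.var 20 → s4.var 22 = 1) →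
          (∀ x, x < 20 → s4.var x = s3.var x) → s4.arr = s3.arr → s4.rank = s3.rank →
          s4.drawn = s3.drawn → t4 ≤ t3 + 3 → ∃ n' < (w :: T).length, J n' s4 t4 := by
        intro s4 t4 v20' v21' v22 v22' hv ha hr hd ht4
        refine ⟨T.length, by simp, F₁ ++ [w], T, by rw [hF12]; simp, rfl,
          hfr.trans ⟨fun x h1 h2 => hv x h1, fun a _ _ _ _ _ _ => by rw [ha], hr, hd⟩,
          v20'.trans v20, ?_, ?_, by rw [ha, a1], by rw [ha, a2], by rw [ha, a3],
          hheap3.congr (by rw [ha]) (by rw [ha]) (by rw [ha]) (hv 8 (by omega)) (by rw [hr]), ?_⟩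
        · intro hT0
          apply v22
          rw [v21']
          rcases hnext with h | ⟨y, T', h, -⟩
          · exact h.2
          · simp [hT0] at h
        · rintro y T' rfl
          have hy : s.arr 2 w = y := by
            rcases hnext with h | ⟨y', T'', h, h'⟩
            · simp at h
            · simp only [List.cons.injEq] at h
              rw [h.1, h']
          rw [hy] at v21'
          refine ⟨v22' ?_, v21'⟩
          rw [v21']
          rintro rfl
          exact hxF (by rw [hF12]; simp)
        · omega
      refine WP.seq (WP.instr (WP.ite (fun hc => WP.instr ?_) (fun hc => WP.skip ?_)))
      · refine fin _ _ ?_ ?_ ?_ ?_ ?_ ?_ ?_ ?_ ?_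
        · simp
        · simp [v26]
        · simp
        · intro h; simp [v26, v20] at hc h; exact absurd hc h
        · intro x hx; simp [show x ≠ 22 by omega, show x ≠ 21 by omega]
        · simp
        · simp
        · simp
        · omega
      · refine fin _ _ ?_ ?_ ?_ ?_ ?_ ?_ ?_ ?_ ?_
        · simp
        · simp [v26]
        · intro h; simp [v26, v20] at hc h; exact absurd h hc
        · simp [v22]
        · intro x hx; simp [show x ≠ 21 by omega]
        · simp
        · simp
        · simp
        · omega
    · rintro n s2 t2 ⟨F₁, F₂, hF12, rfl, hf, h20, -, hw, ha1, ha2, ha3, hheap, hT⟩ hb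
      have e5 : s2.var 5 = 1 := (hf.var 5 (by omega) (by omega)).trans h1
      have hb : s2.var 22 ≠ 1 := by simpa [e5] using hb
      rcases F₂ with _ | ⟨w, T⟩
      swap
      · exact absurd (hw w T rfl).1 hb
      rw [List.append_nil] at hF12
      subst hF12
      refine WP.block (h _ _ (hf.trans ⟨fun x h1 h2 => ?_, fun a h1 h2 h3 h4 h5 h6 => ?_, ?_, ?_⟩)
        ?_ ?_ ?_ ?_ ?_)
      · simp
      · simp [h2, h3]
      · rfl
      · rfl
      · simp [ha1]
        ext v
        simp [dumpLeader, hF]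
      · simp [ha2]
        ext v
        simp [dumpLink, hF, Function.update_apply, h20]
        by_cases hv : v = s.var 20 <;> simp [hv]
      · simp [ha3]
        ext v
        simp [dumpLink, hF, Function.update_apply, h20]
        by_cases hv : v = s.var 20 <;> simp [hv]
      · rw [hFF]
        exact hheap.congr (by simp) (by simp) (by simp) (by simp) (by simp)
      · rw [hcard]
        simp only [List.length_cons, List.length_nil] at hT ⊢
        omega
  refine WP.seq (WP.block (WP.seq (WP.ite (fun hb => WP.instr ?_) (fun hb => WP.skip ?_))))
  · refine loop _ _ F.length ⟨[], F, rfl, rfl, ⟨fun x h1 h2 => ?_, fun a _ _ _ _ _ _ => ?_, rfl, rfl⟩,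
      ?_, ?_, ?_, ?_, ?_, ?_, ?_, ?_⟩
    · simp [show x ≠ 21 by omega, show x ≠ 22 by omega]
    · simp
    · simp
    · simp
    · rintro w T rfl
      rcases hring.first with h | ⟨y, T', h, h'⟩
      · simp at h
      · simp [h'] at hb
        simp only [List.cons.injEq] at h
        rw [← hb] at hxF
        simp [h.1] at hxF
    · simp
    · simp
    · simp
    · simp only [List.toFinset_nil, Finset.union_empty]
      exact hQ.congr (by simp) (by simp) (by simp) (by simp) (by simp)
    · simp
  · refine loop _ _ F.length ⟨[], F, rfl, rfl, ⟨fun x h1 h2 => ?_, fun a _ _ _ _ _ _ => ?_, rfl, rfl⟩,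
      ?_, ?_, ?_, ?_, ?_, ?_, ?_, ?_⟩
    · simp [show x ≠ 21 by omega, show x ≠ 22 by omega]
    · simp
    · simp
    · rintro rfl
      rcases hring.first with h | ⟨y, T', h, h'⟩
      · simp [h.2] at hb
      · simp at h
    · rintro w T rfl
      rcases hring.first with h | ⟨y, T', h, h'⟩
      · simp at h
      · simp only [List.cons.injEq] at h
        simp [h', h.1]
    · simp
    · simp
    · simp
    · simp only [List.toFinset_nil, Finset.union_empty]
      exact hQ.congr (by simp) (by simp) (by simp) (by simp) (by simp)
    · simp

theorem wp_link {x u : ℕ} (hx : s.var 23 = x) (hu : s.var 24 = u)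
    (h : ∀ s' t', ClusterFrame s s' → s'.arr 1 = Function.update (s.arr 1) x (u + 1) →
      s'.arr 2 = Function.update (Function.update (s.arr 2) x (s.arr 2 u)) u x →
      s'.arr 3 = Function.update (Function.update (s.arr 3) (s.arr 2 u) x) x u →
      s'.arr 4 = s.arr 4 → s'.arr 5 = s.arr 5 → s'.arr 8 = s.arr 8 → s'.var 8 = s.var 8 →
      t' ≤ t + 8 → Φ s' t') :
    WP H ω linkProg s t Φ := by
  refine WP.block (h _ _ ⟨fun y h1 h2 => ?_, fun a h1 h2 h3 h4 h5 h6 => ?_, rfl, rfl⟩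
    ?_ ?_ ?_ ?_ ?_ ?_ ?_ ?_)
  · simp [show y ≠ 25 by omega]
  · simp [h1, h2, h3]
  · simp [hx, hu]
  · simp [hx, hu]
  · simp [hx, hu]
  · simp
  · simp
  · simp
  · simp
  · simp

end ClusterPrograms

/-! # The invariants of the algorithm -/

/-- The invariant on the sorted list `S`, the queue `Q` and the leaders `ℓ`. -/
structure Core (G : SimpleGraph ℕ) (π : ℕ → I) (A : Finset ℕ) (S : List ℕ) (Q : Finset ℕ)
    (ℓ : ℕ → ℕ) : Prop where
  sub : ∀ v ∈ S, v ∈ A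
  qsub : ∀ v ∈ Q, v ∈ A
  sorted : S.Pairwise fun a b => (π a : ℝ) < π b
  disj : ∀ v ∈ Q, v ∉ S
  zeroS : ∀ v ∈ S, ℓ v = 0
  zeroQ : ∀ v ∈ Q, ℓ v = 0
  cover : ∀ v ∈ A, v ∈ S ∨ v ∈ Q ∨ ℓ v ≠ 0
  lead : ∀ v u, ℓ v = u + 1 → v ∈ A ∧ (u ∈ S ∨ u ∈ Q) ∧ G.Adj u v ∧ (π u : ℝ) < π v

/-- No two vertices in `S` are adjacent. -/
def Indep (G : SimpleGraph ℕ) (S : List ℕ) : Prop := ∀ a ∈ S, ∀ b ∈ S, ¬ G.Adj a b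

/-- The invariant that relates the state during an update to the list `S₀` and the leaders `ℓ₀`
before the update: `M₀` is the greedy maximal independent set before the update, `τ` the rank of
the vertex that was popped last, `X` the set of vertices that lost their leader, and `Y` the set of
vertices whose entry to the list has pushed another vertex out. -/
structure Hist (G : SimpleGraph ℕ) (π : ℕ → I) (A : Finset ℕ) (S₀ : List ℕ) (ℓ₀ : ℕ → ℕ)
    (M₀ : ℕ → Prop) (S : List ℕ) (Q : Finset ℕ) (ℓ : ℕ → ℕ) (τ : ℝ) (X Y : Finset ℕ) : Prop where
  queue : ∀ q ∈ Q, τ < π q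
  old : ∀ x ∈ S, τ < π x → x ∈ S₀
  kept : ∀ y ∈ S₀, y ∈ A → τ < π y → y ∈ S ∨ (∀ x ∈ S, (π x : ℝ) < π y) ∨
    ∃ s ∈ S, (π s : ℝ) ≤ τ ∧ G.Adj s y
  leader : ∀ w u, ℓ w = u + 1 → (ℓ₀ w = u + 1 ∧ w ∉ X) ∨
    (u ∈ S ∧ (π u : ℝ) ≤ τ ∧ ∀ s ∈ S, G.Adj s w → (π u : ℝ) ≤ π s)
  dumped : ∀ w ∈ X, ∃ x, ℓ₀ w = x + 1 ∧
    (x ∉ A ∨ ∃ s ∈ S, (π s : ℝ) ≤ τ ∧ G.Adj s x ∧ (π s : ℝ) < π x)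
  fresh : ∀ u ∈ Y, u ∈ S ∧ (π u : ℝ) ≤ τ ∧ ¬ M₀ u

section Steps

variable {G : SimpleGraph ℕ} {π : ℕ → I} {A : Finset ℕ} {S₀ : List ℕ} {ℓ₀ : ℕ → ℕ}
  {M₀ : ℕ → Prop} {S P L L₁ L₂ : List ℕ} {Q Fs : Finset ℕ} {ℓ : ℕ → ℕ} {τ : ℝ} {X Y : Finset ℕ}
  {u v x z s : ℕ}

theorem Core.flat (h : Core G π A S Q ℓ) : FlatLeaders ℓ := fun w u hw => by
  rcases (h.lead w u hw).2.1 with h' | h'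
  · exact h.zeroS u h'
  · exact h.zeroQ u h'

theorem Core.follower_notMem (h : Core G π A S Q ℓ) (hw : ℓ u = x + 1) : u ∉ Q ∧ u ∉ S := by
  constructor
  · intro h'; have := h.zeroQ u h'; omega
  · intro h'; have := h.zeroS u h'; omega

theorem Core.enter (h : Core G π A (P ++ L) Q ℓ) (hu : u ∈ Q)
    (hP : ∀ p ∈ P, (π p : ℝ) < π u) (hL : ∀ x ∈ L, (π u : ℝ) < π x) :
    Core G π A (P ++ u :: L) (Q.erase u) ℓ := by
  have hs := List.pairwise_append.1 h.sorted
  obtain ⟨h1, h2, -, h4, h5, h6, h7, h8⟩ := h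
  have h9 : ∀ v, ℓ v ≠ 0 → v ∈ A := fun v hv => (h8 v (ℓ v - 1) (by omega)).1
  constructor
  · grind
  · grind
  · rw [List.pairwise_append, List.pairwise_cons]
    refine ⟨hs.1, ⟨hL, hs.2.1⟩, fun a ha b hb => ?_⟩
    rcases List.mem_cons.1 hb with rfl | hb
    · exact hP a ha
    · exact hs.2.2 a ha b hb
  · grind
  · grind
  · grind
  · grind
  · grind

theorem Core.drop (h : Core G π A (L₁ ++ x :: L₂) Q ℓ) (hu : u ∈ L₁) (hadj : G.Adj u x)
    (hlt : (π u : ℝ) < π x) (hFs : ∀ w, w ∈ Fs ↔ ℓ w = x + 1) :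
    Core G π A (L₁ ++ L₂) (Q ∪ Fs) (Function.update (dumpLeader ℓ x) x (u + 1)) := by
  have hs := h.sorted
  have hx : ∀ v ∈ L₁ ++ L₂, v ≠ x := by
    rw [List.pairwise_append, List.pairwise_cons] at hs
    rintro v hv rfl
    rcases List.mem_append.1 hv with hv | hv
    · exact (hs.2.2 v hv v (by simp)).ne rfl
    · exact (hs.2.1.1 v hv).ne rfl
  have hflat := h.flat
  obtain ⟨h1, h2, -, h4, h5, h6, h7, h8⟩ := h
  have h9 : ∀ v, ℓ v ≠ 0 → v ∈ A := fun v hv => (h8 v (ℓ v - 1) (by omega)).1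
  constructor
  · grind
  · grind
  · exact hs.sublist (by simp)
  · grind
  · grind [dumpLeader]
  · simp only [Function.update_apply, dumpLeader]; grind
  · simp only [Function.update_apply, dumpLeader]; grind
  · simp only [Function.update_apply, dumpLeader]; grind

theorem Core.demote (h : Core G π A S Q ℓ) (hu : u ∈ Q) (hs : s ∈ S) (hadj : G.Adj s u)
    (hlt : (π s : ℝ) < π u) (hFs : ∀ w, w ∈ Fs ↔ ℓ w = u + 1) :
    Core G π A S (Q.erase u ∪ Fs) (Function.update (dumpLeader ℓ u) u (s + 1)) := by
  have hflat := h.flat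
  obtain ⟨h1, h2, h3, h4, h5, h6, h7, h8⟩ := h
  have h9 : ∀ v, ℓ v ≠ 0 → v ∈ A := fun v hv => (h8 v (ℓ v - 1) (by omega)).1
  constructor
  · grind
  · grind
  · exact h3
  · grind
  · simp only [Function.update_apply, dumpLeader]; grind
  · simp only [Function.update_apply, dumpLeader]; grind
  · simp only [Function.update_apply, dumpLeader]; grind
  · simp only [Function.update_apply, dumpLeader]; grind

theorem Core.overflow (h : Core G π A (L ++ [z]) Q ℓ) : Core G π A L (insert z Q) ℓ := by
  have hs := List.pairwise_append.1 h.sorted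
  obtain ⟨h1, h2, -, h4, h5, h6, h7, h8⟩ := h
  have h9 : ∀ v, ℓ v ≠ 0 → v ∈ A := fun v hv => (h8 v (ℓ v - 1) (by omega)).1
  have hz : z ∉ L := fun hz => (hs.2.2 z hz z (by simp)).ne rfl
  constructor
  · grind
  · grind
  · exact hs.1
  · grind
  · grind
  · grind
  · grind
  · grind

theorem Core.insert (h : Core G π A S Q ℓ) (hv : v ∉ A) :
    Core G π (insert v A) S (insert v Q) ℓ := by
  obtain ⟨h1, h2, h3, h4, h5, h6, h7, h8⟩ := h
  have h9 : ∀ v, ℓ v ≠ 0 → v ∈ A := fun v hv => (h8 v (ℓ v - 1) (by omega)).1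
  have hv0 : ℓ v = 0 := by
    by_contra hc
    exact hv (h8 v (ℓ v - 1) (by omega)).1
  constructor
  · grind
  · grind
  · exact h3
  · grind
  · grind
  · grind
  · grind
  · grind

theorem Core.delFollower (h : Core G π A S Q ℓ) (hv : ℓ v ≠ 0) :
    Core G π (A.erase v) S Q (Function.update ℓ v 0) := by
  obtain ⟨h1, h2, h3, h4, h5, h6, h7, h8⟩ := h
  have h9 : ∀ v, ℓ v ≠ 0 → v ∈ A := fun v hv => (h8 v (ℓ v - 1) (by omega)).1
  constructor
  · grind
  · grind
  · exact h3
  · grind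
  · simp only [Function.update_apply]; grind
  · simp only [Function.update_apply]; grind
  · simp only [Function.update_apply]; grind
  · simp only [Function.update_apply]; grind

theorem Core.delListed (h : Core G π A (L₁ ++ v :: L₂) Q ℓ) (hFs : ∀ w, w ∈ Fs ↔ ℓ w = v + 1) :
    Core G π (A.erase v) (L₁ ++ L₂) (Q ∪ Fs) (dumpLeader ℓ v) := by
  have hs := h.sorted
  have hx : ∀ w ∈ L₁ ++ L₂, w ≠ v := by
    rw [List.pairwise_append, List.pairwise_cons] at hs
    rintro w hv rfl
    rcases List.mem_append.1 hv with hv | hv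
    · exact (hs.2.2 w hv w (by simp)).ne rfl
    · exact (hs.2.1.1 w hv).ne rfl
  obtain ⟨h1, h2, -, h4, h5, h6, h7, h8⟩ := h
  have h9 : ∀ v, ℓ v ≠ 0 → v ∈ A := fun v hv => (h8 v (ℓ v - 1) (by omega)).1
  constructor
  · grind
  · grind
  · exact hs.sublist (by simp)
  · grind
  · simp only [dumpLeader]; grind
  · simp only [dumpLeader]; grind
  · simp only [dumpLeader]; grind
  · simp only [dumpLeader]; grind

theorem Core.delQueued (h : Core G π A S Q ℓ) (hv : v ∈ Q) (hFs : ∀ w, w ∈ Fs ↔ ℓ w = v + 1) :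
    Core G π (A.erase v) S ((Q ∪ Fs).erase v) (dumpLeader ℓ v) := by
  obtain ⟨h1, h2, h3, h4, h5, h6, h7, h8⟩ := h
  have h9 : ∀ v, ℓ v ≠ 0 → v ∈ A := fun v hv => (h8 v (ℓ v - 1) (by omega)).1
  constructor
  · grind
  · grind
  · exact h3
  · grind
  · simp only [dumpLeader]; grind
  · simp only [dumpLeader]; grind
  · simp only [dumpLeader]; grind
  · simp only [dumpLeader]; grind

end Steps

/-! # The history during one update -/

section History

variable {G : SimpleGraph ℕ} {π : ℕ → I} {A : Finset ℕ} {S₀ : List ℕ} {ℓ₀ : ℕ → ℕ}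
  {M₀ : ℕ → Prop} {S P L L₁ L₂ : List ℕ} {Q Fs : Finset ℕ} {ℓ : ℕ → ℕ} {τ : ℝ} {X Y : Finset ℕ}
  {u v x z s : ℕ}

theorem Hist.start (hτ : τ < 0) (hS : ∀ x ∈ S, x ∈ S₀) (hS₀ : ∀ y ∈ S₀, y ∈ A → y ∈ S)
    (hℓ : ∀ w u, ℓ w = u + 1 → ℓ₀ w = u + 1 ∧ w ∉ X)
    (hX : ∀ w ∈ X, ∃ x, ℓ₀ w = x + 1 ∧ x ∉ A) :
    Hist G π A S₀ ℓ₀ M₀ S Q ℓ τ X ∅ where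
  queue q _ := hτ.trans_le (π q).2.1
  old x hx _ := hS x hx
  kept y hy hA _ := .inl (hS₀ y hy hA)
  leader w u h := .inl (hℓ w u h)
  dumped w hw := (hX w hw).imp fun x h => ⟨h.1, .inl h.2⟩
  fresh u hu := by simp at hu

theorem Hist.enter (h : Hist G π A S₀ ℓ₀ M₀ (P ++ L) Q ℓ τ X Y) (hu : u ∈ Q)
    (hmin : ∀ q ∈ Q.erase u, (π u : ℝ) < π q)
    (hP : ∀ p ∈ P, (π p : ℝ) < π u) :
    Hist G π A S₀ ℓ₀ M₀ (P ++ u :: L) (Q.erase u) ℓ (π u) X Y := by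
  have h0 := h.queue u hu
  obtain ⟨h1, h2, h3, h4, h5, h6⟩ := h
  constructor
  · exact hmin
  · intro x hx hlt
    have := hP x
    rcases List.mem_append.1 hx with hx | hx
    · linarith [hP x hx]
    · rcases List.mem_cons.1 hx with rfl | hx
      · exact absurd hlt (lt_irrefl _)
      · exact h2 x (by simp [hx]) (h0.trans hlt)
  · intro y hy hA hlt
    rcases h3 y hy hA (h0.trans hlt) with h | h | ⟨s, hs, hle, hadj⟩
    · exact .inl (by simp only [List.mem_append, List.mem_cons] at h ⊢; tauto)
    · refine .inr (.inl fun x hx => ?_)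
      simp only [List.mem_append, List.mem_cons] at hx
      rcases hx with hx | rfl | hx
      · exact h x (by simp [hx])
      · exact hlt
      · exact h x (by simp [hx])
    · exact .inr (.inr ⟨s, by simp only [List.mem_append, List.mem_cons] at hs ⊢; tauto,
        hle.trans h0.le, hadj⟩)
  · intro w u' hw
    rcases h4 w u' hw with h | ⟨hS, hle, hfirst⟩
    · exact .inl h
    · refine .inr ⟨by simp only [List.mem_append, List.mem_cons] at hS ⊢; tauto,
        hle.trans h0.le, fun s hs hadj => ?_⟩
      simp only [List.mem_append, List.mem_cons] at hs
      rcases hs with hs | rfl | hs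
      · exact hfirst s (by simp [hs]) hadj
      · exact hle.trans h0.le
      · exact hfirst s (by simp [hs]) hadj
  · intro w hw
    obtain ⟨x, h, h'⟩ := h5 w hw
    refine ⟨x, h, h'.imp_right ?_⟩
    rintro ⟨s, hs, hle, hadj⟩
    exact ⟨s, by simp only [List.mem_append, List.mem_cons] at hs ⊢; tauto, hle.trans h0.le, hadj⟩
  · intro y hy
    obtain ⟨hS, hle, h'⟩ := h6 y hy
    exact ⟨by simp only [List.mem_append, List.mem_cons] at hS ⊢; tauto, hle.trans h0.le, h'⟩

theorem Hist.drop (h : Hist G π A S₀ ℓ₀ M₀ (L₁ ++ x :: L₂) Q ℓ (π u) X Y)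
    (hc : Core G π A (L₁ ++ x :: L₂) Q ℓ) (hu : u ∈ L₁) (hadj : G.Adj u x)
    (hlt : (π u : ℝ) < π x)
    (hind : ∀ a ∈ L₁ ++ x :: L₂, ∀ b ∈ L₁ ++ x :: L₂, G.Adj a b → a = u ∨ b = u)
    (hFs : ∀ w, w ∈ Fs ↔ ℓ w = x + 1) :
    Hist G π A S₀ ℓ₀ M₀ (L₁ ++ L₂) (Q ∪ Fs) (Function.update (dumpLeader ℓ x) x (u + 1)) (π u)
      (X ∪ Fs) Y := by
  have hux : x ≠ u := by rintro rfl; exact lt_irrefl _ hlt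
  have hsub : ∀ y, y ∈ L₁ ++ L₂ → y ∈ L₁ ++ x :: L₂ := fun y hy => by
    simp only [List.mem_append, List.mem_cons] at hy ⊢; tauto
  have hsub' : ∀ y, y ∈ L₁ ++ x :: L₂ → (π y : ℝ) ≤ π u → y ∈ L₁ ++ L₂ := fun y hy hle => by
    simp only [List.mem_append, List.mem_cons] at hy ⊢
    rcases hy with hy | rfl | hy
    · exact .inl hy
    · exact absurd hlt hle.not_gt
    · exact .inr hy
  have hu' : u ∈ L₁ ++ L₂ := by simp [hu]
  obtain ⟨h1, h2, h3, h4, h5, h6⟩ := h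
  constructor
  · intro q hq
    rcases Finset.mem_union.1 hq with hq | hq
    · exact h1 q hq
    · exact hlt.trans (hc.lead q x ((hFs q).1 hq)).2.2.2
  · exact fun y hy => h2 y (hsub y hy)
  · intro y hy hA hτ
    rcases h3 y hy hA hτ with h | h | ⟨s, hs, hle, hs'⟩
    · by_cases hyx : y = x
      · exact .inr (.inr ⟨u, hu', le_rfl, hyx ▸ hadj⟩)
      · refine .inl ?_
        simp only [List.mem_append, List.mem_cons] at h ⊢; tauto
    · exact .inr (.inl fun a ha => h a (hsub a ha))
    · exact .inr (.inr ⟨s, hsub' s hs hle, hle, hs'⟩)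
  · intro w u' hw
    by_cases hwx : w = x
    · subst hwx
      simp only [Function.update_self, add_left_inj] at hw
      subst hw
      refine .inr ⟨hu', le_rfl, fun s hs hs' => ?_⟩
      rcases hind s (hsub s hs) w (by simp) hs' with rfl | h
      · exact le_rfl
      · exact absurd h hux
    · rw [Function.update_of_ne hwx, dumpLeader] at hw
      split_ifs at hw with hwx'
      rcases h4 w u' hw with h | ⟨hS, hle, hfirst⟩
      · refine .inl ⟨h.1, ?_⟩
        simp only [Finset.mem_union, hFs, not_or]
        exact ⟨h.2, hwx'⟩
      · exact .inr ⟨hsub' u' hS hle, hle, fun s hs => hfirst s (hsub s hs)⟩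
  · intro w hw
    rcases Finset.mem_union.1 hw with hw | hw
    · obtain ⟨x', h, h'⟩ := h5 w hw
      refine ⟨x', h, h'.imp_right ?_⟩
      rintro ⟨s, hs, hle, h⟩
      exact ⟨s, hsub' s hs hle, hle, h⟩
    · rcases h4 w x ((hFs w).1 hw) with h | ⟨hS, hle, hfirst⟩
      · exact ⟨x, h.1, .inr ⟨u, hu', le_rfl, hadj, hlt⟩⟩
      · exact absurd hlt hle.not_gt
  · intro y hy
    obtain ⟨hS, hle, h'⟩ := h6 y hy
    exact ⟨hsub' y hS hle, hle, h'⟩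

theorem Hist.disjoint_followers (h : Hist G π A S₀ ℓ₀ M₀ S Q ℓ τ X Y)
    (hx : x ∈ S → τ < π x) (hFs : ∀ w, w ∈ Fs ↔ ℓ w = x + 1) : Disjoint X Fs := by
  rw [Finset.disjoint_right]
  intro w hw
  rcases h.leader w x ((hFs w).1 hw) with h | h
  · exact h.2
  · exact absurd (hx h.1) h.2.1.not_gt

theorem Hist.demote (h : Hist G π A S₀ ℓ₀ M₀ S Q ℓ τ X Y) (hc : Core G π A S Q ℓ) (hu : u ∈ Q)
    (hmin : ∀ q ∈ Q.erase u, (π u : ℝ) < π q) (hs : s ∈ S) (hadj : G.Adj s u)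
    (hlt : (π s : ℝ) < π u) (hfirst : ∀ a ∈ S, G.Adj a u → (π s : ℝ) ≤ π a)
    (hFs : ∀ w, w ∈ Fs ↔ ℓ w = u + 1) :
    Hist G π A S₀ ℓ₀ M₀ S (Q.erase u ∪ Fs) (Function.update (dumpLeader ℓ u) u (s + 1)) (π u)
      (X ∪ Fs) Y := by
  have h0 := h.queue u hu
  have huS := hc.disj u hu
  obtain ⟨h1, h2, h3, h4, h5, h6⟩ := h
  constructor
  · intro q hq
    rcases Finset.mem_union.1 hq with hq | hq
    · exact hmin q hq
    · exact (hc.lead q u ((hFs q).1 hq)).2.2.2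
  · exact fun x hx hlt => h2 x hx (h0.trans hlt)
  · intro y hy hA hlt
    rcases h3 y hy hA (h0.trans hlt) with h | h | ⟨s, hs, hle, hadj⟩
    · exact .inl h
    · exact .inr (.inl h)
    · exact .inr (.inr ⟨s, hs, hle.trans h0.le, hadj⟩)
  · intro w u' hw
    by_cases hwu : w = u
    · subst hwu
      simp only [Function.update_self, add_left_inj] at hw
      subst hw
      exact .inr ⟨hs, hlt.le, hfirst⟩
    · rw [Function.update_of_ne hwu, dumpLeader] at hw
      split_ifs at hw with hwu'
      rcases h4 w u' hw with h | ⟨hS, hle, hfirst⟩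
      · refine .inl ⟨h.1, ?_⟩
        simp only [Finset.mem_union, hFs, not_or]
        exact ⟨h.2, hwu'⟩
      · exact .inr ⟨hS, hle.trans h0.le, hfirst⟩
  · intro w hw
    rcases Finset.mem_union.1 hw with hw | hw
    · obtain ⟨x', h, h'⟩ := h5 w hw
      refine ⟨x', h, h'.imp_right ?_⟩
      rintro ⟨s, hs, hle, h⟩
      exact ⟨s, hs, hle.trans h0.le, h⟩
    · rcases h4 w u ((hFs w).1 hw) with h | ⟨hS, -⟩
      · exact ⟨u, h.1, .inr ⟨s, hs, hlt.le, hadj, hlt⟩⟩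
      · exact absurd hS huS
  · intro y hy
    obtain ⟨hS, hle, h'⟩ := h6 y hy
    exact ⟨hS, hle.trans h0.le, h'⟩

theorem Hist.overflow (h : Hist G π A S₀ ℓ₀ M₀ (L ++ [z]) Q ℓ (π u) X Y)
    (hs : (L ++ [z]).Pairwise fun a b => (π a : ℝ) < π b) (hu : u ∈ L) (hM : ¬ M₀ u) :
    Hist G π A S₀ ℓ₀ M₀ L (insert z Q) ℓ (π u) X (insert u Y) := by
  have hLz : ∀ x ∈ L, (π x : ℝ) < π z := fun x hx =>
    (List.pairwise_append.1 hs).2.2 x hx z (by simp)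
  have hz := hLz u hu
  have hsub : ∀ y, y ∈ L → y ∈ L ++ [z] := fun y hy => by simp [hy]
  have hsub' : ∀ y, y ∈ L ++ [z] → (π y : ℝ) ≤ π u → y ∈ L := fun y hy hle => by
    rcases List.mem_append.1 hy with hy | hy
    · exact hy
    · rw [List.mem_singleton.1 hy] at hle
      exact absurd hz hle.not_gt
  obtain ⟨h1, h2, h3, h4, h5, h6⟩ := h
  constructor
  · intro q hq
    rcases Finset.mem_insert.1 hq with rfl | hq
    · exact hz
    · exact h1 q hq
  · exact fun x hx => h2 x (hsub x hx)
  · intro y hy hA hlt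
    rcases h3 y hy hA hlt with h | h | ⟨s, hs, hle, hadj⟩
    · rcases List.mem_append.1 h with h | h
      · exact .inl h
      · rw [List.mem_singleton.1 h]
        exact .inr (.inl hLz)
    · exact .inr (.inl fun x hx => h x (hsub x hx))
    · exact .inr (.inr ⟨s, hsub' s hs hle, hle, hadj⟩)
  · intro w u' hw
    rcases h4 w u' hw with h | ⟨hS, hle, hfirst⟩
    · exact .inl h
    · exact .inr ⟨hsub' u' hS hle, hle, fun s hs => hfirst s (hsub s hs)⟩
  · intro w hw
    obtain ⟨x', h, h'⟩ := h5 w hw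
    refine ⟨x', h, h'.imp_right ?_⟩
    rintro ⟨s, hs, hle, h⟩
    exact ⟨s, hsub' s hs hle, hle, h⟩
  · intro y hy
    rcases Finset.mem_insert.1 hy with rfl | hy
    · exact ⟨hu, le_rfl, hM⟩
    · obtain ⟨hS, hle, h'⟩ := h6 y hy
      exact ⟨hsub' y hS hle, hle, h'⟩

/-- A vertex that enters the list, and pushes a later vertex out, was not selected before. -/
theorem Hist.not_selected (h : Hist G π A S₀ ℓ₀ M₀ S Q ℓ τ X Y) (hc : Core G π A S Q ℓ)
    (hM : ∀ y, M₀ y → ∀ x ∈ S₀, (π y : ℝ) < π x → y ∈ S₀) (hu : u ∈ Q)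
    (hz : z ∈ S) (huz : (π u : ℝ) < π z)
    (hadj : ∀ s ∈ S, (π s : ℝ) ≤ π u → ¬ G.Adj s u) : ¬ M₀ u := by
  intro hMu
  have h0 := h.queue u hu
  rcases h.kept u (hM u hMu z (h.old z hz (h0.trans huz)) huz) (hc.qsub u hu) h0 with
    h | h | ⟨s, hs, hle, h⟩
  · exact hc.disj u hu h
  · exact lt_asymm (h z hz) huz
  · exact hadj s hs (hle.trans h0.le) h

end History

/-! # The invariant between updates -/

/-- The invariant between updates, for lists of length at most `K`. -/
structure Rest (G : SimpleGraph ℕ) (π : ℕ → I) (K : ℕ) (A : Finset ℕ) (S : List ℕ) (Q : Finset ℕ)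
    (ℓ : ℕ → ℕ) : Prop where
  core : Core G π A S Q ℓ
  indep : Indep G S
  length_le : S.length ≤ K
  done : Q = ∅ ∨ (S.length = K ∧ ∀ q ∈ Q, ∀ x ∈ S, (π x : ℝ) < π q)

section Rest

variable {G : SimpleGraph ℕ} {π : ℕ → I} {A A₀ : Finset ℕ} {S S₀ : List ℕ} {Q : Finset ℕ}
  {ℓ ℓ₀ : ℕ → ℕ} {K k : ℕ} {X Y : Finset ℕ} {τ : ℝ}

theorem Rest.take_greedyMIS (h : Rest G π K A S Q ℓ) : (greedyMIS G π A).take S.length = S := by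
  have hc := h.core
  refine eq_take_greedyMIS hc.sorted hc.sub h.indep fun v hv => ?_
  have hq : ∀ q ∈ Q, ∀ x ∈ S, (π x : ℝ) < π q := fun q hq => by
    rcases h.done with h | h
    · simp [h] at hq
    · exact h.2 q hq
  rcases hc.cover v hv with h1 | h1 | h1
  · exact .inl h1
  · exact .inr (.inr (hq v h1))
  · obtain ⟨-, h2, h3, h4⟩ := hc.lead v (ℓ v - 1) (by omega)
    rcases h2 with h2 | h2
    · exact .inr (.inl ⟨_, h2, h4, h3⟩)
    · exact .inr (.inr fun x hx => (hq _ h2 x hx).trans h4)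

theorem Rest.mem_greedyMIS (h : Rest G π K A S Q ℓ) {v : ℕ} (hv : v ∈ S) :
    v ∈ greedyMIS G π A := by
  rw [← h.take_greedyMIS] at hv
  exact List.mem_of_mem_take hv

theorem Rest.mem_of_lt (h : Rest G π K A S Q ℓ) (hπ : π.Injective) {x y : ℕ}
    (hy : y ∈ greedyMIS G π A) (hx : x ∈ S) (hlt : (π y : ℝ) < π x) : y ∈ S := by
  have hs := greedyMIS_sorted G hπ A
  rw [← List.take_append_drop S.length (greedyMIS G π A), h.take_greedyMIS] at hs hy
  rcases List.mem_append.1 hy with hy | hy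
  · exact hy
  · exact absurd ((List.pairwise_append.1 hs).2.2 x hx y hy) (not_lt.2 (le_of_lt hlt))

theorem Rest.eq_greedyMIS (h : Rest G π K A S ∅ ℓ) (hπ : π.Injective) :
    greedyMIS G π A = S := by
  have hd : greedyMIS G π A = S ++ (greedyMIS G π A).drop S.length := by
    conv_lhs => rw [← List.take_append_drop S.length (greedyMIS G π A), h.take_greedyMIS]
  rcases hr : (greedyMIS G π A).drop S.length with - | ⟨g, r⟩
  · rw [hd, hr, List.append_nil]
  · have hn := greedyMIS_nodup G hπ A
    have hg : g ∈ greedyMIS G π A := by rw [hd, hr]; simp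
    rw [hd, hr] at hn
    rcases h.core.cover g (mem_of_mem_greedyMIS hg) with h1 | h1 | h1
    · exact absurd (List.nodup_append.1 hn).2.2 fun hc => hc g h1 g (by simp) rfl
    · simp at h1
    · obtain ⟨-, h2, h3, -⟩ := h.core.lead g (ℓ g - 1) (by omega)
      simp only [Finset.notMem_empty, or_false] at h2
      exact absurd h3 (greedyMIS_indep (h.mem_greedyMIS h2) hg)

theorem Rest.isTopLFMISWithLeaders (h : Rest G π (k + 1) A S Q ℓ) (hπ : π.Injective) :
    IsTopLFMISWithLeaders k G π A (S.take k).toFinset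
      (fun v => if ℓ v = 0 then none else some (ℓ v - 1)) := by
  have hc := h.core
  have hset : (greedyMIS G π A).take k = S.take k := by
    rcases h.done with rfl | hd
    · rw [h.eq_greedyMIS hπ]
    · conv_rhs => rw [← h.take_greedyMIS]
      rw [List.take_take, min_eq_left (by omega)]
  have hall : topLFMIS k G π A = LFMIS G π A → Q = ∅ ∧ S.take k = S := by
    intro he
    have hn := greedyMIS_nodup G hπ A
    have h1 := congrArg Finset.card he
    rw [topLFMIS, LFMIS, List.toFinset_card_of_nodup hn,
      List.toFinset_card_of_nodup (hn.sublist (List.take_sublist _ _)), List.length_take] at h1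
    have h2 := congrArg List.length h.take_greedyMIS
    rw [List.length_take] at h2
    have h3 : S.length ≤ k := by omega
    exact ⟨h.done.resolve_right fun hd => by omega, List.take_of_length_le h3⟩
  constructor
  · rw [topLFMIS, hset]
  · intro v hv u hu
    split_ifs at hu with h0
    obtain ⟨-, h1, h2, -⟩ := hc.lead v (ℓ v - 1) (by omega)
    simp only [Option.some.injEq] at hu
    subst hu
    exact ⟨h1.elim (hc.sub _) (hc.qsub _), h2.symm⟩
  · intro he v hv hvS
    obtain ⟨rfl, hS⟩ := hall he
    rw [topLFMIS, hset, hS, List.mem_toFinset] at hvS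
    rw [topLFMIS, hset, hS]
    have h0 : ℓ v ≠ 0 := by
      rcases hc.cover v hv with h | h | h
      · exact absurd h hvS
      · simp at h
      · exact h
    refine ⟨ℓ v - 1, ?_, by simp [h0]⟩
    have := (hc.lead v (ℓ v - 1) (by omega)).2.1
    simpa using this
  · intro he v hv
    obtain ⟨rfl, hS⟩ := hall he
    rw [topLFMIS, hset, hS, List.mem_toFinset] at hv
    simp [hc.zeroS v hv]

/-- The vertices whose leader is not the vertex that eliminates them. -/
noncomputable def wrong (G : SimpleGraph ℕ) (π : ℕ → I) (A : Finset ℕ) (ℓ : ℕ → ℕ) : Finset ℕ :=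
  A.filter fun w => ℓ w ≠ 0 ∧ elim G π A w ≠ some (ℓ w - 1)


theorem Hist.card_dumped_add_wrong_le {Q₀ : Finset ℕ} (hπ : π.Injective)
    (h₀ : Core G π A₀ S₀ Q₀ ℓ₀) (h : Rest G π K A S Q ℓ)
    (hh : Hist G π A S₀ ℓ₀ (· ∈ greedyMIS G π A₀) S Q ℓ τ X Y) :
    X.card + (wrong G π A ℓ).card ≤
      (wrong G π A₀ ℓ₀).card + 2 * (elimDiff G π A₀ A).card := by
  have hX : X ⊆ (X ∩ wrong G π A₀ ℓ₀) ∪ elimDiff G π A₀ A := by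
    intro w hw
    obtain ⟨x, h1, h2⟩ := hh.dumped w hw
    have h3 : elim G π A w ≠ some x := by
      intro h3
      have hx := (elim_some h3).1
      rcases h2 with h2 | ⟨s, hs, -, hadj, -⟩
      · exact h2 (mem_of_mem_greedyMIS hx)
      · exact greedyMIS_indep (h.mem_greedyMIS hs) hx hadj
    by_cases h4 : elim G π A₀ w = some x
    · exact Finset.mem_union_right _ (mem_elimDiff.2 (by rw [h4]; exact h3.symm))
    · refine Finset.mem_union_left _ (Finset.mem_inter.2 ⟨hw, Finset.mem_filter.2
        ⟨(h₀.lead w x h1).1, by omega, ?_⟩⟩)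
      rwa [h1, Nat.add_sub_cancel]
  have hW : wrong G π A ℓ ⊆ (wrong G π A₀ ℓ₀ \ X) ∪ elimDiff G π A₀ A := by
    intro w hw
    obtain ⟨hA, h1, h2⟩ := Finset.mem_filter.1 hw
    rcases hh.leader w (ℓ w - 1) (by omega) with ⟨h3, h4⟩ | ⟨h3, h4, h5⟩
    · by_cases h6 : elim G π A₀ w = some (ℓ w - 1)
      · exact Finset.mem_union_right _ (mem_elimDiff.2 (by rw [h6]; exact h2.symm))
      · refine Finset.mem_union_left _ (Finset.mem_sdiff.2 ⟨Finset.mem_filter.2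
          ⟨(h₀.lead w _ h3).1, by omega, ?_⟩, h4⟩)
        rwa [h3, Nat.add_sub_cancel]
    · refine absurd (elim_eq_of_min hπ hA (h.mem_greedyMIS h3)
        (.inr (h.core.lead w (ℓ w - 1) (by omega)).2.2.1) fun x hx hxw => ?_) h2
      rcases hxw with rfl | hxw
      · exact absurd (h.core.lead x (ℓ x - 1) (by omega)).2.2.1
          (greedyMIS_indep (h.mem_greedyMIS h3) hx)
      · by_contra hc
        exact hc (h5 x (h.mem_of_lt hπ hx h3 (lt_of_not_ge hc)) hxw)
  have c1 := (Finset.card_le_card hX).trans (Finset.card_union_le _ _)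
  have c2 := (Finset.card_le_card hW).trans (Finset.card_union_le _ _)
  have c3 := Finset.card_inter_add_card_sdiff (wrong G π A₀ ℓ₀) X
  rw [Finset.inter_comm] at c3
  omega

theorem Hist.card_fresh_le (hπ : π.Injective) (h : Rest G π K A S Q ℓ)
    (hh : Hist G π A S₀ ℓ₀ (· ∈ greedyMIS G π A₀) S Q ℓ τ X Y) :
    Y.card ≤ (elimDiff G π A₀ A).card := by
  refine Finset.card_le_card fun u hu => ?_
  obtain ⟨h1, -, h2⟩ := hh.fresh u hu
  rw [mem_elimDiff, elim_self hπ (h.mem_greedyMIS h1)]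
  exact fun h3 => h2 (elim_some h3).1

end Rest

/-- Dump the cluster of the vertex in variable `13` and make the vertex in variable `14` its
leader. -/
def attachProg : Prog :=
  .instr (.copy 20 13) ;; dumpProg ;; Prog.block [.copy 23 13, .copy 24 14] ;; linkProg

/-- The memory of the machine during an update, apart from the list, in relation to the abstract
state. -/
structure Mid (G : SimpleGraph ℕ) (π : ℕ → I) (K : ℕ) (A : Finset ℕ) (S₀ : List ℕ) (ℓ₀ : ℕ → ℕ)
    (M₀ : ℕ → Prop) (s : MState) (S : List ℕ) (Q : Finset ℕ) (τ : ℝ) (X Y : Finset ℕ) : Prop where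
  zero : s.var 4 = 0
  one : s.var 5 = 1
  cap : s.var 6 = K
  rank : ∀ v ∈ A, s.rank 0 v = π v
  heap : IsHeap s Q
  clusters : Clusters (s.arr 2) (s.arr 3) (s.arr 1) A
  core : Core G π A S Q (s.arr 1)
  hist : Hist G π A S₀ ℓ₀ M₀ S Q (s.arr 1) τ X Y

section Attach

variable {G H : SimpleGraph ℕ} {ω π : ℕ → I} {K N : ℕ} {A : Finset ℕ} {S₀ : List ℕ} {ℓ₀ : ℕ → ℕ}
  {M₀ : ℕ → Prop} {S P L L₁ L₂ : List ℕ} {Q Fs : Finset ℕ} {ℓ : ℕ → ℕ} {τ : ℝ} {X Y : Finset ℕ}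
  {u v x z a : ℕ} {s : MState} {t : ℕ} {Φ : MState → ℕ → Prop}

theorem exists_followers (hc : Core G π A S Q ℓ) (x : ℕ) :
    ∃ Fs : Finset ℕ, (∀ w, w ∈ Fs ↔ ℓ w = x + 1) ∧ Fs ⊆ A ∧ Disjoint Q Fs := by
  classical
  have h : ∀ w, w ∈ A.filter (fun w => ℓ w = x + 1) ↔ ℓ w = x + 1 := fun w => by
    rw [Finset.mem_filter, and_iff_right_iff_imp]
    exact fun h => (hc.lead w x h).1
  refine ⟨_, h, Finset.filter_subset _ _, ?_⟩
  rw [Finset.disjoint_right]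
  exact fun w hw => (hc.follower_notMem ((h w).1 hw)).1

theorem ClusterFrame.setVar (s : MState) {x : ℕ} (hx : 20 ≤ x) (n : ℕ) :
    ClusterFrame s (s.setVar x n) :=
  ⟨fun y h1 _ => by simp [show y ≠ x by omega], fun _ _ _ _ _ _ _ => rfl, rfl, rfl⟩

theorem wp_attach {Q' : Finset ℕ} (h0 : s.var 4 = 0) (h1 : s.var 5 = 1) (hQ : IsHeap s Q)
    (hcl : Clusters (s.arr 2) (s.arr 3) (s.arr 1) A) (hQ' : Q ⊆ Q')
    (hc : Core G π A S Q' (s.arr 1)) (hA : A.card < 2 ^ N) (hx : s.var 13 = x) (ha : s.var 14 = a) (hxA : x ∈ A)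
    (hx0 : s.arr 1 x = 0) (hax : a ≠ x) (haA : a ∈ A) (ha0 : s.arr 1 a = 0)
    (hFs : ∀ w, w ∈ Fs ↔ s.arr 1 w = x + 1)
    (h : ∀ s' t', ClusterFrame s s' →
      s'.arr 1 = Function.update (dumpLeader (s.arr 1) x) x (a + 1) →
      Clusters (s'.arr 2) (s'.arr 3) (s'.arr 1) A → IsHeap s' (Q ∪ Fs) → 
      t' ≤ t + Fs.card * (13 * N + 19) + 19 → Φ s' t') :
    WP H ω attachProg s t Φ := by
  have hdisj : Disjoint Q Fs := by
    rw [Finset.disjoint_right]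
    exact fun w hw hq => (hc.follower_notMem ((hFs w).1 hw)).1 (hQ' hq)
  have hsub : Q ∪ Fs ⊆ A := Finset.union_subset (fun q hq => hc.qsub q (hQ' hq))
    fun w hw => (hc.lead w x ((hFs w).1 hw)).1
  have hcard := Finset.card_le_card hsub
  rw [Finset.card_union_of_disjoint hdisj] at hcard
  refine WP.seq (WP.instr (WP.seq (wp_dump (N := N) (A := A) (Fs := Fs) (Q := Q) (by simpa using h0)
    (by simpa using h1) (hQ.congr rfl rfl rfl (by simp) rfl) (by simpa using hcl)
    (by simpa [hx] using hxA) (by simpa [hx] using hx0) (by simpa [hx] using hFs)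
    (fun w hw => Finset.disjoint_right.1 hdisj hw) (by omega) ?_)))
  intro s1 t1 hf1 a1 a2 a3 hheap ht1
  simp only [Instr.step, MState.var_setVar, MState.arr_setVar, if_true, hx] at a1 a2 a3
  have e13 : s1.var 13 = x := by rw [hf1.var 13 (by omega) (by omega)]; simp [hx]
  have e14 : s1.var 14 = a := by rw [hf1.var 14 (by omega) (by omega)]; simp [ha]
  refine WP.seq (WP.block (wp_link (x := x) (u := a) (by simp [e13]) (by simp [e14]) ?_))
  intro s2 t2 hf2 b1 b2 b3 b4 b5 b8 bv ht2
  have hcl1 : Clusters (s1.arr 2) (s1.arr 3) (s1.arr 1) A := by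
    rw [a1, a2, a3]; exact hcl.dump hc.flat hx0
  simp at b1 b2 b3 b4 b5 b8 bv
  refine h s2 t2 ?_ ?_ ?_ ?_ ?_
  · exact (ClusterFrame.setVar s le_rfl _).trans (hf1.trans ((ClusterFrame.setVar s1
      (by omega : 20 ≤ 23) _).trans ((ClusterFrame.setVar _ (by omega : 20 ≤ 24) _).trans hf2)))
  · rw [b1, a1]
  · rw [b1, b2, b3]
    refine hcl1.link ?_ hax ?_ haA
    · rw [a1, dumpLeader, hx0]; simp
    · rw [a1, dumpLeader, ha0]; simp
  · exact hheap.congr b4 b5 b8 bv (by rw [hf2.rank]; rfl)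
  · simp only [List.length_cons, List.length_nil] at ht2
    omega

theorem Mid.wp_drop (h : Mid G π K A S₀ ℓ₀ M₀ s (L₁ ++ x :: L₂) Q (π u) X Y)
    (hA : A.card < 2 ^ N) (hx : s.var 13 = x) (hu : s.var 14 = u) (huL : u ∈ L₁)
    (hadj : G.Adj u x) (hlt : (π u : ℝ) < π x)
    (hind : ∀ a ∈ L₁ ++ x :: L₂, ∀ b ∈ L₁ ++ x :: L₂, G.Adj a b → a = u ∨ b = u)
    (hΦ : ∀ s' t' Q' X', ClusterFrame s s' →
      Mid G π K A S₀ ℓ₀ M₀ s' (L₁ ++ L₂) Q' (π u) X' Y →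
      Q'.card + X.card = Q.card + X'.card →
      t' + (13 * N + 19) * X.card ≤ t + (13 * N + 19) * X'.card + 19 → Φ s' t') :
    WP H ω attachProg s t Φ := by
  obtain ⟨Fs, hFs, -, hdisj⟩ := exists_followers h.core x
  have hXd : Disjoint X Fs := h.hist.disjoint_followers (fun _ => hlt) hFs
  have huL' : u ∈ L₁ ++ x :: L₂ := by simp [huL]
  have hxL : x ∈ L₁ ++ x :: L₂ := by simp
  refine wp_attach h.zero h.one h.heap h.clusters subset_rfl h.core hA hx hu (h.core.sub _ hxL)
    (h.core.zeroS _ hxL) (fun e => by subst e; exact lt_irrefl _ hlt) (h.core.sub _ huL')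
    (h.core.zeroS _ huL') hFs fun s' t' hf a1 hcl hheap ht => ?_
  refine hΦ s' t' (Q ∪ Fs) (X ∪ Fs) hf ⟨?_, ?_, ?_, ?_, hheap, hcl, ?_, ?_⟩ ?_ ?_
  · rw [hf.var 4 (by omega) (by omega), h.zero]
  · rw [hf.var 5 (by omega) (by omega), h.one]
  · rw [hf.var 6 (by omega) (by omega), h.cap]
  · rw [hf.rank]; exact h.rank
  · rw [a1]; exact h.core.drop huL hadj hlt hFs
  · rw [a1]; exact h.hist.drop h.core huL hadj hlt hind hFs
  · rw [Finset.card_union_of_disjoint hdisj, Finset.card_union_of_disjoint hXd]; ring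
  · rw [Finset.card_union_of_disjoint hXd, mul_add]
    rw [mul_comm Fs.card] at ht
    omega

end Attach

/-- The array `a` begins with the elements of the list `S`. -/
def ListAt (a : ℕ → ℕ) (S : List ℕ) : Prop := ∀ P x L, S = P ++ x :: L → a P.length = x

theorem ListAt.map_range {a : ℕ → ℕ} {S : List ℕ} (h : ListAt a S) :
    (List.range S.length).map a = S := by
  refine List.ext_getElem (by simp) fun i h1 h2 => ?_
  have := h (S.take i) S[i] (S.drop (i + 1)) (by simp)
  rw [List.length_take, min_eq_left h2.le] at this
  simpa using this

theorem ListAt.take {a : ℕ → ℕ} {S L : List ℕ} (h : ListAt a (S ++ L)) : ListAt a S :=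
  fun P x T e => h P x (T ++ L) (by simp [e])

theorem ListAt.snoc {a : ℕ → ℕ} {S : List ℕ} (h : ListAt a S) (x : ℕ) :
    ListAt (Function.update a S.length x) (S ++ [x]) := by
  intro P y T e
  rcases T.eq_nil_or_concat with rfl | ⟨T', z, rfl⟩
  · obtain ⟨rfl, e⟩ := List.append_inj' e rfl
    simp at e
    simp [e]
  · have e : S ++ [x] = (P ++ y :: T') ++ [z] := by rw [e]; simp
    obtain ⟨rfl, -⟩ := List.append_inj' e rfl
    rw [Function.update_of_ne (by simp), h P y T' rfl]

/-- What operations on temporary variables leave unchanged. -/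
structure TempFrame (s s' : MState) : Prop where
  var : ∀ x, x < 11 ∨ 19 ≤ x → s'.var x = s.var x
  arr : s'.arr = s.arr
  rank : s'.rank = s.rank
  drawn : s'.drawn = s.drawn

theorem TempFrame.trans {s s' s'' : MState} (h : TempFrame s s') (h' : TempFrame s' s'') :
    TempFrame s s'' :=
  ⟨fun x h1 => (h'.var x h1).trans (h.var x h1), h'.arr.trans h.arr, h'.rank.trans h.rank,
    h'.drawn.trans h.drawn⟩

theorem TempFrame.setVar (s : MState) {x : ℕ} (hx : 11 ≤ x) (hx' : x < 19) (n : ℕ) :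
    TempFrame s (s.setVar x n) :=
  ⟨fun y h1 => by simp [show y ≠ x by omega], rfl, rfl, rfl⟩

/-- Look in the list for the first vertex that is not before the vertex in variable `10` or
adjacent to it. Put `1` plus this vertex into variable `15` if it is before and adjacent, otherwise
put its position into variable `11`. -/
def scanProg : Prog :=
  Prog.block [.const 11 0, .copy 12 7, .const 15 0] ;;
  .while (.lt 11 12) (
    Prog.block [.load 13 0 11, .lessRank 14 0 13 0 10] ;;
    .ite (.eq 14 5)
      (.instr (.adj 14 13 10) ;;
        .ite (.eq 14 5) (Prog.block [.copy 15 13, .inc 15, .const 12 0]) (.instr (.inc 11)))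
      (.instr (.const 12 0)))

section Scan

variable {G : SimpleGraph ℕ} {ω π : ℕ → I} {A : Finset ℕ} {S : List ℕ} {u : ℕ} {s : MState} {t : ℕ}
  {Φ : MState → ℕ → Prop}

theorem activeGraph_adj {a b : ℕ} (ha : a ∈ A) (hb : b ∈ A) :
    (activeGraph G A).Adj a b ↔ G.Adj a b :=
  ⟨fun h => h.1, fun h => ⟨h, ha, hb⟩⟩

theorem holds_adj {H : SimpleGraph ℕ} {x y a b v w : ℕ} (hy : s.var y = 1) (hne : y ≠ x)
    (ha : s.var a = v) (hb : s.var b = w) :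
    (Test.eq x y).Holds (Instr.step H ω s (.adj x a b)) ↔ H.Adj v w := by
  simp only [Test.Holds, Instr.step, MState.var_setVar, if_true, if_neg hne, hy, ha, hb]
  subst ha hb
  split_ifs with h <;> simpa using h

/-- The result of the search in the list. -/
def ScanResult (G : SimpleGraph ℕ) (π : ℕ → I) (S : List ℕ) (u : ℕ) (s : MState) : Prop :=
  ∃ P L, S = P ++ L ∧ (∀ p ∈ P, (π p : ℝ) < π u ∧ ¬ G.Adj p u) ∧
    ((∃ x L', L = x :: L' ∧ s.var 15 = x + 1 ∧ (π x : ℝ) < π u ∧ G.Adj x u) ∨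
      (s.var 15 = 0 ∧ s.var 11 = P.length ∧ ∀ x ∈ L, (π u : ℝ) ≤ π x))

theorem wp_scan (hl : ListAt (s.arr 0) S) (h5 : s.var 5 = 1) (h7 : s.var 7 = S.length)
    (h10 : s.var 10 = u) (hr : ∀ v ∈ A, s.rank 0 v = π v) (hS : ∀ x ∈ S, x ∈ A) (hu : u ∈ A)
    (hsort : S.Pairwise fun a b => (π a : ℝ) < π b)
    (h : ∀ s' t', TempFrame s s' → ScanResult G π S u s' → t' ≤ t + 9 * S.length + 10 → Φ s' t') :
    WP (activeGraph G A) ω scanProg s t Φ := by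
  refine WP.seq (WP.block (WP.while (n := S.length + 1) (fun n s' t' => TempFrame s s' ∧
    ((∃ P L, S = P ++ L ∧ n = L.length + 1 ∧ s'.var 11 = P.length ∧ s'.var 12 = S.length ∧
        s'.var 15 = 0 ∧ (∀ p ∈ P, (π p : ℝ) < π u ∧ ¬ G.Adj p u) ∧
        t' + 9 * L.length ≤ t + 3 + 9 * S.length) ∨
      (n = 0 ∧ s'.var 12 = 0 ∧ ScanResult G π S u s' ∧ t' ≤ t + 6 + 9 * S.length))) ?_ ?_ ?_))
  · refine ⟨⟨fun x hx => ?_, rfl, rfl, rfl⟩, .inl ⟨[], S, rfl, rfl, ?_, ?_, ?_, ?_, ?_⟩⟩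
    · simp [show x ≠ 11 by omega, show x ≠ 12 by omega, show x ≠ 15 by omega]
    · simp
    · simp [h7]
    · simp
    · simp
    · simp
  · rintro n s1 t1 ⟨hf, hJ⟩ hb
    rcases hJ with ⟨P, L, rfl, rfl, e11, e12, e15, hP, ht⟩ | ⟨-, e12, -⟩
    swap
    · simp [e12] at hb
    rcases L with - | ⟨x, L⟩
    · simp [e11, e12] at hb
    have hx : s1.arr 0 (s1.var 11) = x := by rw [hf.arr, e11, hl P x L rfl]
    have hxA := hS x (by simp)
    have e10 : s1.var 10 = u := (hf.var 10 (by omega)).trans h10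
    have e5 : s1.var 5 = 1 := (hf.var 5 (by omega)).trans h5
    have hrx : s1.rank 0 x = π x := by rw [hf.rank, hr x hxA]
    have hru : s1.rank 0 u = π u := by rw [hf.rank, hr u hu]
    have hfr : ∀ n m, TempFrame s ((s1.setVar 13 n).setVar 14 m) := fun n m =>
      hf.trans ((TempFrame.setVar _ (by omega) (by omega) n).trans
        (TempFrame.setVar _ (by omega) (by omega) m))
    simp only [List.length_append, List.length_cons] at ht h ⊢
    refine WP.seq (WP.block (WP.ite (fun hb1 => ?_) (fun hb1 => WP.instr ?_)))
    · simp [hx, hrx, hru, e10, e5] at hb1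
      refine WP.seq (WP.instr (WP.ite (fun hb2 => WP.block ?_) (fun hb2 => WP.instr ?_)))
      · rw [holds_adj (v := x) (w := u) (by simp [e5]) (by omega) (by simp [hx]) (by simp [e10]),
          activeGraph_adj hxA hu] at hb2
        refine ⟨0, by omega, ?_, .inr ⟨rfl, by simp, ⟨P, x :: L, rfl, hP, .inl ⟨x, L, rfl, ?_, hb1,
          hb2⟩⟩, ?_⟩⟩
        · refine (hfr _ _).trans ((TempFrame.setVar _ (by omega : 11 ≤ 14) (by omega) _).trans
            ((TempFrame.setVar _ (by omega : 11 ≤ 15) (by omega) _).trans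
            ((TempFrame.setVar _ (by omega : 11 ≤ 15) (by omega) _).trans
            (TempFrame.setVar _ (by omega : 11 ≤ 12) (by omega) _))))
        · simp [hx]
        · simp only [List.length_cons, List.length_nil]; omega
      · rw [holds_adj (v := x) (w := u) (by simp [e5]) (by omega) (by simp [hx]) (by simp [e10]),
          activeGraph_adj hxA hu] at hb2
        refine ⟨L.length + 1, by omega, ?_, .inl ⟨P ++ [x], L, by simp, rfl, ?_, ?_, ?_, ?_, ?_⟩⟩
        · exact (hfr _ _).trans ((TempFrame.setVar _ (by omega : 11 ≤ 14) (by omega) _).trans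
            (TempFrame.setVar _ (by omega : 11 ≤ 11) (by omega) _))
        · simp [e11]
        · simp [e12]
        · simp [e15]
        · intro p hp
          rcases List.mem_append.1 hp with hp | hp
          · exact hP p hp
          · rw [List.mem_singleton.1 hp]; exact ⟨hb1, hb2⟩
        · simp only [List.length_cons, List.length_nil]; omega
    · simp [hx, hrx, hru, e10, e5] at hb1
      refine ⟨0, by omega, ?_, .inr ⟨rfl, by simp, ⟨P, x :: L, rfl, hP, .inr ⟨?_, ?_, ?_⟩⟩, ?_⟩⟩
      · exact (hfr _ _).trans (TempFrame.setVar _ (by omega : 11 ≤ 12) (by omega) _)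
      · simp [e15]
      · simp [e11]
      · have hb1 : (π u : ℝ) ≤ π x := hb1
        intro y hy
        rcases List.mem_cons.1 hy with rfl | hy
        · exact hb1
        · have := (List.pairwise_cons.1 (List.pairwise_append.1 hsort).2.1).1 y hy
          linarith
      · simp only [List.length_cons, List.length_nil]; omega
  · rintro n s1 t1 ⟨hf, hJ⟩ hb
    rcases hJ with ⟨P, L, rfl, rfl, e11, e12, e15, hP, ht⟩ | ⟨-, e12, hres, ht⟩
    · rcases L with - | ⟨x, L⟩
      · refine h _ _ hf ⟨P, [], rfl, hP, .inr ⟨e15, e11, by simp⟩⟩ ?_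
        simp only [List.length_nil] at ht
        omega
      · simp [e11, e12] at hb
    · exact h _ _ hf hres (by omega)

end Scan

/-- Go through the list from the position in variable `11` on. Attach the vertices that are adjacent
to the vertex `u` in variable `10` to `u`, and collect the others in the array `7`. -/
def filterProg : Prog :=
  Prog.block [.const 16 0, .copy 17 11] ;;
  .while (.lt 17 7) (
    Prog.block [.load 13 0 17, .inc 17] ;; .instr (.adj 14 13 10) ;;
    .ite (.eq 14 5) (.instr (.copy 14 10) ;; attachProg) (Prog.block [.store 7 16 13, .inc 16]))

/-- Append the elements collected in the array `7` to the list. -/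
def copyBackProg : Prog :=
  .instr (.const 17 0) ;;
  .while (.lt 17 16) (Prog.block [.load 13 7 17, .store 0 7 13, .inc 7, .inc 17])

/-- Move the last element of the list into the heap if the list is too long. -/
def overflowProg : Prog :=
  .ite (.lt 6 7) (Prog.block [.dec 7, .load 30 0 7] ;; pushProg) .skip

/-- Insert the vertex in variable `10` into the list, at the position in variable `11`. -/
def enterProg : Prog :=
  filterProg ;; Prog.block [.store 0 11 10, .copy 7 11, .inc 7] ;; copyBackProg ;; overflowProg

/-- What the main loop leaves unchanged. -/
structure LoopFrame (s s' : MState) : Prop where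
  var : ∀ x, x < 7 → s'.var x = s.var x
  arr : s'.arr 6 = s.arr 6
  rank : s'.rank = s.rank
  drawn : s'.drawn = s.drawn

theorem LoopFrame.refl (s : MState) : LoopFrame s s := ⟨fun _ _ => rfl, rfl, rfl, rfl⟩

theorem LoopFrame.trans {s s' s'' : MState} (h : LoopFrame s s') (h' : LoopFrame s' s'') :
    LoopFrame s s'' :=
  ⟨fun x h1 => (h'.var x h1).trans (h.var x h1), h'.arr.trans h.arr, h'.rank.trans h.rank,
    h'.drawn.trans h.drawn⟩

theorem TempFrame.loop {s s' : MState} (h : TempFrame s s') : LoopFrame s s' :=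
  ⟨fun x hx => h.var x (by omega), by rw [h.arr], h.rank, h.drawn⟩

section Enter

variable {G H : SimpleGraph ℕ} {ω π : ℕ → I} {K N : ℕ} {A : Finset ℕ} {S₀ : List ℕ} {ℓ₀ : ℕ → ℕ}
  {M₀ : ℕ → Prop} {S P L T L₁ L₂ : List ℕ} {Q : Finset ℕ} {τ : ℝ} {X Y : Finset ℕ}
  {u : ℕ} {s s' : MState} {t : ℕ} {Φ : MState → ℕ → Prop}

theorem Mid.congr (h : Mid G π K A S₀ ℓ₀ M₀ s S Q τ X Y)
    (hv : ∀ x, x < 9 → x ≠ 7 → s'.var x = s.var x)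
    (ha : ∀ a, 1 ≤ a → a ≤ 5 ∨ a = 8 → s'.arr a = s.arr a) (hr : s'.rank = s.rank) :
    Mid G π K A S₀ ℓ₀ M₀ s' S Q τ X Y where
  zero := by rw [hv 4 (by omega) (by omega), h.zero]
  one := by rw [hv 5 (by omega) (by omega), h.one]
  cap := by rw [hv 6 (by omega) (by omega), h.cap]
  rank := by rw [hr]; exact h.rank
  heap := h.heap.congr (ha 4 (by omega) (by omega)) (ha 5 (by omega) (by omega))
    (ha 8 (by omega) (by omega)) (hv 8 (by omega) (by omega)) (by rw [hr])
  clusters := by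
    rw [ha 1 (by omega) (by omega), ha 2 (by omega) (by omega), ha 3 (by omega) (by omega)]
    exact h.clusters
  core := by rw [ha 1 (by omega) (by omega)]; exact h.core
  hist := by rw [ha 1 (by omega) (by omega)]; exact h.hist

theorem wp_filter (h : Mid G π K A S₀ ℓ₀ M₀ s (P ++ u :: L) Q (π u) X Y) (hA : A.card < 2 ^ N)
    (hl : ListAt (s.arr 0) (P ++ L)) (h7 : s.var 7 = P.length + L.length) (h10 : s.var 10 = u)
    (h11 : s.var 11 = P.length)
    (hind : ∀ a ∈ P ++ u :: L, ∀ b ∈ P ++ u :: L, G.Adj a b → a = u ∨ b = u)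
    (hΦ : ∀ s' t' T Q' X', LoopFrame s s' → s'.var 7 = s.var 7 → s'.var 10 = u →
      s'.var 11 = P.length → s'.arr 0 = s.arr 0 → T.Sublist L →
      Mid G π K A S₀ ℓ₀ M₀ s' (P ++ u :: T) Q' (π u) X' Y → ListAt (s'.arr 7) T →
      s'.var 16 = T.length → (∀ x ∈ T, ¬ G.Adj u x) → Q'.card + X.card = Q.card + X'.card →
      t' + (13 * N + 19) * X.card ≤ t + (13 * N + 19) * X'.card + 26 * L.length + 3 → Φ s' t') :
    WP (activeGraph G A) ω filterProg s t Φ := by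
  refine WP.seq (WP.block (WP.while (n := L.length) (fun n s' t' => ∃ L₁ R T Q' X', L = L₁ ++ R ∧
    n = R.length ∧ LoopFrame s s' ∧ s'.var 7 = s.var 7 ∧ s'.var 10 = u ∧ s'.var 11 = P.length ∧
    s'.arr 0 = s.arr 0 ∧ T.Sublist L₁ ∧ Mid G π K A S₀ ℓ₀ M₀ s' (P ++ u :: (T ++ R)) Q' (π u) X' Y ∧
    ListAt (s'.arr 7) T ∧ s'.var 16 = T.length ∧ s'.var 17 = P.length + L₁.length ∧
    (∀ x ∈ T, ¬ G.Adj u x) ∧ Q'.card + X.card = Q.card + X'.card ∧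
    t' + (13 * N + 19) * X.card ≤ t + (13 * N + 19) * X'.card + 26 * L₁.length + 2) ?_ ?_ ?_))
  · refine ⟨[], L, [], Q, X, rfl, rfl, ⟨fun x hx => ?_, ?_, rfl, rfl⟩, ?_, ?_, ?_, ?_, ?_, ?_, ?_, ?_,
      ?_, ?_, ?_, ?_⟩
    · simp [show x ≠ 16 by omega, show x ≠ 17 by omega]
    · simp
    · simp
    · simp [h10]
    · simp [h11]
    · simp
    · simp
    · refine h.congr (fun x h1 h2 => ?_) (fun a _ _ => ?_) rfl
      · simp [show x ≠ 16 by omega, show x ≠ 17 by omega]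
      · simp
    · intro P x L e; simp at e
    · simp
    · simp [h11]
    · simp
    · rfl
    · simp only [List.length_nil, List.length_cons]; omega
  · rintro n s1 t1 ⟨L₁, R, T, Q', X', rfl, rfl, hf, e7, e10, e11, ea0, hsub, hm, hl7, e16, e17, hT,
      hc, ht⟩ hb
    have hb : s1.var 17 < s1.var 7 := hb
    rcases R with - | ⟨x, R⟩
    · simp [e17, e7, h7] at hb
    have e5 : s1.var 5 = 1 := hm.one
    have hx : s1.arr 0 (s1.var 17) = x := by
      rw [ea0, e17, ← List.length_append]
      exact hl (P ++ L₁) x R (by simp)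
    have huS : u ∈ P ++ u :: (T ++ x :: R) := by simp
    have hxS : x ∈ P ++ u :: (T ++ x :: R) := by simp
    have hxA := hm.core.sub x hxS
    have huA := hm.core.sub u huS
    have hsplit : P ++ u :: (T ++ x :: R) = (P ++ u :: T) ++ x :: R := by simp
    have hux : (π u : ℝ) < π x := by
      have := hm.core.sorted
      rw [List.pairwise_append, List.pairwise_cons] at this
      exact this.2.1.1 x (by simp)
    refine WP.seq (WP.block (WP.seq (WP.instr (WP.ite (fun hb1 => ?_) (fun hb1 => WP.block ?_)))))
    · rw [holds_adj (v := x) (w := u) (by simp [e5]) (by omega) (by simp [hx]) (by simp [e10]),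
        activeGraph_adj hxA huA] at hb1
      refine WP.seq (WP.instr ?_)
      rw [hsplit] at hm
      refine Mid.wp_drop (G := G) (π := π) (K := K) (A := A) (S₀ := S₀) (ℓ₀ := ℓ₀) (M₀ := M₀)
        (L₁ := P ++ u :: T) (L₂ := R) (x := x) (u := u) (Q := Q') (X := X') (Y := Y) (N := N)
        (hm.congr (fun y h1 h2 => ?_) (fun a _ _ => ?_) rfl) hA ?_ ?_ ?_ hb1.symm hux ?_ ?_
      · simp [show y ≠ 13 by omega, show y ≠ 14 by omega, show y ≠ 17 by omega]
      · simp
      · simp [hx]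
      · simp [e10]
      · simp
      · intro a ha b hb
        have : ∀ a, a ∈ (P ++ u :: T) ++ x :: R → a ∈ P ++ u :: (L₁ ++ x :: R) := by
          intro a ha
          have := hsub.subset (a := a)
          simp only [List.mem_append, List.mem_cons] at ha ⊢
          tauto
        exact hind a (this a ha) b (this b hb)
      · intro s2 t2 Q2 X2 hf2 hm2 hc2 ht2
        have hv : ∀ y, y < 20 → y ≠ 8 → y ≠ 13 → y ≠ 14 → y ≠ 17 → s2.var y = s1.var y := by
          intro y h1 h2 h3 h4 h5
          rw [hf2.var y h1 h2]
          simp [h3, h4, h5]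
        refine ⟨R.length, by simp, L₁ ++ [x], R, T, Q2, X2, by simp, rfl, hf.trans ⟨fun y hy =>
          hv y (by omega) (by omega) (by omega) (by omega) (by omega), ?_, ?_, ?_⟩, ?_, ?_, ?_, ?_, ?_,
          ?_, ?_, ?_, ?_, hT, by omega, ?_⟩
        · rw [hf2.arr 6 (by omega) (by omega) (by omega) (by omega) (by omega) (by omega)]; simp
        · rw [hf2.rank]; rfl
        · rw [hf2.drawn]; rfl
        · rw [hv 7 (by omega) (by omega) (by omega) (by omega) (by omega), e7]
        · rw [hv 10 (by omega) (by omega) (by omega) (by omega) (by omega), e10]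
        · rw [hv 11 (by omega) (by omega) (by omega) (by omega) (by omega), e11]
        · rw [hf2.arr 0 (by omega) (by omega) (by omega) (by omega) (by omega) (by omega), ← ea0]
          simp
        · exact hsub.trans (List.sublist_append_left _ _)
        · simpa using hm2
        · rw [hf2.arr 7 (by omega) (by omega) (by omega) (by omega) (by omega) (by omega)]
          simpa using hl7
        · rw [hv 16 (by omega) (by omega) (by omega) (by omega) (by omega), e16]
        · rw [hf2.var 17 (by omega) (by omega)]
          simp [e17]
          omega
        · simp only [List.length_append, List.length_cons, List.length_nil] at ht2 ⊢
          omega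
    · rw [holds_adj (v := x) (w := u) (by simp [e5]) (by omega) (by simp [hx]) (by simp [e10]),
        activeGraph_adj hxA huA] at hb1
      refine ⟨R.length, by simp, L₁ ++ [x], R, T ++ [x], Q', X', by simp, rfl,
        hf.trans ⟨fun y hy => ?_, ?_, rfl, rfl⟩, ?_, ?_, ?_, ?_, ?_,
          ?_, ?_, ?_, ?_, ?_, hc, ?_⟩
      · simp [show y ≠ 16 by omega, show y ≠ 14 by omega, show y ≠ 13 by omega, show y ≠ 17 by omega]
      · simp
      · simp [e7]
      · simp [e10]
      · simp [e11]
      · simp [ea0]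
      · exact hsub.append (List.Sublist.refl _)
      · refine Mid.congr (s := s1) (by simpa using hm) (fun y h1 h2 => ?_) (fun a h1 h2 => ?_) rfl
        · simp [show y ≠ 16 by omega, show y ≠ 14 by omega, show y ≠ 13 by omega,
            show y ≠ 17 by omega]
        · simp [show a ≠ 7 by omega]
      · simpa [e16, hx] using hl7.snoc x
      · simp [e16]
      · simp [e17]
        omega
      · intro y hy
        rcases List.mem_append.1 hy with hy | hy
        · exact hT y hy
        · rw [List.mem_singleton.1 hy]; exact fun h => hb1 h.symm
      · simp only [List.length_append, List.length_cons, List.length_nil] at ht ⊢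
        omega
  · rintro n s1 t1 ⟨L₁, R, T, Q', X', rfl, rfl, hf, e7, e10, e11, ea0, hsub, hm, hl7, e16, e17, hT,
      hc, ht⟩ hb
    have hb : ¬ s1.var 17 < s1.var 7 := hb
    have hR : R = [] := by
      rw [e17, e7, h7, List.length_append] at hb
      exact List.length_eq_zero_iff.1 (by omega)
    subst hR
    rw [List.append_nil] at hm
    exact hΦ s1 _ T Q' X' hf e7 e10 e11 ea0 (by simpa using hsub) hm hl7 e16 hT hc
      (by simp only [List.append_nil]; omega)

theorem wp_copyBack (hl : ListAt (s.arr 0) P) (h7 : s.var 7 = P.length)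
    (hl7 : ListAt (s.arr 7) T) (h16 : s.var 16 = T.length)
    (hΦ : ∀ s' t', (∀ x, x ≠ 7 → x ≠ 13 → x ≠ 17 → s'.var x = s.var x) →
      (∀ a, a ≠ 0 → s'.arr a = s.arr a) → s'.rank = s.rank → s'.drawn = s.drawn →
      ListAt (s'.arr 0) (P ++ T) → s'.var 7 = P.length + T.length → t' ≤ t + 5 * T.length + 2 →
      Φ s' t') :
    WP H ω copyBackProg s t Φ := by
  refine WP.seq (WP.instr (WP.while (n := T.length) (fun n s' t' => ∃ T₁ T₂, T = T₁ ++ T₂ ∧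
    n = T₂.length ∧ (∀ x, x ≠ 7 → x ≠ 13 → x ≠ 17 → s'.var x = s.var x) ∧
      (∀ a, a ≠ 0 → s'.arr a = s.arr a) ∧ s'.rank = s.rank ∧ s'.drawn = s.drawn ∧
      ListAt (s'.arr 0) (P ++ T₁) ∧ s'.var 7 = P.length + T₁.length ∧ s'.var 17 = T₁.length ∧
      t' ≤ t + 5 * T₁.length + 1) ?_ ?_ ?_))
  · refine ⟨[], T, rfl, rfl, fun x h1 h2 h3 => ?_, fun a ha => ?_, rfl, rfl, ?_, ?_, ?_, ?_⟩
    · simp [h3]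
    · simp
    · simpa using hl
    · simp [h7]
    · simp
    · simp
  · rintro n s1 t1 ⟨T₁, T₂, rfl, rfl, hv, ha, hr, hd, hl0, e7, e17, ht⟩ hb
    have hb : s1.var 17 < s1.var 16 := hb
    rw [e17, hv 16 (by omega) (by omega) (by omega), h16] at hb
    rcases T₂ with - | ⟨x, T₂⟩
    · simp at hb
    have hx : s1.arr 7 (s1.var 17) = x := by
      rw [ha 7 (by omega), e17]; exact hl7 T₁ x T₂ rfl
    refine WP.block ⟨T₂.length, by simp, T₁ ++ [x], T₂, by simp, rfl, fun y h1 h2 h3 => ?_,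
      fun a h1 => ?_, hr, hd, ?_, ?_, ?_, ?_⟩
    · simp [h1, h2, h3, hv]
    · simp [h1, ha]
    · have := hl0.snoc x
      rw [List.length_append, ← e7] at this
      simpa [hx] using this
    · simp [e7]
      omega
    · simp [e17]
    · simp only [List.length_append, List.length_cons, List.length_nil] at ht ⊢
      omega
  · rintro n s1 t1 ⟨T₁, T₂, rfl, rfl, hv, ha, hr, hd, hl0, e7, e17, ht⟩ hb
    have hb : ¬ s1.var 17 < s1.var 16 := hb
    rw [e17, hv 16 (by omega) (by omega) (by omega), h16, List.length_append] at hb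
    have hT : T₂ = [] := List.length_eq_zero_iff.1 (by omega)
    subst hT
    exact hΦ s1 _ hv ha hr hd (by simpa using hl0) (by simpa using e7)
      (by simp only [List.append_nil]; omega)

end Enter

/-- One round of the main loop: remove the root of the heap, and attach it to a vertex of the list
or insert it into the list. -/
def bodyProg : Prog :=
  Prog.block [.const 11 1, .load 10 4 11] ;; removeRootProg ;; scanProg ;;
  .ite (.lt 4 15) (Prog.block [.copy 13 10, .copy 14 15, .dec 14] ;; attachProg) enterProg

/-- The machine and the abstract state at the beginning of a round of the main loop. -/
structure LoopState (G : SimpleGraph ℕ) (π : ℕ → I) (K : ℕ) (A : Finset ℕ) (S₀ : List ℕ)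
    (ℓ₀ : ℕ → ℕ) (M₀ : ℕ → Prop) (s : MState) (S : List ℕ) (Q : Finset ℕ) (τ : ℝ)
    (X Y : Finset ℕ) : Prop where
  mid : Mid G π K A S₀ ℓ₀ M₀ s S Q τ X Y
  list : ListAt (s.arr 0) S
  len : s.var 7 = S.length
  indep : Indep G S
  le : S.length ≤ K

section Body

variable {G H : SimpleGraph ℕ} {ω π : ℕ → I} {K N : ℕ} {A : Finset ℕ} {S₀ : List ℕ} {ℓ₀ : ℕ → ℕ}
  {M₀ : ℕ → Prop} {S P L T L₁ L₂ : List ℕ} {Q : Finset ℕ} {τ : ℝ} {X Y : Finset ℕ}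
  {u : ℕ} {s s' : MState} {t : ℕ} {Φ : MState → ℕ → Prop}

theorem wp_overflow (h : Mid G π K A S₀ ℓ₀ M₀ s S Q (π u) X Y) (hA : A.card < 2 ^ N)
    (hl : ListAt (s.arr 0) S) (h7 : s.var 7 = S.length) (hind : Indep G S)
    (hK : S.length ≤ K ∨ ∃ S' z, S = S' ++ [z] ∧ S'.length = K ∧ u ∈ S' ∧ ¬ M₀ u) (huY : u ∉ Y)
    (hΦ : ∀ s' t' S' Q' Y', LoopFrame s s' → LoopState G π K A S₀ ℓ₀ M₀ s' S' Q' (π u) X Y' →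
      Q'.card + Y.card = Q.card + Y'.card → t' ≤ t + 13 * N + 13 → Φ s' t') :
    WP H ω overflowProg s t Φ := by
  have e6 := h.cap
  refine WP.ite (fun hb => ?_) (fun hb => WP.skip ?_)
  · have hb : s.var 6 < s.var 7 := hb
    obtain ⟨S', z, rfl, hS', hu, hM⟩ := hK.resolve_left (by omega)
    have hz : s.arr 0 S'.length = z := hl S' z [] rfl
    have hzS : z ∈ S' ++ [z] := by simp
    have hzQ : z ∉ Q := fun hq => h.core.disj z hq hzS
    have hcore := h.core.overflow
    have hcard := Finset.card_le_card (fun v hv => hcore.qsub v hv : insert z Q ⊆ A)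
    have hsize := h.heap.size
    rw [Finset.card_insert_of_notMem hzQ] at hcard
    refine WP.seq (WP.block (wp_push (N := N) (Q := Q) (by simp [h.zero]) (by simp [h.one])
      (h.heap.congr rfl rfl rfl (by simp) rfl) ?_ ?_ ?_))
    · simp [h7, hz, hzQ]
    · simp; omega
    · intro s1 t1 hf hheap ht
      simp [h7, hz] at hheap
      have ha : ∀ a, a ≠ 4 → a ≠ 5 → a ≠ 8 → s1.arr a = s.arr a := fun a h1 h2 h3 => by
        rw [hf.arr a h1 h2 h3]; simp
      have hv : ∀ x, x < 30 → x ≠ 7 → x ≠ 8 → s1.var x = s.var x := fun x h1 h2 h3 => by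
        rw [hf.var x h1 h3]; simp [h2, show x ≠ 30 by omega]
      have hr : s1.rank = s.rank := by rw [hf.rank]; rfl
      refine hΦ s1 t1 S' (insert z Q) (insert u Y) ⟨fun x hx => hv x (by omega) (by omega) (by omega),
        ha 6 (by omega) (by omega) (by omega), hr, ?_⟩ ⟨⟨?_, ?_, ?_, ?_, hheap, ?_, ?_, ?_⟩, ?_,
        ?_, ?_, ?_⟩ ?_ ?_
      · rw [hf.drawn]; rfl
      · rw [hv 4 (by omega) (by omega) (by omega), h.zero]
      · rw [hv 5 (by omega) (by omega) (by omega), h.one]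
      · rw [hv 6 (by omega) (by omega) (by omega), h.cap]
      · rw [hr]; exact h.rank
      · rw [ha 1 (by omega) (by omega) (by omega), ha 2 (by omega) (by omega) (by omega),
          ha 3 (by omega) (by omega) (by omega)]
        exact h.clusters
      · rw [ha 1 (by omega) (by omega) (by omega)]; exact hcore
      · rw [ha 1 (by omega) (by omega) (by omega)]; exact h.hist.overflow h.core.sorted hu hM
      · rw [ha 0 (by omega) (by omega) (by omega)]; exact hl.take
      · rw [hf.var 7 (by omega) (by omega)]; simp [h7]
      · exact fun a ha b hb => hind a (by simp [ha]) b (by simp [hb])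
      · exact hS'.le
      · rw [Finset.card_insert_of_notMem hzQ, Finset.card_insert_of_notMem huY]; omega
      · simp only [List.length_cons, List.length_nil] at ht; omega
  · have hb : ¬ s.var 6 < s.var 7 := hb
    exact hΦ s _ S Q Y (LoopFrame.refl s) ⟨h, hl, h7, hind, by omega⟩ rfl (by omega)

theorem wp_enter (h : Mid G π K A S₀ ℓ₀ M₀ s (P ++ u :: L) Q (π u) X Y) (hA : A.card < 2 ^ N)
    (hl : ListAt (s.arr 0) (P ++ L)) (h7 : s.var 7 = P.length + L.length) (h10 : s.var 10 = u)
    (h11 : s.var 11 = P.length) (hP : ∀ p ∈ P, ¬ G.Adj p u) (hind : Indep G (P ++ L))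
    (hK : P.length + L.length ≤ K) (hg : P.length + L.length < K ∨ L ≠ []) (hM : L ≠ [] → ¬ M₀ u)
    (huY : u ∉ Y)
    (hΦ : ∀ s' t' S' Q' X' Y', LoopFrame s s' →
      LoopState G π K A S₀ ℓ₀ M₀ s' S' Q' (π u) X' Y' →
      Q'.card + X.card + Y.card = Q.card + X'.card + Y'.card →
      t' + (13 * N + 19) * X.card ≤ t + (13 * N + 19) * X'.card + 31 * K + 13 * N + 21 → Φ s' t') :
    WP (activeGraph G A) ω enterProg s t Φ := by
  have hmem : ∀ a, a ∈ P ++ u :: L → a = u ∨ a ∈ P ++ L := fun a ha => by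
    simp only [List.mem_append, List.mem_cons] at ha ⊢; tauto
  refine WP.seq (wp_filter h hA hl h7 h10 h11 ?_ ?_)
  · intro a ha b hb hab
    rcases hmem a ha with h1 | h1
    · exact .inl h1
    rcases hmem b hb with h2 | h2
    · exact .inr h2
    exact absurd hab (hind a h1 b h2)
  intro s1 t1 T Q1 X1 hf1 e7 e10 e11 ea0 hsub hm hl7 e16 hT hc1 ht1
  have hind1 : Indep G (P ++ u :: T) := by
    have hTL := hsub.subset
    have key : ∀ b ∈ P ++ u :: T, ¬ G.Adj u b := by
      intro b hb
      simp only [List.mem_append, List.mem_cons] at hb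
      rcases hb with hb | rfl | hb
      · exact fun h => hP b hb h.symm
      · exact G.loopless.irrefl _
      · exact hT b hb
    intro a ha b hb hab
    have hs : ∀ c, c ∈ P ++ u :: T → c ∈ P ++ u :: L := fun c hc => by
      simp only [List.mem_append, List.mem_cons] at hc ⊢
      rcases hc with hc | hc | hc
      · exact .inl hc
      · exact .inr (.inl hc)
      · exact .inr (.inr (hTL hc))
    rcases hmem a (hs a ha) with rfl | h1
    · exact key b hb hab
    rcases hmem b (hs b hb) with rfl | h2
    · exact key a ha hab.symm
    exact hind a h1 b h2 hab
  have hTlen := hsub.length_le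
  refine WP.seq (WP.block (WP.seq (wp_copyBack (P := P ++ [u]) (T := T) ?_ ?_ ?_ ?_ ?_)))
  · have : ListAt (s1.arr 0) P := by rw [ea0]; exact hl.take
    have := this.snoc u
    rw [← e11] at this
    simpa [e10] using this
  · simp [e11]
  · simpa using hl7
  · simp [e16]
  intro s2 t2 hv2 ha2 hr2 hd2 hl2 e72 ht2
  refine wp_overflow (G := G) (π := π) (K := K) (A := A) (S₀ := S₀) (ℓ₀ := ℓ₀) (M₀ := M₀)
    (S := P ++ u :: T) (u := u) (Q := Q1) (X := X1) (Y := Y) (N := N)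
    (hm.congr (fun x h1 h2 => ?_) (fun a h1 h2 => ?_) ?_) hA ?_ ?_ hind1 ?_ huY ?_
  · rw [hv2 x (by omega) (by omega) (by omega)]; simp [show x ≠ 7 by omega]
  · rw [ha2 a (by omega)]; simp [show a ≠ 0 by omega]
  · rw [hr2]; rfl
  · simpa using hl2
  · rw [e72]; simp; omega
  · by_cases hlen : (P ++ u :: T).length ≤ K
    · exact .inl hlen
    simp only [List.length_append, List.length_cons] at hlen
    have hL : L ≠ [] := hg.resolve_left (by omega)
    have hTL : T = L := hsub.eq_of_length_le (by omega)
    subst hTL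
    obtain ⟨T', z, rfl⟩ := T.eq_nil_or_concat.resolve_left hL
    refine .inr ⟨P ++ u :: T', z, by simp, ?_, by simp, hM hL⟩
    simp only [List.length_append, List.length_cons, List.length_concat] at hlen hK ⊢
    omega
  · intro s3 t3 S3 Q3 Y3 hf3 hs3 hc3 ht3
    refine hΦ s3 t3 S3 Q3 X1 Y3 (hf1.trans (LoopFrame.trans ⟨fun x hx => ?_, ?_, ?_, ?_⟩ hf3)) hs3
      (by omega) ?_
    · rw [hv2 x (by omega) (by omega) (by omega)]; simp [show x ≠ 7 by omega]
    · rw [ha2 6 (by omega)]; simp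
    · rw [hr2]; rfl
    · rw [hd2]; rfl
    · simp only [List.length_cons, List.length_nil] at ht2
      omega

end Body

/-- The main loop: it runs until the heap is empty, or the list is full and the root of the heap is
after all of its elements. -/
def loopProg : Prog :=
  .instr (.const 18 1) ;;
  .while (.eq 18 5) (
    .ite (.lt 4 8)
      (.ite (.lt 7 6) .skip (Prog.block [.copy 11 7, .dec 11, .load 13 0 11, .const 14 1,
        .load 10 4 14, .lessRank 18 0 10 0 13]))
      (.instr (.const 18 0)) ;;
    .ite (.eq 18 5) (bodyProg ;; .instr (.const 18 1)) .skip)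

section MainLoop

variable {G : SimpleGraph ℕ} {ω π : ℕ → I} {K N : ℕ} {A : Finset ℕ} {S₀ : List ℕ} {ℓ₀ : ℕ → ℕ}
  {M₀ : ℕ → Prop} {S : List ℕ} {Q : Finset ℕ} {τ : ℝ} {X Y : Finset ℕ}
  {s : MState} {t : ℕ} {Φ : MState → ℕ → Prop}

theorem Mid.root (h : Mid G π K A S₀ ℓ₀ M₀ s S Q τ X Y) (hπ : π.Injective) (hpos : 0 < s.var 8) :
    s.arr 4 1 ∈ Q ∧ ∀ q ∈ Q.erase (s.arr 4 1), (π (s.arr 4 1) : ℝ) < π q := by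
  have hu := h.heap.map.mem 1 le_rfl hpos
  refine ⟨hu, fun q hq => ?_⟩
  obtain ⟨hne, hq⟩ := Finset.mem_erase.1 hq
  have h1 := h.heap.ord.le_root _ (h.heap.map.one_le q hq) (h.heap.map.le q hq)
  rw [h.heap.map.heap_pos q hq, h.rank _ (h.core.qsub q hq), h.rank _ (h.core.qsub _ hu)] at h1
  exact lt_of_le_of_ne h1 fun e => hne (hπ (Subtype.ext e)).symm

theorem LoopState.wp_body (h : LoopState G π K A S₀ ℓ₀ M₀ s S Q τ X Y) (hπ : π.Injective)
    (hA : A.card < 2 ^ N) (hM : ∀ y, M₀ y → ∀ x ∈ S₀, (π y : ℝ) < π x → y ∈ S₀)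
    (hpos : 0 < s.var 8) (hg : S.length < K ∨ ∃ z ∈ S, (π (s.arr 4 1) : ℝ) < π z)
    (hΦ : ∀ s' t' S' Q' X' Y', LoopFrame s s' →
      LoopState G π K A S₀ ℓ₀ M₀ s' S' Q' (π (s.arr 4 1)) X' Y' →
      Q'.card + X.card + Y.card + 1 = Q.card + X'.card + Y'.card →
      t' + (13 * N + 19) * X.card ≤ t + (13 * N + 19) * X'.card + 40 * K + 37 * N + 80 → Φ s' t') :
    WP (activeGraph G A) ω bodyProg s t Φ := by
  obtain ⟨hm, hl, h7, hind, hK⟩ := h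
  obtain ⟨huQ, hmin⟩ := hm.root hπ hpos
  obtain ⟨u, hu⟩ : ∃ u, u = s.arr 4 1 := ⟨_, rfl⟩
  rw [← hu] at huQ hmin hg hΦ
  have hτ := hm.hist.queue u huQ
  have huA := hm.core.qsub u huQ
  have huS := hm.core.disj u huQ
  have huY : u ∉ Y := fun hy => huS (hm.hist.fresh u hy).1
  have hQcard := Finset.card_le_card (fun v hv => hm.core.qsub v hv : Q ⊆ A)
  have hsize := hm.heap.size
  have hQe := Finset.card_erase_add_one huQ
  refine WP.seq (WP.block (WP.seq (wp_removeRoot (N := N) (Q := Q) (by simp [hm.zero])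
    (by simp [hm.one]) ⟨?_, ?_, ?_⟩ (by simpa using hpos) (by simp; omega) ?_)))
  · simpa using hm.heap.map
  · simpa using hm.heap.tab
  · have := hm.heap.ord.except (i := 1)
    simpa using this
  intro s1 t1 hf1 hheap1 ht1
  simp only [List.length_cons, List.length_nil] at ht1
  have hroot : (List.foldl (Instr.step (activeGraph G A) ω) s [Instr.const 11 1, Instr.load 10 4 11]).arr
      4 1 = u := by simp [hu]
  rw [hroot] at hheap1
  have hv1 : ∀ x, x < 30 → x ≠ 8 → x ≠ 10 → x ≠ 11 → s1.var x = s.var x := fun x h1 h2 h3 h4 => by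
    rw [hf1.var x h1 h2]; simp [h3, h4]
  have ha1 : ∀ a, a ≠ 4 → a ≠ 5 → a ≠ 8 → s1.arr a = s.arr a := fun a h1 h2 h3 => by
    rw [hf1.arr a h1 h2 h3]; simp
  have hr1 : s1.rank = s.rank := by rw [hf1.rank]; rfl
  have hd1 : s1.drawn = s.drawn := by rw [hf1.drawn]; rfl
  have e10 : s1.var 10 = u := by rw [hf1.var 10 (by omega) (by omega)]; simp [hu]
  refine WP.seq (wp_scan (π := π) (S := S) (u := u) (by rw [ha1 0 (by omega) (by omega) (by omega)]; exact hl)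
    (by rw [hv1 5 (by omega) (by omega) (by omega) (by omega), hm.one])
    (by rw [hv1 7 (by omega) (by omega) (by omega) (by omega), h7]) e10
    (by rw [hr1]; exact hm.rank) hm.core.sub huA hm.core.sorted ?_)
  intro s2 t2 hf2 hres ht2
  have hv2 : ∀ x, x < 30 → x ≠ 8 → (x < 10 ∨ 19 ≤ x) → s2.var x = s.var x := fun x h1 h2 h3 => by
    rw [hf2.var x (by omega), hv1 x h1 h2 (by omega) (by omega)]
  have ha2 : ∀ a, a ≠ 4 → a ≠ 5 → a ≠ 8 → s2.arr a = s.arr a := fun a h1 h2 h3 => by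
    rw [hf2.arr, ha1 a h1 h2 h3]
  have hr2 : s2.rank = s.rank := by rw [hf2.rank, hr1]
  have hd2 : s2.drawn = s.drawn := by rw [hf2.drawn, hd1]
  have hheap2 : IsHeap s2 (Q.erase u) := hheap1.congr (by rw [hf2.arr]) (by rw [hf2.arr])
    (by rw [hf2.arr]) (hf2.var 8 (by omega)) (by rw [hf2.rank])
  have hcl2 : Clusters (s2.arr 2) (s2.arr 3) (s2.arr 1) A := by
    rw [ha2 1 (by omega) (by omega) (by omega), ha2 2 (by omega) (by omega) (by omega),
      ha2 3 (by omega) (by omega) (by omega)]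
    exact hm.clusters
  have e21 : s2.arr 1 = s.arr 1 := ha2 1 (by omega) (by omega) (by omega)
  have e24 : s2.var 4 = 0 := by rw [hv2 4 (by omega) (by omega) (by omega), hm.zero]
  have e25 : s2.var 5 = 1 := by rw [hv2 5 (by omega) (by omega) (by omega), hm.one]
  have e26 : s2.var 6 = K := by rw [hv2 6 (by omega) (by omega) (by omega), hm.cap]
  have e210 : s2.var 10 = u := by rw [hf2.var 10 (by omega), e10]
  have hlf2 : LoopFrame s s2 := ⟨fun x hx => hv2 x (by omega) (by omega) (by omega),
    ha2 6 (by omega) (by omega) (by omega), hr2, hd2⟩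
  obtain ⟨P, L, rfl, hP, hres⟩ := hres
  refine WP.ite (fun hb => ?_) (fun hb => ?_)
  · have hb : s2.var 4 < s2.var 15 := hb
    obtain ⟨x, L', rfl, e15, hlt, hadj⟩ := hres.resolve_right fun hr => by omega
    have hx : x ∈ P ++ x :: L' := by simp
    have hfirst : ∀ a ∈ P ++ x :: L', G.Adj a u → (π x : ℝ) ≤ π a := by
      intro a ha hadj'
      rcases List.mem_append.1 ha with ha | ha
      · exact absurd hadj' (hP a ha).2
      · rcases List.mem_cons.1 ha with rfl | ha
        · exact le_rfl
        · exact ((List.pairwise_cons.1 (List.pairwise_append.1 hm.core.sorted).2.1).1 a ha).le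
    obtain ⟨Fs, hFs, -, hdisj⟩ := exists_followers hm.core u
    have hXd : Disjoint X Fs := hm.hist.disjoint_followers (fun h => absurd h huS) hFs
    have hQd : Disjoint (Q.erase u) Fs := Finset.disjoint_of_subset_left (Finset.erase_subset _ _) hdisj
    refine WP.seq (WP.block (wp_attach (N := N) (A := A) (Fs := Fs) (Q := Q.erase u) (Q' := Q)
      (x := u) (a := x) (by simp [e24]) (by simp [e25])
      (hheap2.congr (by simp) (by simp) (by simp) (by simp) (by simp)) (by simpa using hcl2)
      (Finset.erase_subset _ _) (by simpa [e21] using hm.core) hA (by simp [e210]) (by simp [e15])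
      huA (by simpa [e21] using hm.core.zeroQ u huQ) (by rintro rfl; exact huS hx)
      (hm.core.sub x hx) (by simpa [e21] using hm.core.zeroS x hx) (by simpa [e21] using hFs) ?_))
    intro s3 t3 hf3 b1 hcl3 hheap3 ht3
    simp only [List.length_cons, List.length_nil] at ht3
    simp only [List.foldl, Instr.step, MState.arr_setVar, e21] at b1
    have hv3 : ∀ x, x < 20 → x ≠ 8 → x ≠ 13 → x ≠ 14 → s3.var x = s2.var x :=
      fun x h1 h2 h3 h4 => by rw [hf3.var x h1 h2]; simp [h3, h4]
    have ha3 : ∀ a, a = 0 ∨ a = 6 → s3.arr a = s2.arr a := fun a h1 => by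
      rw [hf3.arr a (by omega) (by omega) (by omega) (by omega) (by omega) (by omega)]; simp
    have hr3 : s3.rank = s2.rank := by rw [hf3.rank]; rfl
    have hd3 : s3.drawn = s2.drawn := by rw [hf3.drawn]; rfl
    refine hΦ s3 t3 (P ++ x :: L') (Q.erase u ∪ Fs) (X ∪ Fs) Y (hlf2.trans ⟨fun y hy =>
      hv3 y (by omega) (by omega) (by omega) (by omega), ha3 6 (by omega), hr3, hd3⟩)
      ⟨⟨?_, ?_, ?_, ?_, hheap3, hcl3, ?_, ?_⟩, ?_, ?_, hind, hK⟩ ?_ ?_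
    · rw [hv3 4 (by omega) (by omega) (by omega) (by omega), e24]
    · rw [hv3 5 (by omega) (by omega) (by omega) (by omega), e25]
    · rw [hv3 6 (by omega) (by omega) (by omega) (by omega), e26]
    · rw [hr3, hr2]; exact hm.rank
    · rw [b1]; exact hm.core.demote huQ hx hadj hlt hFs
    · rw [b1]; exact hm.hist.demote hm.core huQ hmin hx hadj hlt hfirst hFs
    · rw [ha3 0 (by omega), ha2 0 (by omega) (by omega) (by omega)]; exact hl
    · rw [hv3 7 (by omega) (by omega) (by omega) (by omega), hv2 7 (by omega) (by omega) (by omega), h7]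
    · rw [Finset.card_union_of_disjoint hQd, Finset.card_union_of_disjoint hXd]; omega
    · rw [Finset.card_union_of_disjoint hXd, mul_add]
      rw [mul_comm Fs.card] at ht3
      omega
  · have hb : ¬ s2.var 4 < s2.var 15 := hb
    obtain ⟨e15, e11, hL⟩ := hres.resolve_left fun ⟨x, L', _, e, _⟩ => by omega
    have hL : ∀ x ∈ L, (π u : ℝ) < π x := fun x hx => lt_of_le_of_ne (hL x hx) fun e => huS (by
      rw [hπ (Subtype.ext e)]; simp [hx])
    have hM' : L ≠ [] → ¬ M₀ u := by
      intro hne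
      obtain ⟨z, L', rfl⟩ := List.exists_cons_of_ne_nil hne
      refine hm.hist.not_selected hm.core hM huQ (z := z) (by simp) (hL z (by simp)) ?_
      intro a ha hle
      rcases List.mem_append.1 ha with ha | ha
      · exact (hP a ha).2
      · exact absurd (hL a ha) hle.not_gt
    have hlen : (P ++ L).length = P.length + L.length := List.length_append
    refine wp_enter (G := G) (π := π) (K := K) (A := A) (S₀ := S₀) (ℓ₀ := ℓ₀) (M₀ := M₀)
      (P := P) (L := L) (u := u) (Q := Q.erase u) (X := X) (Y := Y) (N := N)
      ⟨e24, e25, e26, by rw [hr2]; exact hm.rank, hheap2, hcl2, ?_, ?_⟩ hA ?_ ?_ e210 e11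
      (fun p hp => (hP p hp).2) hind (by omega) ?_ hM' huY ?_
    · rw [e21]; exact hm.core.enter huQ (fun p hp => (hP p hp).1) hL
    · rw [e21]; exact hm.hist.enter huQ hmin (fun p hp => (hP p hp).1)
    · rw [ha2 0 (by omega) (by omega) (by omega)]; exact hl
    · rw [hv2 7 (by omega) (by omega) (by omega), h7, hlen]
    · refine hg.imp (fun h => by omega) ?_
      rintro ⟨z, hz, hlt⟩ rfl
      rw [List.append_nil] at hz
      exact lt_asymm hlt (hP z hz).1
    · intro s3 t3 S3 Q3 X3 Y3 hf3 hs3 hc3 ht3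
      exact hΦ s3 t3 S3 Q3 X3 Y3 (hlf2.trans hf3) hs3 (by omega) (by omega)

theorem LoopState.wp_loop {k : ℕ} (h : LoopState G π (k + 1) A S₀ ℓ₀ M₀ s S Q τ X Y)
    (hπ : π.Injective) (hA : A.card < 2 ^ N)
    (hM : ∀ y, M₀ y → ∀ x ∈ S₀, (π y : ℝ) < π x → y ∈ S₀)
    (hΦ : ∀ s' t' S' Q' τ' X' Y' m, LoopFrame s s' →
      LoopState G π (k + 1) A S₀ ℓ₀ M₀ s' S' Q' τ' X' Y' → Rest G π (k + 1) A S' Q' (s'.arr 1) →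
      Q'.card + X.card + Y.card + m = Q.card + X'.card + Y'.card →
      t' + (13 * N + 19) * X.card ≤
        t + (13 * N + 19) * X'.card + (40 * k + 37 * N + 140) * m + 20 → Φ s' t') :
    WP (activeGraph G A) ω loopProg s t Φ := by
  classical
  obtain ⟨E, hE⟩ : ∃ E, E = 40 * k + 37 * N + 140 := ⟨_, rfl⟩
  obtain ⟨c, hc⟩ : ∃ c, c = 13 * N + 19 := ⟨_, rfl⟩
  rw [← hE, ← hc] at hΦ
  refine WP.seq (WP.instr (WP.while (n := 2 * (A.filter fun v => τ < π v).card + 1)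
    (fun n s' t' => ∃ S' Q' τ' X' Y' m, LoopFrame s s' ∧
      LoopState G π (k + 1) A S₀ ℓ₀ M₀ s' S' Q' τ' X' Y' ∧
      Q'.card + X.card + Y.card + m = Q.card + X'.card + Y'.card ∧
      n = 2 * (A.filter fun v => τ' < π v).card + s'.var 18 ∧
      (s'.var 18 = 1 ∨ s'.var 18 = 0 ∧ Rest G π (k + 1) A S' Q' (s'.arr 1)) ∧
      t' + c * X.card + 12 * s'.var 18 ≤ t + c * X'.card + E * m + 13) ?_ ?_ ?_))
  · refine ⟨S, Q, τ, X, Y, 0, (TempFrame.setVar s (by omega : 11 ≤ 18) (by omega) 1).loop, ?_, rfl, ?_, ?_,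
      ?_⟩
    · exact ⟨h.mid.congr (fun x h1 h2 => by simp [show x ≠ 18 by omega]) (fun a _ _ => rfl) rfl,
        h.list, by simpa using h.len, h.indep, h.le⟩
    · simp
    · simp
    · simp; omega
  · rintro n s1 t1 ⟨S1, Q1, τ1, X1, Y1, m, hf, hs, hcard, rfl, hor, ht⟩ hb
    have hb : s1.var 18 = s1.var 5 := hb
    rw [hs.mid.one] at hb
    have e4 := hs.mid.zero
    have e5 := hs.mid.one
    have e6 := hs.mid.cap
    have e7 := hs.len
    have hsize := hs.mid.heap.size
    -- the end of the loop
    have halt : ∀ s2 : MState, TempFrame s1 (s2.setVar 10 (s1.var 10)) → s2.arr = s1.arr →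
        s2.rank = s1.rank → s2.drawn = s1.drawn → s2.var 18 = 0 →
        (Q1 = ∅ ∨ (S1.length = k + 1 ∧ ∀ q ∈ Q1, ∀ x ∈ S1, (π x : ℝ) < π q)) →
        ∀ t2 ≤ t1 + 10, WP (activeGraph G A) ω
          (.ite (.eq 18 5) (bodyProg ;; .instr (.const 18 1)) .skip) s2 t2
          fun s' t' => ∃ n' < 2 * (A.filter fun v => τ1 < π v).card + s1.var 18,
            ∃ S' Q' τ' X' Y' m, LoopFrame s s' ∧
            LoopState G π (k + 1) A S₀ ℓ₀ M₀ s' S' Q' τ' X' Y' ∧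
            Q'.card + X.card + Y.card + m = Q.card + X'.card + Y'.card ∧
            n' = 2 * (A.filter fun v => τ' < π v).card + s'.var 18 ∧
            (s'.var 18 = 1 ∨ s'.var 18 = 0 ∧ Rest G π (k + 1) A S' Q' (s'.arr 1)) ∧
            t' + c * X.card + 12 * s'.var 18 ≤ t + c * X'.card + E * m + 13 := by
      intro s2 hf2 ha hr hd e18 hdone t2 ht2
      have hv : ∀ x, x < 10 → s2.var x = s1.var x := fun x hx => by
        rw [← hf2.var x (by omega)]; simp [show x ≠ 10 by omega]
      refine WP.ite (fun hb => ?_) (fun hb => WP.skip ⟨_, ?_, S1, Q1, τ1, X1, Y1, m,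
        hf.trans ⟨fun x hx => hv x (by omega), by rw [ha], hr, hd⟩, ⟨?_, ?_, ?_, hs.indep, hs.le⟩,
        hcard, rfl, .inr ⟨e18, ?_⟩, ?_⟩)
      · have hb : s2.var 18 = s2.var 5 := hb
        rw [e18, hv 5 (by omega), e5] at hb
        omega
      · rw [e18]; omega
      · exact hs.mid.congr (fun x h1 h2 => hv x (by omega)) (fun a _ _ => by rw [ha]) hr
      · rw [ha]; exact hs.list
      · rw [hv 7 (by omega), e7]
      · exact ⟨by rw [ha]; exact hs.mid.core, hs.indep, hs.le, hdone⟩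
      · rw [e18]; omega
    have cont : ∀ s2 : MState, TempFrame s1 (s2.setVar 10 (s1.var 10)) → s2.arr = s1.arr →
        s2.rank = s1.rank → s2.drawn = s1.drawn → s2.var 18 = 1 → 0 < s1.var 8 →
        (S1.length < k + 1 ∨ ∃ z ∈ S1, (π (s1.arr 4 1) : ℝ) < π z) →
        ∀ t2 ≤ t1 + 10, WP (activeGraph G A) ω
          (.ite (.eq 18 5) (bodyProg ;; .instr (.const 18 1)) .skip) s2 t2
          fun s' t' => ∃ n' < 2 * (A.filter fun v => τ1 < π v).card + s1.var 18,
            ∃ S' Q' τ' X' Y' m, LoopFrame s s' ∧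
            LoopState G π (k + 1) A S₀ ℓ₀ M₀ s' S' Q' τ' X' Y' ∧
            Q'.card + X.card + Y.card + m = Q.card + X'.card + Y'.card ∧
            n' = 2 * (A.filter fun v => τ' < π v).card + s'.var 18 ∧
            (s'.var 18 = 1 ∨ s'.var 18 = 0 ∧ Rest G π (k + 1) A S' Q' (s'.arr 1)) ∧
            t' + c * X.card + 12 * s'.var 18 ≤ t + c * X'.card + E * m + 13 := by
      intro s2 hf2 ha hr hd e18 hpos hg t2 ht2
      have hv : ∀ x, x < 10 → s2.var x = s1.var x := fun x hx => by
        rw [← hf2.var x (by omega)]; simp [show x ≠ 10 by omega]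
      have hs2 : LoopState G π (k + 1) A S₀ ℓ₀ M₀ s2 S1 Q1 τ1 X1 Y1 :=
        ⟨hs.mid.congr (fun x h1 h2 => hv x (by omega)) (fun a _ _ => by rw [ha]) hr,
          by rw [ha]; exact hs.list, by rw [hv 7 (by omega), e7], hs.indep, hs.le⟩
      refine WP.ite (fun hb => WP.seq (hs2.wp_body (N := N) hπ hA hM
        (by rw [hv 8 (by omega)]; exact hpos) (by rw [ha]; exact hg) ?_)) (fun hb => ?_)
      · intro s3 t3 S3 Q3 X3 Y3 hf3 hs3 hc3 ht3
        rw [ha] at hs3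
        have hroot := (hs.mid.root hπ hpos).1
        have hlt := hs.mid.hist.queue _ hroot
        have hfilter : (A.filter fun v => (π (s1.arr 4 1) : ℝ) < π v).card <
            (A.filter fun v => τ1 < π v).card := by
          refine Finset.card_lt_card (Finset.ssubset_iff_of_subset (fun v hv => ?_) |>.2
            ⟨s1.arr 4 1, ?_, ?_⟩)
          · rw [Finset.mem_filter] at hv ⊢
            exact ⟨hv.1, hlt.trans hv.2⟩
          · exact Finset.mem_filter.2 ⟨hs.mid.core.qsub _ hroot, hlt⟩
          · simp
        refine WP.instr ⟨_, ?_, S3, Q3, _, X3, Y3, m + 1, hf.trans (LoopFrame.trans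
          ⟨fun x hx => hv x (by omega), by rw [ha], hr, hd⟩ (hf3.trans
          (TempFrame.setVar s3 (by omega : 11 ≤ 18) (by omega) 1).loop)),
          ⟨hs3.mid.congr (fun x h1 h2 => by simp [show x ≠ 18 by omega]) (fun a _ _ => rfl) rfl,
          hs3.list, by simpa using hs3.len, hs3.indep, hs3.le⟩, ?_, rfl, ?_, ?_⟩
        · simp only [Instr.step, MState.var_setVar, if_true]; omega
        · omega
        · simp
        · rw [← hc] at ht3
          simp [mul_add]
          omega
      · have hb : ¬ s2.var 18 = s2.var 5 := hb
        rw [e18, hv 5 (by omega), e5] at hb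
        omega
    refine WP.seq (WP.ite (fun hb1 => WP.ite (fun hb2 => WP.skip ?_) (fun hb2 => WP.block ?_))
      (fun hb1 => WP.instr ?_))
    · have hb1 : s1.var 4 < s1.var 8 := hb1
      have hb2 : s1.var 7 < s1.var 6 := hb2
      exact cont s1 ⟨fun x hx => by simp +contextual, rfl, rfl, rfl⟩ rfl rfl rfl hb
        (by omega) (.inl (by omega)) _ (by omega)
    · have hb1 : s1.var 4 < s1.var 8 := hb1
      have hb2 : ¬ s1.var 7 < s1.var 6 := hb2
      have hlen := hs.le
      have hlen' : S1.length = k + 1 := by omega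
      obtain ⟨P, z, hPz⟩ := S1.eq_nil_or_concat.resolve_left (by rintro rfl; simp at hlen')
      rw [List.concat_eq_append] at hPz
      subst hPz
      have hz : s1.arr 0 (s1.var 7 - 1) = z := by
        rw [e7]
        simpa using hs.list P z [] (by simp)
      have hzS : z ∈ P ++ [z] := by simp
      have hroot := hs.mid.root hπ (by omega)
      have hrz : s1.rank 0 z = π z := hs.mid.rank z (hs.mid.core.sub z hzS)
      have hru : s1.rank 0 (s1.arr 4 1) = π (s1.arr 4 1) :=
        hs.mid.rank _ (hs.mid.core.qsub _ hroot.1)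
      by_cases hlt : π (s1.arr 4 1) < π z
      · refine cont _ ?_ ?_ ?_ ?_ ?_ (by omega)
          (.inr ⟨z, hzS, hlt⟩) _ ?_
        · exact ⟨fun x hx => by simp; grind, by simp, rfl, rfl⟩
        · simp
        · rfl
        · rfl
        · simp [hz, hrz, hru, hlt]
        · simp only [List.length_cons, List.length_nil]; omega
      · refine halt _ ?_ ?_ ?_ ?_ ?_
          (.inr ⟨hlen', ?_⟩) _ ?_
        · exact ⟨fun x hx => by simp; grind, by simp, rfl, rfl⟩
        · simp
        · rfl
        · rfl
        · simp [hz, hrz, hru]; exact le_of_not_gt hlt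
        · intro q hq x hx
          have h1 : (π x : ℝ) ≤ π z := by
            rcases List.mem_append.1 hx with hx | hx
            · exact ((List.pairwise_append.1 hs.mid.core.sorted).2.2 x hx z (by simp)).le
            · rw [List.mem_singleton.1 hx]
          have h2 : (π z : ℝ) < π (s1.arr 4 1) := by
            refine lt_of_le_of_ne (le_of_not_gt hlt) fun e => ?_
            have := hπ (Subtype.ext e)
            exact hs.mid.core.disj _ hroot.1 (this ▸ hzS)
          have h3 : (π (s1.arr 4 1) : ℝ) ≤ π q := by
            by_cases hqe : q = s1.arr 4 1
            · rw [hqe]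
            · exact (hroot.2 q (Finset.mem_erase.2 ⟨hqe, hq⟩)).le
          linarith
        · simp only [List.length_cons, List.length_nil]; omega
    · have hb1 : ¬ s1.var 4 < s1.var 8 := hb1
      refine halt _ ?_ ?_ ?_ ?_ ?_
        (.inl (Finset.card_eq_zero.1 (by omega))) _ ?_
      · exact ⟨fun x hx => by simp; grind, rfl, rfl, rfl⟩
      · rfl
      · rfl
      · rfl
      · simp
      · omega
  · rintro n s1 t1 ⟨S1, Q1, τ1, X1, Y1, m, hf, hs, hcard, rfl, hor, ht⟩ hb
    have hb : ¬ s1.var 18 = s1.var 5 := hb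
    rw [hs.mid.one] at hb
    obtain ⟨e18, hrest⟩ := hor.resolve_left hb
    exact hΦ s1 _ S1 Q1 τ1 X1 Y1 m hf hs hrest hcard (by omega)

end MainLoop

/-- Insert the vertex in variable `2`: draw its rank if it is new, and put it into the heap. -/
def insertProg : Prog :=
  .instr (.load 10 6 2) ;; .ite (.eq 10 4) (Prog.block [.store 6 2 5, .draw 0 2]) .skip ;;
  Prog.block [.store 2 2 2, .store 3 2 2, .store 1 2 4, .copy 30 2] ;; pushProg

/-- Remove the vertex in variable `2` from the list. -/
def unlistProg : Prog :=
  Prog.block [.const 16 0, .const 17 0] ;;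
  .while (.lt 17 7) (
    Prog.block [.load 13 0 17, .inc 17] ;;
    .ite (.eq 13 2) .skip (Prog.block [.store 7 16 13, .inc 16])) ;;
  .instr (.const 7 0) ;; copyBackProg

/-- Delete the vertex in variable `2`. -/
def deleteProg : Prog :=
  .instr (.load 10 1 2) ;;
  .ite (.lt 4 10)
    (Prog.block [.load 23 2 2, .load 24 3 2, .store 2 24 23, .store 3 23 24, .store 1 2 4])
    (.instr (.copy 20 2) ;; dumpProg ;; .instr (.load 10 5 2) ;;
      .ite (.lt 4 10) (.instr (.copy 30 2) ;; raiseProg ;; removeRootProg) unlistProg)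

/-- The dynamic algorithm for the top-`k` LFMIS with leaders. -/
def mainProg : Prog :=
  Prog.block [.const 4 0, .const 5 1, .copy 6 0, .inc 6] ;;
  .ite (.eq 1 5) insertProg deleteProg ;; loopProg ;;
  .ite (.lt 0 7) (.instr (.copy 3 0)) (.instr (.copy 3 7))

/-- The state of the machine between updates: `D` is the set of all vertices inserted so far. -/
structure AtRest (G : SimpleGraph ℕ) (π : ℕ → I) (k : ℕ) (s : MState) (A D : Finset ℕ)
    (S : List ℕ) (Q : Finset ℕ) : Prop where
  param : s.var 0 = k
  sub : A ⊆ D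
  rank : ∀ v ∈ D, s.rank 0 v = π v
  seen : ∀ v, s.arr 6 v = if v ∈ D then 1 else 0
  drawn : s.drawn = D.card
  heap : IsHeap s Q
  clusters : Clusters (s.arr 2) (s.arr 3) (s.arr 1) A
  rest : Rest G π (k + 1) A S Q (s.arr 1)
  list : ListAt (s.arr 0) S
  len : s.var 7 = S.length

section Preludes

variable {G H : SimpleGraph ℕ} {ω π : ℕ → I} {k N : ℕ} {A D : Finset ℕ}
  {S : List ℕ} {Q : Finset ℕ} {s s₀ : MState} {t v : ℕ} {Φ : MState → ℕ → Prop}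

theorem AtRest.congr (h : AtRest G π k s₀ A D S Q)
    (hv : ∀ x, x = 0 ∨ x = 7 ∨ x = 8 → s.var x = s₀.var x) (ha : s.arr = s₀.arr)
    (hr : s.rank = s₀.rank) (hd : s.drawn = s₀.drawn) : AtRest G π k s A D S Q := by
  obtain ⟨h1, h2, h3, h4, h5, h6, h7, h8, h9, h10⟩ := h
  refine ⟨by rw [hv 0 (by omega), h1], h2, by rwa [hr], by rwa [ha], by rw [hd, h5],
    h6.congr (by rw [ha]) (by rw [ha]) (by rw [ha]) (hv 8 (by omega)) (by rw [hr]), by rwa [ha],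
    by rwa [ha], by rwa [ha], by rw [hv 7 (by omega), h10]⟩

theorem AtRest.wp_insert (h : AtRest G π k s A D S Q) (h2 : s.var 2 = v) (h4 : s.var 4 = 0)
    (h5 : s.var 5 = 1) (h6 : s.var 6 = k + 1) (hv : v ∉ A) (hA : (insert v A).card < 2 ^ N)
    (hω : v ∉ D → ω s.drawn = π v)
    (hΦ : ∀ s' t', LoopState G π (k + 1) (insert v A) S (s.arr 1) (· ∈ greedyMIS G π A) s' S
      (insert v Q) (-1) ∅ ∅ → s'.var 0 = k → (∀ w ∈ insert v D, s'.rank 0 w = π w) →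
      (∀ w, s'.arr 6 w = if w ∈ insert v D then 1 else 0) → s'.drawn = (insert v D).card →
      t' ≤ t + 13 * N + 20 → Φ s' t') :
    WP H ω insertProg s t Φ := by
  have hc := h.rest.core
  have hvℓ : s.arr 1 v = 0 := by
    by_contra hne
    exact hv (hc.lead v (s.arr 1 v - 1) (by omega)).1
  have hvQ : v ∉ Q := fun hq => hv (hc.qsub v hq)
  have hcore := hc.insert hv
  have hcard := Finset.card_le_card (fun w hw => hcore.qsub w hw : insert v Q ⊆ insert v A)
  rw [Finset.card_insert_of_notMem hvQ] at hcard
  have hsize := h.heap.size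
  have key : ∀ s1 t1, (∀ x, x ≠ 10 → s1.var x = s.var x) → (∀ a, a ≠ 6 → s1.arr a = s.arr a) →
      (∀ w ∈ insert v D, s1.rank 0 w = π w) →
      (∀ w, s1.arr 6 w = if w ∈ insert v D then 1 else 0) → s1.drawn = (insert v D).card →
      t1 ≤ t + 4 → WP H ω (Prog.block [.store 2 2 2, .store 3 2 2, .store 1 2 4, .copy 30 2] ;;
        pushProg) s1 t1 Φ := by
    intro s1 t1 hv1 ha1 hr1 hs1 hd1 ht1
    have e2 : s1.var 2 = v := by rw [hv1 2 (by omega), h2]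
    have e4 : s1.var 4 = 0 := by rw [hv1 4 (by omega), h4]
    have hheap : IsHeap s1 Q := by
      obtain ⟨g1, g2, g3⟩ := h.heap
      refine ⟨?_, ?_, ?_⟩
      · rw [ha1 4 (by omega), ha1 5 (by omega), hv1 8 (by omega)]; exact g1
      · rw [ha1 8 (by omega), hv1 8 (by omega)]; exact g2
      · rw [ha1 4 (by omega), hv1 8 (by omega)]
        intro j hj hj'
        have hq : ∀ i, 1 ≤ i → i ≤ s.var 8 → s1.rank 0 (s.arr 4 i) = s.rank 0 (s.arr 4 i) := by
          intro i hi hi'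
          have := h.sub (hc.qsub _ (g1.mem i hi hi'))
          rw [h.rank _ this, hr1 _ (Finset.mem_insert_of_mem this)]
        rw [hq (j / 2) (by omega) (by omega), hq j (by omega) hj']
        exact g3 j hj hj'
    refine WP.seq (WP.block (wp_push (N := N) (Q := Q) (by simp [e4])
      (by simp [hv1 5, h5]) (hheap.congr (by simp) (by simp) (by simp) (by simp) (by simp))
      (by simpa [e2] using hvQ) (by simp [hv1 8]; omega) ?_))
    intro s2 t2 hf2 hheap2 ht2
    simp [e2] at hheap2
    have hv2 : ∀ x, x < 30 → x ≠ 8 → x ≠ 10 → s2.var x = s.var x := fun x g1 g2 g3 => by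
      rw [hf2.var x g1 g2]; simp [show x ≠ 30 by omega, hv1 x g3]
    have ha2 : ∀ a, a = 0 ∨ a = 6 → s2.arr a = s1.arr a := fun a g => by
      rw [hf2.arr a (by omega) (by omega) (by omega)]
      simp [show a ≠ 1 by omega, show a ≠ 2 by omega, show a ≠ 3 by omega]
    have hr2 : s2.rank = s1.rank := by rw [hf2.rank]; rfl
    have e1 : s2.arr 1 = s.arr 1 := by
      rw [hf2.arr 1 (by omega) (by omega) (by omega)]
      simp [e2, e4, ha1 1, ← hvℓ]
    have e2 : s2.arr 2 = Function.update (s.arr 2) v v := by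
      rw [hf2.arr 2 (by omega) (by omega) (by omega)]
      simp [e2, ha1 2]
    have e3 : s2.arr 3 = Function.update (s.arr 3) v v := by
      rw [hf2.arr 3 (by omega) (by omega) (by omega)]
      simp [h2, hv1 2, ha1 3]
    refine hΦ s2 t2 ⟨⟨?_, ?_, ?_, ?_, hheap2, ?_, ?_, ?_⟩, ?_, ?_, h.rest.indep, h.rest.length_le⟩
      ?_ ?_ ?_ ?_ ?_
    · rw [hv2 4 (by omega) (by omega) (by omega), h4]
    · rw [hv2 5 (by omega) (by omega) (by omega), h5]
    · rw [hv2 6 (by omega) (by omega) (by omega), h6]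
    · rw [hr2]; exact fun w hw => hr1 w (Finset.insert_subset_insert _ h.sub hw)
    · rw [e1, e2, e3]
      refine h.clusters.singleton (fun w hw => hv ?_) hvℓ
      exact (hc.lead w v hw).2.1.elim (hc.sub v) (hc.qsub v)
    · rw [e1]; exact hcore
    · rw [e1]
      exact Hist.start (by norm_num) (fun x hx => hx) (fun y hy _ => hy)
        (fun w u hw => ⟨hw, by simp⟩) (by simp)
    · rw [ha2 0 (by omega), ha1 0 (by omega)]; exact h.list
    · rw [hv2 7 (by omega) (by omega) (by omega), h.len]
    · rw [hv2 0 (by omega) (by omega) (by omega), h.param]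
    · rw [hr2]; exact hr1
    · rw [ha2 6 (by omega)]; exact hs1
    · rw [hf2.drawn]; exact hd1
    · simp only [List.length_cons, List.length_nil] at ht2; omega
  refine WP.seq (WP.instr (WP.seq (WP.ite (fun hb => WP.block ?_) (fun hb => WP.skip ?_))))
  · have hvD : v ∉ D := by
      intro hvD
      simp [h2, h4, h.seen, hvD] at hb
    refine key _ _ (fun x hx => ?_) (fun a ha => ?_) ?_ ?_ ?_ ?_
    · simp [MState.setRank, hx]
    · simp [MState.setRank, ha]
    · intro w hw
      by_cases hwv : w = v
      · simp [MState.setRank, hwv, h2, hω hvD]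
      · simp [MState.setRank, hwv, h2, h.rank w (Finset.mem_of_mem_insert_of_ne hw hwv)]
    · intro w
      simp only [List.foldl, Instr.step, MState.setRank, MState.arr_setArr, MState.var_setArr,
        if_true, MState.var_setVar, MState.arr_setVar]
      by_cases hwv : w = v <;> simp [hwv, h2, h5, h.seen]
    · rw [Finset.card_insert_of_notMem hvD, ← h.drawn]; rfl
    · simp only [List.length_cons, List.length_nil]; omega
  · have hvD : v ∈ D := by
      by_contra hvD
      simp [h2, h4, h.seen, hvD] at hb
    rw [Finset.insert_eq_of_mem hvD] at key
    refine key _ _ (fun x hx => ?_) (fun a ha => ?_) ?_ ?_ ?_ (by omega)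
    · simp [hx]
    · simp
    · exact h.rank
    · exact h.seen
    · exact h.drawn

theorem wp_unlist (hl : ListAt (s.arr 0) S) (h7 : s.var 7 = S.length) (h2 : s.var 2 = v)
    (hΦ : ∀ s' t', (∀ x, x ≠ 7 → x ≠ 13 → x ≠ 16 → x ≠ 17 → s'.var x = s.var x) →
      (∀ a, a ≠ 0 → a ≠ 7 → s'.arr a = s.arr a) → s'.rank = s.rank → s'.drawn = s.drawn →
      ListAt (s'.arr 0) (S.filter (· ≠ v)) → s'.var 7 = (S.filter (· ≠ v)).length →
      t' ≤ t + 11 * S.length + 6 → Φ s' t') :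
    WP H ω unlistProg s t Φ := by
  refine WP.seq (WP.block (WP.seq (WP.while (n := S.length) (fun n s' t' => ∃ L R, S = L ++ R ∧
    n = R.length ∧ (∀ x, x ≠ 13 → x ≠ 16 → x ≠ 17 → s'.var x = s.var x) ∧
    (∀ a, a ≠ 7 → s'.arr a = s.arr a) ∧ s'.rank = s.rank ∧ s'.drawn = s.drawn ∧
    ListAt (s'.arr 7) (L.filter (· ≠ v)) ∧ s'.var 16 = (L.filter (· ≠ v)).length ∧
    s'.var 17 = L.length ∧ t' ≤ t + 2 + 6 * L.length) ?_ ?_ ?_)))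
  · refine ⟨[], S, rfl, rfl, fun x h1 h2 h3 => ?_, fun a ha => ?_, rfl, rfl, ?_, ?_, ?_, ?_⟩
    · simp [h2, h3]
    · simp
    · intro P x L e; simp at e
    · simp
    · simp
    · simp
  · rintro n s1 t1 ⟨L, R, rfl, rfl, hv, ha, hr, hd, hl7, e16, e17, ht⟩ hb
    have hb : s1.var 17 < s1.var 7 := hb
    rw [e17, hv 7 (by omega) (by omega) (by omega), h7] at hb
    rcases R with - | ⟨x, R⟩
    · simp at hb
    have hx : s1.arr 0 (s1.var 17) = x := by rw [ha 0 (by omega), e17]; exact hl L x R rfl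
    have e2 : s1.var 2 = v := by rw [hv 2 (by omega) (by omega) (by omega), h2]
    refine WP.seq (WP.block (WP.ite (fun hb1 => WP.skip ?_) (fun hb1 => WP.block ?_)))
    · have hxv : x = v := by simpa [hx, e2] using hb1
      refine ⟨R.length, by simp, L ++ [x], R, by simp, rfl, fun y g1 g2 g3 => ?_, fun a g => ?_, hr,
        hd, ?_, ?_, ?_, ?_⟩
      · simp [g1, g3, hv y g1 g2 g3]
      · simp [ha a g]
      · simpa [hxv] using hl7
      · simpa [hxv] using e16
      · simp [e17]
      · simp only [List.length_append, List.length_cons, List.length_nil]; omega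
    · have hxv : x ≠ v := by simpa [hx, e2] using hb1
      refine ⟨R.length, by simp, L ++ [x], R, by simp, rfl, fun y g1 g2 g3 => ?_, fun a g => ?_, hr,
        hd, ?_, ?_, ?_, ?_⟩
      · simp [g1, g2, g3, hv y g1 g2 g3]
      · simp [g, ha a g]
      · have := hl7.snoc x
        simpa [hxv, hx, e16, List.filter_append] using this
      · simp [hxv, e16, List.filter_append]
      · simp [e17]
      · simp only [List.length_append, List.length_cons, List.length_nil]; omega
  · rintro n s1 t1 ⟨L, R, rfl, rfl, hv, ha, hr, hd, hl7, e16, e17, ht⟩ hb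
    have hb : ¬ s1.var 17 < s1.var 7 := hb
    rw [e17, hv 7 (by omega) (by omega) (by omega), h7, List.length_append] at hb
    have hR : R = [] := List.length_eq_zero_iff.1 (by omega)
    subst hR
    rw [List.append_nil] at hΦ
    have hfl := List.length_filter_le (fun x => decide (x ≠ v)) L
    refine WP.seq (WP.instr (wp_copyBack (P := []) (T := L.filter (· ≠ v)) ?_ ?_ ?_ ?_ ?_))
    · intro P x L e; simp at e
    · simp
    · simpa using hl7
    · simp [e16]
    · intro s2 t2 hv2 ha2 hr2 hd2 hl2 e72 ht2
      refine hΦ s2 t2 (fun x g1 g2 g3 g4 => ?_) (fun a g1 g2 => ?_) ?_ ?_ ?_ ?_ ?_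
      · rw [hv2 x g1 g2 g4]; simp [g1, hv x g2 g3 g4]
      · rw [ha2 a g1]; simp [ha a g2]
      · rw [hr2]; exact hr
      · rw [hd2]; exact hd
      · simpa using hl2
      · simpa using e72
      · omega

end Preludes

section Delete

variable {G H : SimpleGraph ℕ} {ω π : ℕ → I} {k N : ℕ} {A D : Finset ℕ}
  {S : List ℕ} {Q : Finset ℕ} {s s₀ : MState} {t v : ℕ} {Φ : MState → ℕ → Prop}

theorem Core.nodup {ℓ : ℕ → ℕ} (h : Core G π A S Q ℓ) : S.Nodup :=
  h.sorted.imp fun hab e => hab.ne (by rw [e])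

theorem AtRest.wp_delete (h : AtRest G π k s A D S Q) (h2 : s.var 2 = v) (h4 : s.var 4 = 0)
    (h5 : s.var 5 = 1) (h6 : s.var 6 = k + 1) (hv : v ∈ A) (hA : A.card < 2 ^ N)
    (hΦ : ∀ s' t' S' Q' X', LoopFrame s s' →
      LoopState G π (k + 1) (A.erase v) S (s.arr 1) (· ∈ greedyMIS G π A) s' S' Q' (-1) X' ∅ →
      Q'.card ≤ Q.card + X'.card →
      t' ≤ t + (13 * N + 19) * X'.card + 11 * k + 33 * N + 90 → Φ s' t') :
    WP H ω deleteProg s t Φ := by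
  have hc := h.rest.core
  have hsize := h.heap.size
  have hrank : ∀ w ∈ A.erase v, s.rank 0 w = π w := fun w hw =>
    h.rank w (h.sub (Finset.mem_of_mem_erase hw))
  refine WP.seq (WP.instr (WP.ite (fun hb => WP.block ?_) (fun hb => ?_)))
  · have hvℓ : s.arr 1 v ≠ 0 := by
      simp [h2, h4] at hb; omega
    obtain ⟨u, hu⟩ : ∃ u, s.arr 1 v = u + 1 := ⟨s.arr 1 v - 1, by omega⟩
    have hcore := hc.delFollower hvℓ
    have huA : u ∈ A := (hc.lead v u hu).2.1.elim (hc.sub u) (hc.qsub u)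
    have a1 : ∀ s', s' = (List.foldl (Instr.step H ω) (Instr.step H ω s (Instr.load 10 1 2))
        [Instr.load 23 2 2, Instr.load 24 3 2, Instr.store 2 24 23, Instr.store 3 23 24,
          Instr.store 1 2 4]) → s'.arr 1 = Function.update (s.arr 1) v 0 := by
      rintro s' rfl; simp [h2, h4]
    refine hΦ _ _ S Q ∅ ⟨fun x hx => ?_, ?_, rfl, rfl⟩ ⟨⟨?_, ?_, ?_, hrank,
      h.heap.congr ?_ ?_ ?_ ?_ rfl, ?_, ?_, ?_⟩, ?_, ?_, h.rest.indep, h.rest.length_le⟩ le_self_add ?_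
    · simp [show x ≠ 10 by omega, show x ≠ 23 by omega, show x ≠ 24 by omega]
    · simp
    · simp [h4]
    · simp [h5]
    · simp [h6]
    · simp
    · simp
    · simp
    · simp
    · have := h.clusters.unlink hc.flat hu huA
      simpa [h2, h4] using this
    · rw [a1 _ rfl]; exact hcore
    · rw [a1 _ rfl]
      refine Hist.start (by norm_num) (fun x hx => hx) (fun y hy _ => hy) (fun w u hw => ?_) (by simp)
      by_cases hwv : w = v
      · simp [hwv] at hw
      · simpa [hwv] using hw
    · simpa using h.list
    · simp [h.len]
    · simp only [List.length_cons, List.length_nil]; omega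
  · have hvℓ : s.arr 1 v = 0 := by
      simp [h2, h4] at hb; omega
    obtain ⟨Fs, hFs, hFA, hdisj⟩ := exists_followers hc v
    have hsub : Q ∪ Fs ⊆ A := Finset.union_subset (fun q hq => hc.qsub q hq) hFA
    have hcard := Finset.card_le_card hsub
    rw [Finset.card_union_of_disjoint hdisj] at hcard
    have hvFs : v ∉ Fs := by rw [hFs, hvℓ]; omega
    refine WP.seq (WP.instr (WP.seq (wp_dump (N := N) (A := A) (Fs := Fs) (Q := Q) (by simp [h4])
      (by simp [h5]) (h.heap.congr (by simp) (by simp) (by simp) (by simp) (by simp))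
      (by simpa using h.clusters) (by simpa [h2] using hv) (by simpa [h2] using hvℓ)
      (by simpa [h2] using hFs) (fun w hw => Finset.disjoint_right.1 hdisj hw) (by omega) ?_)))
    intro s1 t1 hf1 a1 a2 a3 hheap1 ht1
    simp only [Instr.step, MState.arr_setVar, MState.var_setVar, if_true, h2,
      show (2 : ℕ) ≠ 10 by omega, if_false] at a1 a2 a3
    have hv1 : ∀ x, x < 20 → x ≠ 8 → x ≠ 10 → s1.var x = s.var x := fun x g1 g2 g3 => by
      rw [hf1.var x g1 g2]; simp [show x ≠ 20 by omega, g3]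
    have ha1 : ∀ a, a = 0 ∨ a = 6 → s1.arr a = s.arr a := fun a g => by
      rw [hf1.arr a (by omega) (by omega) (by omega) (by omega) (by omega) (by omega)]; simp
    have hr1 : s1.rank = s.rank := by rw [hf1.rank]; rfl
    have hd1 : s1.drawn = s.drawn := by rw [hf1.drawn]; rfl
    have hcl1 : Clusters (s1.arr 2) (s1.arr 3) (s1.arr 1) (A.erase v) := by
      rw [a1, a2, a3]
      exact (h.clusters.dump hc.flat hvℓ).mono (Finset.erase_subset _ _)
    have hℓ : ∀ w u, dumpLeader (s.arr 1) v w = u + 1 → s.arr 1 w = u + 1 ∧ w ∉ Fs := by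
      intro w u hw
      rw [dumpLeader] at hw
      split_ifs at hw with hwv
      exact ⟨hw, by rwa [hFs]⟩
    have hX : ∀ w ∈ Fs, ∃ x, s.arr 1 w = x + 1 ∧ x ∉ A.erase v := fun w hw =>
      ⟨v, (hFs w).1 hw, Finset.notMem_erase v A⟩
    have e2 : s1.var 2 = v := by rw [hv1 2 (by omega) (by omega) (by omega), h2]
    have hsize1 := hheap1.size
    rw [Finset.card_union_of_disjoint hdisj] at hsize1
    rw [mul_comm Fs.card] at ht1
    have hvU : v ∈ Q ∪ Fs ↔ v ∈ Q := by simp [hvFs]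
    refine WP.seq (WP.instr (WP.ite (fun hb => WP.seq (WP.instr (WP.seq (wp_raise (N := N)
      (Q := Q ∪ Fs) ?_ (hheap1.congr (by simp) (by simp) (by simp) (by simp) (by simp)) ?_ ?_ ?_))))
      (fun hb => wp_unlist (S := S) (v := v) ?_ ?_ ?_ ?_)))
    · simp [hv1, h4]
    · have : v ∈ Q ∪ Fs := by
        by_contra hc'
        simp [e2, hheap1.map.pos_zero v hc'] at hb
      simpa [e2] using this
    · simp; omega
    · have hvQ : v ∈ Q := by
        rw [← hvU]
        by_contra hc'
        simp [e2, hheap1.map.pos_zero v hc'] at hb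
      intro s2 t2 hf2 e28 hheap2 eroot ht2
      have hv2 : ∀ x, x < 20 → x ≠ 8 → x ≠ 10 → s2.var x = s.var x := fun x g1 g2 g3 => by
        rw [hf2.var x (by omega) g2]
        simp [g3, show x ≠ 30 by omega, hv1 x g1 g2 g3]
      have ha2 : ∀ a, a ≠ 4 → a ≠ 5 → a ≠ 8 → s2.arr a = s1.arr a := fun a g1 g2 g3 => by
        rw [hf2.arr a g1 g2 g3]; simp
      have e28 : s2.var 8 = s1.var 8 := by rw [e28]; simp
      have hpos : 0 < Q.card := Finset.card_pos.2 ⟨v, hvQ⟩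
      have eroot : s2.arr 4 1 = v := by rw [eroot]; simp [e2]
      refine wp_removeRoot (N := N) (Q := Q ∪ Fs)
        (by rw [hv2 4 (by omega) (by omega) (by omega), h4])
        (by rw [hv2 5 (by omega) (by omega) (by omega), h5]) hheap2 (by omega) (by omega) ?_
      intro s3 t3 hf3 hheap3 ht3
      rw [eroot] at hheap3
      have hv3 : ∀ x, x < 20 → x ≠ 8 → x ≠ 10 → s3.var x = s.var x := fun x g1 g2 g3 => by
        rw [hf3.var x (by omega) g2, hv2 x g1 g2 g3]
      have ha3 : ∀ a, a ≠ 4 → a ≠ 5 → a ≠ 8 → s3.arr a = s1.arr a := fun a g1 g2 g3 => by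
        rw [hf3.arr a g1 g2 g3, ha2 a g1 g2 g3]
      have hr3 : s3.rank = s.rank := by rw [hf3.rank, hf2.rank]; exact hr1
      have hd3 : s3.drawn = s.drawn := by rw [hf3.drawn, hf2.drawn]; exact hd1
      have e31 : s3.arr 1 = dumpLeader (s.arr 1) v := by
        rw [ha3 1 (by omega) (by omega) (by omega), a1]
      refine hΦ s3 t3 S ((Q ∪ Fs).erase v) Fs ⟨fun x hx => hv3 x (by omega) (by omega) (by omega), ?_,
        hr3, hd3⟩ ⟨⟨?_, ?_, ?_, ?_, hheap3, ?_, ?_, ?_⟩, ?_, ?_, h.rest.indep, h.rest.length_le⟩ ?_ ?_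
      · rw [ha3 6 (by omega) (by omega) (by omega), ha1 6 (by omega)]
      · rw [hv3 4 (by omega) (by omega) (by omega), h4]
      · rw [hv3 5 (by omega) (by omega) (by omega), h5]
      · rw [hv3 6 (by omega) (by omega) (by omega), h6]
      · rw [hr3]; exact hrank
      · rw [ha3 1 (by omega) (by omega) (by omega), ha3 2 (by omega) (by omega) (by omega),
          ha3 3 (by omega) (by omega) (by omega)]
        exact hcl1
      · rw [e31]; exact hc.delQueued hvQ hFs
      · rw [e31]
        exact Hist.start (by norm_num) (fun x hx => hx) (fun y hy _ => hy) hℓ hX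
      · rw [ha3 0 (by omega) (by omega) (by omega), ha1 0 (by omega)]; exact h.list
      · rw [hv3 7 (by omega) (by omega) (by omega), h.len]
      · have := Finset.card_erase_le (s := Q ∪ Fs) (a := v)
        rw [Finset.card_union_of_disjoint hdisj] at this
        omega
      · omega
    · have := ha1 0 (by omega)
      simpa [this] using h.list
    · simp [hv1, h.len]
    · simp [e2]
    · have hvQ : v ∉ Q := by
        rw [← hvU]
        intro hc'
        have := hheap1.map.one_le v hc'
        simp [e2, hv1, h4] at hb
        omega
      have hvS : v ∈ S := by
        rcases hc.cover v hv with g | g | g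
        · exact g
        · exact absurd g hvQ
        · exact absurd hvℓ g
      obtain ⟨L₁, L₂, rfl⟩ := List.append_of_mem hvS
      have hfil : (L₁ ++ v :: L₂).filter (· ≠ v) = L₁ ++ L₂ := by
        have := hc.nodup.erase_eq_filter v
        have h1 : v ∉ L₁ := fun hm => by
          have := hc.nodup
          rw [List.nodup_append] at this
          exact this.2.2 v hm v (by simp) rfl
        rw [List.erase_append_right _ h1, List.erase_cons_head] at this
        rw [this]
        congr 1
        ext x
        by_cases hx : x = v <;> simp [hx]
      rw [hfil]
      intro s2 t2 hv2' ha2' hr2' hd2' hl2 e27 ht2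
      have hv2 : ∀ x, x ≠ 7 → x < 10 → x ≠ 8 → s2.var x = s.var x := fun x g1 g2 g3 => by
        rw [hv2' x g1 (by omega) (by omega) (by omega)]
        simp [show x ≠ 10 by omega, hv1 x (by omega) g3 (by omega)]
      have ha2 : ∀ a, a ≠ 0 → a ≠ 7 → s2.arr a = s1.arr a := fun a g1 g2 => by
        rw [ha2' a g1 g2]; simp
      have hr2 : s2.rank = s.rank := by rw [hr2']; exact hr1
      have hlen := h.rest.length_le
      have e21 : s2.arr 1 = dumpLeader (s.arr 1) v := by
        rw [ha2 1 (by omega) (by omega), a1]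
      have hsubset : ∀ x ∈ L₁ ++ L₂, x ∈ L₁ ++ v :: L₂ := fun x hx => by
        simp only [List.mem_append, List.mem_cons] at hx ⊢; tauto
      refine hΦ s2 t2 (L₁ ++ L₂) (Q ∪ Fs) Fs ⟨fun x hx => hv2 x (by omega) (by omega) (by omega), ?_,
        hr2, ?_⟩ ⟨⟨?_, ?_, ?_, ?_, hheap1.congr ?_ ?_ ?_ ?_ ?_, ?_, ?_, ?_⟩, hl2, e27, ?_, ?_⟩ ?_ ?_
      · rw [ha2 6 (by omega) (by omega), ha1 6 (by omega)]
      · rw [hd2']; exact hd1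
      · rw [hv2 4 (by omega) (by omega) (by omega), h4]
      · rw [hv2 5 (by omega) (by omega) (by omega), h5]
      · rw [hv2 6 (by omega) (by omega) (by omega), h6]
      · rw [hr2]; exact hrank
      · exact ha2 4 (by omega) (by omega)
      · exact ha2 5 (by omega) (by omega)
      · exact ha2 8 (by omega) (by omega)
      · rw [hv2' 8 (by omega) (by omega) (by omega) (by omega)]; simp
      · rw [hr2, hr1]
      · rw [ha2 1 (by omega) (by omega), ha2 2 (by omega) (by omega), ha2 3 (by omega) (by omega)]
        exact hcl1
      · rw [e21]; exact hc.delListed hFs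
      · rw [e21]
        refine Hist.start (by norm_num) hsubset (fun y hy hyA => ?_) hℓ hX
        have := Finset.ne_of_mem_erase hyA
        simp only [List.mem_append, List.mem_cons] at hy ⊢
        tauto
      · exact fun a ha b hb => h.rest.indep a (hsubset a ha) b (hsubset b hb)
      · simp only [List.length_append, List.length_cons] at hlen ⊢; omega
      · rw [Finset.card_union_of_disjoint hdisj]
      · omega

end Delete

/-- The set of all vertices inserted so far, after one more update. -/
def Update.record (D : Finset ℕ) : Update → Finset ℕ
  | .ins v => insert v D
  | .del _ => D

section Step

variable {G : SimpleGraph ℕ} {ω π : ℕ → I} {k N : ℕ} {A A' D D' : Finset ℕ}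
  {S S' : List ℕ} {Q Q' X : Finset ℕ} {s s₀ s' : MState} {t t' v : ℕ}

theorem AtRest.wp_finish (h : AtRest G π k s A D S Q) (hπ : π.Injective) (hA : A'.card < 2 ^ N)
    (hl : LoopState G π (k + 1) A' S (s.arr 1) (· ∈ greedyMIS G π A) s' S' Q' (-1) X ∅)
    (h0 : s'.var 0 = k) (hsub : A' ⊆ D') (hr : ∀ w ∈ D', s'.rank 0 w = π w)
    (hseen : ∀ w, s'.arr 6 w = if w ∈ D' then 1 else 0) (hd : s'.drawn = D'.card)
    (hQ : Q'.card ≤ Q.card + X.card + 1)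
    (ht : t' ≤ t + (13 * N + 19) * X.card + 11 * k + 33 * N + 100) :
    WP (activeGraph G A') ω (loopProg ;; .ite (.lt 0 7) (.instr (.copy 3 0)) (.instr (.copy 3 7)))
      s' t' fun s₂ t₂ => ∃ S₂ Q₂, AtRest G π k s₂ A' D' S₂ Q₂ ∧ s₂.var 3 = min k S₂.length ∧
        t₂ + (40 * k + 37 * N + 140) * (Q₂.card + 2 * (wrong G π A' (s₂.arr 1)).card) ≤
          t + (40 * k + 37 * N + 140) * (Q.card + 2 * (wrong G π A (s.arr 1)).card +
            (5 * (elimDiff G π A A').card + 4)) := by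
  have hc := h.rest.core
  refine WP.seq (hl.wp_loop (N := N) hπ hA (fun y hy x hx => h.rest.mem_of_lt hπ hy hx) ?_)
  intro s₁ t₁ S₁ Q₁ τ X₁ Y₁ m hf hs hrest hcard ht₁
  have hX := hs.mid.hist.card_dumped_add_wrong_le hπ hc hrest
  have hY := hs.mid.hist.card_fresh_le hπ hrest
  have time : t₁ + 2 + (40 * k + 37 * N + 140) * (Q₁.card + 2 * (wrong G π A' (s₁.arr 1)).card) ≤
      t + (40 * k + 37 * N + 140) * (Q.card + 2 * (wrong G π A (s.arr 1)).card +
        (5 * (elimDiff G π A A').card + 4)) := by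
    obtain ⟨E, hE⟩ : ∃ E, E = 40 * k + 37 * N + 140 := ⟨_, rfl⟩
    obtain ⟨c, hcc⟩ : ∃ c, c = 13 * N + 19 := ⟨_, rfl⟩
    rw [← hcc] at ht ht₁
    rw [← hE] at ht₁ ⊢
    have h1 : c * X₁.card ≤ E * X₁.card := Nat.mul_le_mul_right _ (by omega)
    have h2 : m + Q₁.card + X₁.card + 2 * (wrong G π A' (s₁.arr 1)).card ≤ Q.card +
        2 * (wrong G π A (s.arr 1)).card + 5 * (elimDiff G π A A').card + 1 := by
      simp only [Finset.card_empty] at hcard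
      omega
    have h4 : c * X₁.card + E * (m + Q₁.card + 2 * (wrong G π A' (s₁.arr 1)).card) ≤
        E * (m + Q₁.card + X₁.card + 2 * (wrong G π A' (s₁.arr 1)).card) := by
      simp only [mul_add] at h1 ⊢
      omega
    have h3 := Nat.mul_le_mul_left E h2
    simp only [mul_add] at h3 ⊢
    omega
  have key : ∀ s₂ : MState, (∀ x, x ≠ 3 → s₂.var x = s₁.var x) → s₂.arr = s₁.arr →
      s₂.rank = s₁.rank → s₂.drawn = s₁.drawn → s₂.var 3 = min k S₁.length →
      ∃ S₂ Q₂, AtRest G π k s₂ A' D' S₂ Q₂ ∧ s₂.var 3 = min k S₂.length ∧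
        t₁ + 1 + 1 + (40 * k + 37 * N + 140) * (Q₂.card + 2 * (wrong G π A' (s₂.arr 1)).card) ≤
          t + (40 * k + 37 * N + 140) * (Q.card + 2 * (wrong G π A (s.arr 1)).card +
            (5 * (elimDiff G π A A').card + 4)) := by
    intro s₂ hv ha hrk hdr h3
    refine ⟨S₁, Q₁, ⟨?_, hsub, ?_, ?_, ?_, ?_, ?_, ?_, ?_, ?_⟩, h3, ?_⟩
    · rw [hv 0 (by omega), hf.var 0 (by omega), h0]
    · rw [hrk, hf.rank]; exact hr
    · rw [ha, hf.arr]; exact hseen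
    · rw [hdr, hf.drawn, hd]
    · exact hs.mid.heap.congr (by rw [ha]) (by rw [ha]) (by rw [ha]) (hv 8 (by omega)) (by rw [hrk])
    · rw [ha]; exact hs.mid.clusters
    · rw [ha]; exact hrest
    · rw [ha]; exact hs.list
    · rw [hv 7 (by omega), hs.len]
    · rw [ha]; exact time
  have e0 : s₁.var 0 = k := by rw [hf.var 0 (by omega), h0]
  have e7 := hs.len
  refine WP.ite (fun hb => WP.instr (key _ (fun x hx => by simp [hx]) rfl rfl rfl ?_))
    (fun hb => WP.instr (key _ (fun x hx => by simp [hx]) rfl rfl rfl ?_))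
  · have hb : s₁.var 0 < s₁.var 7 := hb
    simp [e0]; omega
  · have hb : ¬ s₁.var 0 < s₁.var 7 := hb
    simp [e7]; omega

theorem AtRest.exec_main (h : AtRest G π k s A D S Q) (hπ : π.Injective) {u : Update}
    (hu : u.Admissible A) (hA : A.card < 2 ^ N) (hA' : (u.apply A).card < 2 ^ N)
    (hω : ∀ v, u = .ins v → v ∉ D → ω s.drawn = π v) :
    ∃ s' T S' Q', Exec (activeGraph G (u.apply A)) ω mainProg (s.receive u) s' T ∧
      AtRest G π k s' (u.apply A) (u.record D) S' Q' ∧ s'.var 3 = min k S'.length ∧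
      T + (40 * k + 37 * N + 140) * (Q'.card + 2 * (wrong G π (u.apply A) (s'.arr 1)).card) ≤
        (40 * k + 37 * N + 140) * (Q.card + 2 * (wrong G π A (s.arr 1)).card +
          (5 * (elimDiff G π A (u.apply A)).card + 4)) := by
  have main : WP (activeGraph G (u.apply A)) ω mainProg (s.receive u) 0 fun s₂ t₂ => ∃ S₂ Q₂,
      AtRest G π k s₂ (u.apply A) (u.record D) S₂ Q₂ ∧ s₂.var 3 = min k S₂.length ∧
        t₂ + (40 * k + 37 * N + 140) * (Q₂.card + 2 * (wrong G π (u.apply A) (s₂.arr 1)).card) ≤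
          0 + (40 * k + 37 * N + 140) * (Q.card + 2 * (wrong G π A (s.arr 1)).card +
            (5 * (elimDiff G π A (u.apply A)).card + 4)) := by
    obtain ⟨s₁, hs₁⟩ : ∃ s₁, s₁ = List.foldl (Instr.step (activeGraph G (u.apply A)) ω)
      (s.receive u) [.const 4 0, .const 5 1, .copy 6 0, .inc 6] := ⟨_, rfl⟩
    refine WP.seq (WP.block ?_)
    rw [← hs₁]
    have ha : s₁.arr = s.arr := by cases u <;> simp [hs₁, MState.receive]
    have hr : s₁.rank = s.rank := by cases u <;> simp [hs₁, MState.receive]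
    have hd : s₁.drawn = s.drawn := by cases u <;> simp [hs₁, MState.receive]
    have hr1 : AtRest G π k s₁ A D S Q := by
      refine h.congr (fun x hx => ?_) ha hr hd
      cases u <;> simp [hs₁, MState.receive, show x ≠ 4 by omega, show x ≠ 5 by omega,
        show x ≠ 6 by omega, show x ≠ 1 by omega, show x ≠ 2 by omega]
    have e4 : s₁.var 4 = 0 := by simp [hs₁]
    have e5 : s₁.var 5 = 1 := by simp [hs₁]
    have e6 : s₁.var 6 = k + 1 := by cases u <;> simp [hs₁, MState.receive, h.param]
    rw [← ha]
    rw [← hd] at hω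
    cases u with
    | ins v =>
      have e1 : s₁.var 1 = 1 := by simp [hs₁, MState.receive]
      have e2 : s₁.var 2 = v := by simp [hs₁, MState.receive]
      refine WP.seq (WP.ite (fun _ => hr1.wp_insert (N := N) e2 e4 e5 e6 hu hA' (hω v rfl) ?_)
        (fun hb => absurd (e1.trans e5.symm) hb))
      intro s₂ t₂ hl h0 hr₂ hs₂ hd₂ ht₂
      refine hr1.wp_finish hπ hA' hl h0 (Finset.insert_subset_insert v h.sub) hr₂ hs₂ hd₂
        ((Finset.card_insert_le _ _).trans (by omega)) ?_
      simp only [List.length_cons, List.length_nil] at ht₂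
      omega
    | del v =>
      have e1 : s₁.var 1 = 0 := by simp [hs₁, MState.receive]
      have e2 : s₁.var 2 = v := by simp [hs₁, MState.receive]
      refine WP.seq (WP.ite (fun hb => ?_)
        (fun _ => hr1.wp_delete (N := N) e2 e4 e5 e6 hu hA ?_))
      · have hb : s₁.var 1 = s₁.var 5 := hb
        omega
      intro s₂ t₂ S₂ Q₂ X₂ hf hl hQ ht₂
      refine hr1.wp_finish hπ hA' hl ?_ ((Finset.erase_subset _ _).trans h.sub) ?_ ?_ ?_
        (by omega) ?_
      · rw [hf.var 0 (by omega), hr1.param]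
      · rw [hf.rank]; exact hr1.rank
      · rw [hf.arr]; exact hr1.seen
      · rw [hf.drawn]; exact hr1.drawn
      simp only [List.length_cons, List.length_nil] at ht₂
      omega
  obtain ⟨s', T, hE, S₂, Q₂, h1, h2, h3⟩ := main
  exact ⟨s', T, S₂, Q₂, hE, h1, h2, by omega⟩

end Step

/-- The vertices inserted so far, in the order of their first insertions, after one more update. -/
def Update.push (L : List ℕ) : Update → List ℕ
  | .ins v => if v ∈ L then L else L ++ [v]
  | .del _ => L

/-- The vertices of a stream, in the order of their first insertions. -/
def firstInsertions (l : List Update) : List ℕ := l.foldl Update.push []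

section Streams

variable {G : SimpleGraph ℕ} {ω π : ℕ → I} {k N : ℕ} {l : List Update} {u : Update}

theorem activeAfter_snoc (l : List Update) (u : Update) :
    activeAfter (l ++ [u]) = u.apply (activeAfter l) := by simp [activeAfter]

theorem firstInsertions_snoc (l : List Update) (u : Update) :
    firstInsertions (l ++ [u]) = u.push (firstInsertions l) := by simp [firstInsertions]

theorem firstInsertions_nodup (l : List Update) : (firstInsertions l).Nodup := by
  induction l using List.reverseRecOn with
  | nil => exact List.nodup_nil
  | append_singleton l u ih =>
    rw [firstInsertions_snoc]
    cases u with
    | ins v =>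
      rw [Update.push]
      split_ifs with h
      · exact ih
      · rw [List.nodup_append]
        exact ⟨ih, by simp, fun a ha b hb => by
          rw [List.mem_singleton.1 hb]; rintro rfl; exact h ha⟩
    | del v => exact ih

theorem toFinset_push (L : List ℕ) (u : Update) : (u.push L).toFinset = u.record L.toFinset := by
  cases u with
  | ins v =>
    rw [Update.push, Update.record]
    split_ifs with h
    · rw [Finset.insert_eq_of_mem (by simpa using h)]
    · ext; simp
  | del v => rfl

theorem firstInsertions_prefix (l l' : List Update) :
    firstInsertions l <+: firstInsertions (l ++ l') := by
  induction l' using List.reverseRecOn with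
  | nil => rw [List.append_nil]
  | append_singleton l' u ih =>
    rw [← List.append_assoc, firstInsertions_snoc]
    refine ih.trans ?_
    cases u with
    | ins v =>
      rw [Update.push]
      split_ifs
      · exact List.prefix_rfl
      · exact List.prefix_append _ _
    | del v => exact List.prefix_rfl

/-- The vertex that is inserted first as number `i` has the rank number `i` of the random source. -/
def DrawnBy (ω π : ℕ → I) (l : List Update) : Prop :=
  ∀ i v, (firstInsertions l)[i]? = some v → π v = ω i

theorem DrawnBy.init {l' : List Update} (h : DrawnBy ω π (l ++ l')) : DrawnBy ω π l := by
  obtain ⟨r, hr⟩ := firstInsertions_prefix l l'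
  intro i v hi
  refine h i v ?_
  rw [← hr, List.getElem?_append_left (List.getElem?_eq_some_iff.1 hi).1, hi]

theorem ValidStream.init (h : ValidStream (l ++ [u])) : ValidStream l := fun t ht => by
  have := h t (by rw [List.length_append]; omega)
  rwa [List.getElem_append_left ht, List.take_append_of_le_length ht.le] at this

theorem ValidStream.last (h : ValidStream (l ++ [u])) : u.Admissible (activeAfter l) := by
  have := h l.length (by simp)
  simpa using this

theorem ValidStream.take (h : ValidStream l) (t : ℕ) : ValidStream (l.take t) := fun i hi => by
  rw [List.length_take, lt_min_iff] at hi
  have := h i hi.2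
  rwa [List.getElem_take, List.take_take, min_eq_left hi.1.le]

theorem atRest_initState (G : SimpleGraph ℕ) (π : ℕ → I) (k : ℕ) :
    AtRest G π k (initState k) ∅ ∅ [] ∅ where
  param := rfl
  sub := subset_rfl
  rank := by simp
  seen := by simp [initState]
  drawn := rfl
  heap := by
    refine ⟨⟨?_, ?_, ?_, ?_, ?_, ?_⟩, ⟨?_, ?_⟩, ?_⟩ <;> simp [initState, HeapOrd] <;> omega
  clusters := by simp [Clusters]
  rest := by
    refine ⟨⟨?_, ?_, ?_, ?_, ?_, ?_, ?_, ?_⟩, ?_, ?_, .inl rfl⟩ <;> simp [initState, Indep]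
  list := by intro P x L e; simp at e
  len := rfl

/-- The number of vertices whose eliminator changes with the update number `t`. -/
noncomputable def changes (G : SimpleGraph ℕ) (π : ℕ → I) (l : List Update) (t : ℕ) : ℕ :=
  (elimDiff G π (activeAfter (l.take t)) (activeAfter (l.take (t + 1)))).card

theorem exists_runs (hπ : π.Injective) (hl : ValidStream l)
    (hN : ∀ t ≤ l.length, (activeAfter (l.take t)).card < 2 ^ N)
    (hω : DrawnBy ω π l) :
    ∃ s T S Q, Runs mainProg k G ω l s T ∧
      AtRest G π k s (activeAfter l) (firstInsertions l).toFinset S Q ∧ s.var 3 = min k S.length ∧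
      T + (40 * k + 37 * N + 140) * (Q.card + 2 * (wrong G π (activeAfter l) (s.arr 1)).card) ≤
        (40 * k + 37 * N + 140) * ∑ t ∈ Finset.range l.length, (5 * changes G π l t + 4) := by
  induction l using List.reverseRecOn with
  | nil =>
    refine ⟨initState k, 0, [], ∅, .nil, ?_, ?_, ?_⟩
    · simpa [activeAfter, firstInsertions] using atRest_initState G π k
    · simp [initState]
    · simp [wrong, activeAfter, initState]
  | append_singleton l u ih =>
    rw [firstInsertions_snoc]
    obtain ⟨s, T, S, Q, h1, h2, -, h3⟩ := ih hl.init (fun t ht => by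
      have := hN t (by rw [List.length_append]; omega)
      rwa [List.take_append_of_le_length ht] at this) hω.init
    have hA : (activeAfter l).card < 2 ^ N := by simpa using hN l.length (by simp)
    have hA' : (u.apply (activeAfter l)).card < 2 ^ N := by
      have := hN (l ++ [u]).length le_rfl
      rwa [List.take_length, activeAfter_snoc] at this
    obtain ⟨s', T', S', Q', h4, h5, h6, h7⟩ := h2.exec_main (ω := ω) hπ hl.last hA hA' (by
      rintro v rfl hv
      rw [List.mem_toFinset] at hv
      rw [h2.drawn, List.toFinset_card_of_nodup (firstInsertions_nodup l)]
      refine (hω _ v ?_).symm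
      rw [firstInsertions_snoc, Update.push, if_neg hv]
      simp)
    rw [← activeAfter_snoc] at h4
    refine ⟨s', T + T', S', Q', .snoc h1 h4, ?_, h6, ?_⟩
    · rw [activeAfter_snoc, toFinset_push]; exact h5
    · have hsum : ∑ t ∈ Finset.range l.length, (5 * changes G π (l ++ [u]) t + 4) =
          ∑ t ∈ Finset.range l.length, (5 * changes G π l t + 4) := by
        refine Finset.sum_congr rfl fun t ht => ?_
        rw [Finset.mem_range] at ht
        rw [changes, changes, List.take_append_of_le_length ht.le, List.take_append_of_le_length ht]
      have hlast : changes G π (l ++ [u]) l.length =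
          (elimDiff G π (activeAfter l) (u.apply (activeAfter l))).card := by
        rw [changes, List.take_left' rfl, List.take_of_length_le (by simp), activeAfter_snoc]
      rw [List.length_append, List.length_singleton, Finset.sum_range_succ, hsum, hlast,
        activeAfter_snoc]
      simp only [mul_add] at h3 h7 ⊢
      omega

theorem maintains_mainProg (hπ : π.Injective) (hl : ValidStream l)
    (hω : DrawnBy ω π l) :
    Maintains mainProg k G l ω π := by
  intro t ht
  rw [← List.take_append_drop t l] at hω
  obtain ⟨s, T, S, Q, h1, h2, h3, -⟩ := exists_runs (k := k) (G := G) (l := l.take t) (ω := ω)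
    (N := ∑ i ∈ Finset.range (l.length + 1), (activeAfter (l.take i)).card) hπ (hl.take t)
    (fun i hi => by
      rw [List.length_take] at hi
      rw [List.take_take]
      refine (Finset.single_le_sum (f := fun i => (activeAfter (l.take i)).card)
        (fun _ _ => Nat.zero_le _) (Finset.mem_range.2 ?_)).trans_lt Nat.lt_two_pow_self
      omega)
    hω.init
  have hout : s.outList = S.take k := by
    have := h2.list
    rw [← List.take_append_drop k S] at this
    rw [MState.outList, h3, ← this.take.map_range, List.length_take]
  refine ⟨s, T, h1, ?_, ?_⟩
  · rw [hout]; exact h2.rest.core.nodup.sublist (List.take_sublist _ _)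
  · rw [hout]; exact h2.rest.isTopLFMISWithLeaders hπ

end Streams

section Expectation

variable {G : SimpleGraph ℕ} {k N n : ℕ} {l : List Update}

theorem lintegral_changes_le (G : SimpleGraph ℕ) {l : List Update} (hl : ValidStream l)
    (hA : ∀ t ≤ l.length, (activeAfter (l.take t)).card ≤ n) {t : ℕ} (ht : t < l.length) :
    ∃ f : (ℕ → I) → ℝ≥0∞, Measurable f ∧
      (∀ π, Function.Injective π → (changes G π l t : ℝ≥0∞) ≤ f π) ∧
      ∫⁻ π, f π ∂uniformSeq ≤ ENNReal.ofReal (3 + Real.log n) := by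
  have hlog : ∀ {A : Finset ℕ} {v : ℕ}, v ∈ A → A.card ≤ n →
      ENNReal.ofReal (3 + Real.log A.card) ≤ ENNReal.ofReal (3 + Real.log n) := by
    intro A v hv hA
    have : 0 < A.card := Finset.card_pos.2 ⟨v, hv⟩
    refine ENNReal.ofReal_le_ofReal ?_
    have := Real.log_le_log (by exact_mod_cast this) (Nat.cast_le (α := ℝ).2 hA)
    linarith
  have hs : activeAfter (l.take (t + 1)) = (l[t]).apply (activeAfter (l.take t)) := by
    rw [← activeAfter_snoc, List.take_concat_get' l t ht]
  have h1 := hA t ht.le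
  have h2 := hA (t + 1) ht
  have had := hl t ht
  simp only [changes]
  rw [hs] at h2 ⊢
  generalize l[t] = u at *
  generalize activeAfter (l.take t) = A at *
  cases u with
  | ins v =>
    have had : v ∉ A := had
    have h2 : (insert v A).card ≤ n := h2
    obtain ⟨f, hf, hle, hint⟩ := lintegral_elimDiff_erase_le G (Finset.mem_insert_self v A)
    rw [Finset.erase_insert had] at hle
    refine ⟨f, hf, fun π hπ => ?_, hint.trans (hlog (Finset.mem_insert_self v A) h2)⟩
    rw [elimDiff_comm]
    exact hle π hπ
  | del v =>
    obtain ⟨f, hf, hle, hint⟩ := lintegral_elimDiff_erase_le G (A := A) (v := v) had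
    exact ⟨f, hf, hle, hint.trans (hlog had h1)⟩

theorem time_bound_le (k M : ℕ) (hn : 2 ≤ n) :
    ((40 * k + 37 * (Nat.log 2 n + 1) + 140 : ℕ) : ℝ) * (M * (5 * (3 + Real.log n) + 4)) ≤
      11000 * M * (k * Real.log n + Real.log n ^ 2) := by
  have h2 := Real.log_two_gt_d9
  have hlog : Real.log 2 ≤ Real.log n := Real.log_le_log (by norm_num) (by exact_mod_cast hn)
  have hN : (Nat.log 2 n : ℝ) * Real.log 2 ≤ Real.log n := by
    rw [← Real.log_pow]
    refine Real.log_le_log (by positivity) ?_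
    exact_mod_cast Nat.pow_log_le_self 2 (by omega)
  obtain ⟨x, hx⟩ : ∃ x, x = Real.log n := ⟨_, rfl⟩
  rw [← hx] at hlog hN ⊢
  have hx0 : 0.69 ≤ x := by linarith
  have hN' : (Nat.log 2 n : ℝ) ≤ 1.45 * x := by
    have : (0 : ℝ) ≤ Nat.log 2 n := Nat.cast_nonneg _
    nlinarith
  have e1 : ((40 * k + 37 * (Nat.log 2 n + 1) + 140 : ℕ) : ℝ) ≤ 40 * k + 311 * x := by
    push_cast
    linarith
  have e2 : 5 * (3 + x) + 4 ≤ 33 * x := by linarith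
  have hk : (0 : ℝ) ≤ k := Nat.cast_nonneg _
  have hM : (0 : ℝ) ≤ M := Nat.cast_nonneg _
  calc ((40 * k + 37 * (Nat.log 2 n + 1) + 140 : ℕ) : ℝ) * (M * (5 * (3 + x) + 4))
      ≤ (40 * k + 311 * x) * (M * (33 * x)) := by gcongr
    _ = M * (1320 * (k * x) + 10263 * x ^ 2) := by ring
    _ ≤ M * (11000 * (k * x) + 11000 * x ^ 2) := by gcongr <;> norm_num
    _ = 11000 * M * (k * x + x ^ 2) := by ring

end Expectation

theorem mainTheorem6 :
    ∃ (P : Prog) (C : ℝ), ∀ (k : ℕ) (G : SimpleGraph ℕ) (l : List Update),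
      1 ≤ k → ValidStream l →
        (∃ π : (ℕ → I) → (ℕ → I), MeasurePreserving π uniformSeq uniformSeq ∧
          ∀ᵐ ω ∂uniformSeq, Maintains P k G l ω (π ω)) ∧
        ∀ n : ℕ, 2 ≤ n → (∀ t ≤ l.length, (activeAfter (l.take t)).card ≤ n) →
          ∫⁻ ω, totalTime P k G l ω ∂uniformSeq ≤
            ENNReal.ofReal (C * l.length * (k * Real.log n + Real.log n ^ 2)) := by
  refine ⟨mainProg, 11000, fun k G l _ hl => ?_⟩
  obtain ⟨e, he⟩ := exists_perm_map_eq (firstInsertions_nodup l)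
    (List.nodup_range (n := (firstInsertions l).length)) (by simp)
  have hmp := measurePreserving_reindex e
  have hinj : ∀ᵐ ω ∂uniformSeq, Function.Injective fun v : ℕ => (ω (e v) : I) :=
    ae_injective.mono fun ω hω => hω.comp e.injective
  have hdrawn : ∀ ω : ℕ → I, DrawnBy ω (fun v => ω (e v)) l := by
    intro ω i v hi
    obtain ⟨hlt, hv⟩ := List.getElem?_eq_some_iff.1 hi
    have := congrArg (·[i]?) he
    simp [hlt, hv] at this
    exact congrArg ω this
  refine ⟨⟨_, hmp, hinj.mono fun ω hω => maintains_mainProg hω hl (hdrawn ω)⟩, fun n hn hA => ?_⟩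
  obtain ⟨N, hN⟩ : ∃ N, N = Nat.log 2 n + 1 := ⟨_, rfl⟩
  have hnN : n < 2 ^ N := by rw [hN]; exact Nat.lt_pow_succ_log_self (by norm_num) n
  have hf : ∀ t : ℕ, ∃ f : (ℕ → I) → ℝ≥0∞, Measurable f ∧ (t < l.length →
      (∀ π, Function.Injective π → (changes G π l t : ℝ≥0∞) ≤ f π) ∧
      ∫⁻ π, f π ∂uniformSeq ≤ ENNReal.ofReal (3 + Real.log n)) := fun t => by
    by_cases ht : t < l.length
    · obtain ⟨f, h1, h2, h3⟩ := lintegral_changes_le G hl hA ht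
      exact ⟨f, h1, fun _ => ⟨h2, h3⟩⟩
    · exact ⟨0, measurable_zero, fun h => absurd h ht⟩
  choose f hfm hf using hf
  have hlog : 0 ≤ Real.log n := Real.log_natCast_nonneg n
  calc ∫⁻ ω, totalTime mainProg k G l ω ∂uniformSeq
      ≤ ∫⁻ ω, ((40 * k + 37 * N + 140 : ℕ) : ℝ≥0∞) *
          ∑ t ∈ Finset.range l.length, (5 * f t (fun v => ω (e v)) + 4) ∂uniformSeq := by
        refine lintegral_mono_ae (hinj.mono fun ω hω => ?_)
        obtain ⟨s, T, S, Q, h1, -, -, h2⟩ := exists_runs (k := k) (G := G) (N := N) hω hl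
          (fun t ht => (hA t ht).trans_lt hnN) (hdrawn ω)
        have h3 : T ≤ (40 * k + 37 * N + 140) * ∑ t ∈ Finset.range l.length,
            (5 * changes G (fun v => ω (e v)) l t + 4) := le_trans le_self_add h2
        refine (iInf₂_le T ⟨s, h1⟩).trans ((Nat.cast_le.2 h3).trans ?_)
        rw [Nat.cast_mul, Nat.cast_sum]
        gcongr with t ht
        push_cast
        gcongr
        exact (hf t (Finset.mem_range.1 ht)).1 _ hω
    _ = ((40 * k + 37 * N + 140 : ℕ) : ℝ≥0∞) * ∑ t ∈ Finset.range l.length,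
          (5 * ∫⁻ π, f t π ∂uniformSeq + 4) := by
        have hm : ∀ t, Measurable fun ω : ℕ → I => f t (fun v => ω (e v)) := fun t =>
          (hfm t).comp hmp.measurable
        rw [lintegral_const_mul _ (by fun_prop), lintegral_finsetSum _ (by fun_prop)]
        congr 1
        refine Finset.sum_congr rfl fun t _ => ?_
        rw [lintegral_add_right _ measurable_const, lintegral_const_mul _ (hm t),
          hmp.lintegral_comp (hfm t)]
        simp
    _ ≤ ((40 * k + 37 * N + 140 : ℕ) : ℝ≥0∞) * ∑ t ∈ Finset.range l.length,
          ENNReal.ofReal (5 * (3 + Real.log n) + 4) := by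
        gcongr with t ht
        rw [ENNReal.ofReal_add (by positivity) (by norm_num), ENNReal.ofReal_mul (by norm_num)]
        gcongr
        · simp
        · exact (hf t (Finset.mem_range.1 ht)).2
        · simp
    _ = ENNReal.ofReal (((40 * k + 37 * N + 140 : ℕ) : ℝ) *
          (l.length * (5 * (3 + Real.log n) + 4))) := by
        rw [Finset.sum_const, Finset.card_range, nsmul_eq_mul,
          ENNReal.ofReal_mul (Nat.cast_nonneg _), ENNReal.ofReal_mul (Nat.cast_nonneg _),
          ENNReal.ofReal_natCast, ENNReal.ofReal_natCast]
    _ ≤ ENNReal.ofReal (11000 * l.length * (k * Real.log n + Real.log n ^ 2)) := by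
        refine ENNReal.ofReal_le_ofReal ?_
        rw [hN]
        exact time_bound_le k l.length hn
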